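/- Let $(X(p))_{p\text{ prime}}$ be independent random variables on a probability space, each uniformly distributed on the unit circle of $\mathbb{C}$, and let $$L(1,X)=\prod_p\Big(1-\frac{X(p)}{p}\Big)^{-1}=\lim_{N\to\infty}\prod_{p\le N}\Big(1-\frac{X(p)}{p}\Big)^{-1},$$ a limit that exists with probability $1$. Let $\gamma$ be Euler's constant, let $I_0(t)=\sum_{n\ge 0}(t/2)^{2n}/n!^2$, and put $$C=\int_0^2\log I_0(t)\,\frac{dt}{t^2}+\int_2^\infty\big(\log I_0(t)-t\big)\,\frac{dt}{t^2}.$$ For $\tau\ge 1$ define $$\Phi(\tau)=\mathrm{Prob}\big(|L(1,X)|\ge e^{\gamma}\tau\big),\qquad \Psi(\tau)=\mathrm{Prob}\Big(|L(1,X)|\le\frac{\pi^2}{6e^{\gamma}\tau}\Big).$$ Then, uniformly for all real $\tau\ge 1$ (with no upper limit on $\tau$, and with an absolute implied constant), $$\Phi(\tau)=\exp\Big(-\frac{2e^{\tau-C-1}}{\tau}\big(1+O(\tau^{-1/2})\big)\Big),$$ and the same asymptotic holds for $\Psi(\tau)$. Moreover, for every complex number $z$ the random variable $|L(1,X)|^{2z}$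 is integrable and $$\mathbb{E}\big(|L(1,X)|^{2z}\big)=\sum_{n\ge 1}\frac{d_z(n)^2}{n^2},$$ where the series converges absolutely and $d_z$ is the multiplicative function with $d_z(p^a)=z(z+1)\cdots(z+a-1)/a!$ for $p$ prime and $a\ge 0$. -/

import Mathlib

open MeasureTheory ProbabilityTheory Filter Topology

noncomputable section

namespace RandomEuler

/-- The Bessel function `I₀(t) = ∑ (t/2)^{2n} / n!²`, which is the expectation of `exp(Re(tX))`
for `X` uniform on the unit circle. -/
def besselI0 (t : ℝ) : ℝ :=
  ∑' n : ℕ, (t / 2) ^ (2 * n) / (n.factorial : ℝ) ^ 2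

/-- The constant `C = ∫₀² log I₀(t) dt/t² + ∫₂^∞ (log I₀(t) - t) dt/t²`.
Both integrals converge absolutely. -/
def constC : ℝ :=
  (∫ t in Set.Ioc (0 : ℝ) 2, Real.log (besselI0 t) / t ^ 2) +
    ∫ t in Set.Ioi (2 : ℝ), (Real.log (besselI0 t) - t) / t ^ 2

/-- The uniform probability measure on the unit circle of `ℂ`: the law of `e^{iθ}` with `θ`
uniform on `(0, 2π]`. -/
def unifCircle : Measure ℂ :=
  Measure.map (fun θ : ℝ => Complex.exp (θ * Complex.I))
    (ProbabilityTheory.cond volume (Set.Ioc (0 : ℝ) (2 * Real.pi)))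

/-- `(X p)`, `p` prime, is a family of independent random variables, each of them uniformly
distributed on the unit circle. -/
structure IsSteinhaus {Ω : Type*} [MeasurableSpace Ω] (μ : Measure Ω)
    (X : Nat.Primes → Ω → ℂ) : Prop where
  hasLaw : ∀ p, HasLaw (X p) unifCircle μ
  indep : iIndepFun X μ

/-- The partial Euler product `∏_{p ≤ N} (1 - X(p)/p)⁻¹`. -/
def partialProd {Ω : Type*} (X : Nat.Primes → Ω → ℂ) (N : ℕ) (ω : Ω) : ℂ :=
  ∏ n ∈ Finset.range (N + 1),
    if hn : n.Prime then (1 - X ⟨n, hn⟩ ω / (n : ℂ))⁻¹ else 1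

/-- The random Euler product `L(1,X) = ∏_p (1 - X(p)/p)⁻¹`, the primes taken in increasing order
(the convergence is only conditional), that is, the limit of the partial products.
It has an unspecified value where that limit does not exist. -/
def L1 {Ω : Type*} (X : Nat.Primes → Ω → ℂ) (ω : Ω) : ℂ :=
  limUnder atTop (fun N : ℕ => partialProd X N ω)

/-- The generalized divisor function: `d_z(n)` is multiplicative in `n` and
`d_z(p^a) = z (z+1) ⋯ (z+a-1) / a!`, so that `ζ(s)^z = ∑ d_z(n) n^{-s}` for `Re s > 1`. -/
def dz (z : ℂ) (n : ℕ) : ℂ :=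
  if n = 0 then 0
  else n.factorization.prod fun _ a => (ascPochhammer ℂ a).eval z / (a.factorial : ℂ)

/-- `Φ(τ) = Prob(|L(1,X)| ≥ e^γ τ)`. -/
def Phi {Ω : Type*} [MeasurableSpace Ω] (μ : Measure Ω) (X : Nat.Primes → Ω → ℂ) (τ : ℝ) : ℝ :=
  μ.real {ω | Real.exp Real.eulerMascheroniConstant * τ ≤ ‖L1 X ω‖}

/-- `Ψ(τ) = Prob(|L(1,X)| ≤ π² / (6 e^γ τ))`. -/
def Psi {Ω : Type*} [MeasurableSpace Ω] (μ : Measure Ω) (X : Nat.Primes → Ω → ℂ) (τ : ℝ) : ℝ :=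
  μ.real {ω | ‖L1 X ω‖ ≤ Real.pi ^ 2 / (6 * Real.exp Real.eulerMascheroniConstant * τ)}

/-- The value `P` equals `exp(-(2 e^{τ-C-1}/τ) (1 + E))` for some real `E` with
`|E| ≤ A τ^{-1/2}`. -/
def HasAsymptotic (A τ P : ℝ) : Prop :=
  ∃ E : ℝ, |E| ≤ A / √τ ∧ P = Real.exp (-(2 * Real.exp (τ - constC - 1) / τ) * (1 + E))

end RandomEuler

end

/-! Let ε = 1 for the upper tail and ε = -1 for the lower one, and put Y = ε log |L(1,X)|. By
independence the logarithm of E e^{kY} is the sum over primes of log E|1 - X(p)/p|^{-εk}. For large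
p the factor 1 - X(p)/p may be linearised and the summand is log I₀(k/p) + O(k/p²). For small p the
variable X(p) is pushed towards ε and the summand is k·w(p) + O(log k), where w(p) = -ε log(1 -
ε/p). With β(t) = log I₀(t)/t, both regimes are described by k·w(p)·β(k/p), and the total error is
negligible (`abs_logMoment_sub_le`).

The function β increases from 0 to 1 on (0,∞), so β' is a probability density, and the sum of
w(p)β(k/p) equals the integral of β'(t) times the sum of w(p) over p ≤ k/t
(`tsum_eulerWeight_mul_besselSlope`). Mertens' theorem with error O(1/log² x)
(`exists_eulerSum_sub_le`) turns this into log log k + a + b/log k + O(1/log² k), where a is γ or γ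
- log(π²/6). The coefficient b is minus the integral of β'(t) log t, which integration by parts
identifies as C - log 2. The result is `exists_tsum_logMoment_sub_le`.

An error O(1/log² x) in Mertens' theorem is needed, and it is proved from the zeta function. The
3-4-1 inequality together with growth bounds for (s-1)ζ(s) shows that the second derivative of its
logarithmic derivative is O(1 + |t|) to the right of Re s = 1. A Tauberian argument
(`abs_sub_cube_le`) converts this into an asymptotic formula for the sums of Λ(n) log² n / n, and
partial summation gives the rest. The constant γ is found by comparing with log ζ(1 + δ) as δ → 0.

For the tails, take k = e^{τ-b-1+y}. After centring at a + log τ the cumulant generating function is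
K e^y (y-1) + O(K/τ) with K = e^{τ-b-1}/τ = 2e^{τ-C-1}/τ (`saddle_expansion`). Markov's inequality
at y = 0 bounds the probability above. Tilting at y of order τ^{-1/2}, where the tilted mass sits at
positive values, bounds it below (`prob_nonneg_bounds`). Bounded τ is absorbed into the constant.

For the moments, Parseval's identity on the circle applied to (1 - X/p)^{-z} gives each Euler
factor. The partial products have bounded moments of every real order, which gives uniform
integrability and hence convergence of moments (`IsSteinhaus.tendsto_integral_cpow`). Absolute
convergence of the series follows by comparison with a real z ≥ 1, where the partial sums are at
most finite products of local moments. -/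

namespace ZetaBound

/-! ### Growth of (s-1)ζ(s) and its derivatives for Re s near 1. -/

/-- The difference `(s-1)(n^{-s} - ∫_n^{n+1} x^{-s} dx)`. -/
noncomputable def blockTerm (n : ℕ) (s : ℂ) : ℂ :=
  (s - 1) * (n : ℂ) ^ (-s) + ((n + 1 : ℕ) : ℂ) ^ (1 - s) - (n : ℂ) ^ (1 - s)

/-- A geometric mean, with weights 1-β and β, of the trivial bound 2n^{-σ} and the mean value bound
|s|n^{-σ-1}. Each extra power n^{-β} of decay costs only |s|^β, so β can be kept small. -/
lemma norm_cpow_sub_cpow_le {n x : ℝ} (hn : 1 ≤ n) (hx : n ≤ x) (hx1 : x ≤ n + 1) {s : ℂ}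
    (hs : 0 < s.re) {β : ℝ} (hβ : 0 < β) (hβ1 : β < 1) :
    ‖(n : ℂ) ^ (-s) - (x : ℂ) ^ (-s)‖ ≤ 2 * ‖s‖ ^ β * n ^ (-s.re - β) := by
  have hn0 : 0 < n := by linarith
  have hx0 : 0 < x := by linarith
  set a := n ^ (-s.re) with ha
  set b := ‖s‖ * n ^ (-s.re - 1) with hb
  have ha0 : 0 < a := Real.rpow_pos_of_pos hn0 _
  have h1 : ‖(n : ℂ) ^ (-s) - (x : ℂ) ^ (-s)‖ ≤ 2 * a := by
    refine (norm_sub_le _ _).trans ?_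
    rw [Complex.norm_cpow_eq_rpow_re_of_pos hn0, Complex.norm_cpow_eq_rpow_re_of_pos hx0]
    have : x ^ (-s.re) ≤ n ^ (-s.re) :=
      Real.rpow_le_rpow_of_nonpos hn0 hx (by linarith)
    simp only [Complex.neg_re]
    linarith
  have h2 : ‖(n : ℂ) ^ (-s) - (x : ℂ) ^ (-s)‖ ≤ b := by
    have hder : ∀ y ∈ Set.Icc n (n + 1), HasDerivWithinAt (fun y : ℝ => (y : ℂ) ^ (-s))
        (-s * (y : ℂ) ^ (-s - 1)) (Set.Icc n (n + 1)) y := by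
      intro y hy
      have hy0 : 0 < y := by linarith [hy.1]
      have hs0 : -s ≠ 0 := by
        intro h
        rw [neg_eq_zero] at h
        simp [h] at hs
      exact (hasDerivAt_ofReal_cpow_const hy0.ne' hs0).hasDerivWithinAt
    have := Convex.norm_image_sub_le_of_norm_hasDerivWithin_le (C := b) hder (by
      intro y hy
      have hy0 : 0 < y := by linarith [hy.1]
      rw [norm_mul, norm_neg, Complex.norm_cpow_eq_rpow_re_of_pos hy0]
      simp only [Complex.sub_re, Complex.neg_re, Complex.one_re, hb]
      gcongr ?_ * ?_
      exact Real.rpow_le_rpow_of_nonpos hn0 hy.1 (by linarith)) (convex_Icc _ _)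
      (⟨hx, hx1⟩ : x ∈ Set.Icc n (n + 1)) (⟨le_refl _, by linarith⟩ : n ∈ Set.Icc n (n + 1))
    refine this.trans ?_
    have h4 : ‖n - x‖ ≤ 1 := by rw [Real.norm_eq_abs, abs_le]; constructor <;> linarith
    have hb0 : 0 ≤ b := by positivity
    nlinarith
  set q := ‖(n : ℂ) ^ (-s) - (x : ℂ) ^ (-s)‖ with hq
  have hq0 : 0 ≤ q := norm_nonneg _
  have hqq : q = q ^ (1 - β) * q ^ β := by
    rcases hq0.eq_or_lt with h | h
    · rw [← h, Real.zero_rpow (by linarith), Real.zero_rpow hβ.ne', zero_mul]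
    · rw [← Real.rpow_add h]; simp
  rw [hqq]
  calc q ^ (1 - β) * q ^ β ≤ (2 * a) ^ (1 - β) * b ^ β := by
        gcongr
    _ = 2 ^ (1 - β) * ‖s‖ ^ β * (a ^ (1 - β) * (n ^ (-s.re - 1)) ^ β) := by
        rw [Real.mul_rpow (by norm_num) ha0.le, hb, Real.mul_rpow (norm_nonneg _) (by positivity)]
        ring
    _ = 2 ^ (1 - β) * ‖s‖ ^ β * n ^ (-s.re - β) := by
        rw [ha, ← Real.rpow_mul hn0.le, ← Real.rpow_mul hn0.le, ← Real.rpow_add hn0]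
        ring_nf
    _ ≤ 2 ^ (1 : ℝ) * ‖s‖ ^ β * n ^ (-s.re - β) := by
        gcongr
        · norm_num
        · linarith
    _ = _ := by simp

/-- The block term is the increment over [n, n+1] of y ↦ (s-1)n^{-s}(y-n) + y^{1-s}, whose
derivative is (s-1)(n^{-s} - y^{-s}). -/
lemma norm_blockTerm_le {n : ℕ} (hn : 1 ≤ n) {s : ℂ}
    (hs : 0 < s.re) {β : ℝ} (hβ : 0 < β) (hβ1 : β < 1) :
    ‖blockTerm n s‖ ≤ ‖s - 1‖ * (2 * ‖s‖ ^ β * (n : ℝ) ^ (-s.re - β)) := by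
  have hn1 : (1 : ℝ) ≤ n := by exact_mod_cast hn
  by_cases hs1 : s = 1
  · subst hs1; simp [blockTerm]
  have hder : ∀ y ∈ Set.Icc (n : ℝ) (n + 1), HasDerivWithinAt
      (fun y : ℝ => (s - 1) * (n : ℂ) ^ (-s) * ((y : ℂ) - n) + (y : ℂ) ^ (1 - s))
      ((s - 1) * ((n : ℂ) ^ (-s) - (y : ℂ) ^ (-s))) (Set.Icc (n : ℝ) (n + 1)) y := by
    intro y hy
    have hy0 : 0 < y := by linarith [hy.1]
    have hs0 : 1 - s ≠ 0 := sub_ne_zero_of_ne (Ne.symm hs1)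
    have h3 := hasDerivAt_ofReal_cpow_const hy0.ne' hs0
    have h4 := ((Complex.ofRealCLM.hasDerivAt (x := y)).sub_const (n : ℂ)).const_mul
      ((s - 1) * (n : ℂ) ^ (-s))
    have h5 := (h4.add h3).hasDerivWithinAt (s := Set.Icc (n : ℝ) (n + 1))
    convert! h5 using 1
    have h6 : (1 - s - 1 : ℂ) = -s := by ring
    simp only [Complex.ofRealCLM_apply, Complex.ofReal_one, h6]
    ring
  have := Convex.norm_image_sub_le_of_norm_hasDerivWithin_le
      (C := ‖s - 1‖ * (2 * ‖s‖ ^ β * (n : ℝ) ^ (-s.re - β))) hder (by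
      intro y hy
      rw [norm_mul]
      gcongr
      exact_mod_cast norm_cpow_sub_cpow_le hn1 hy.1 hy.2 hs hβ hβ1) (convex_Icc _ _)
      (⟨le_refl _, by linarith⟩ : (n : ℝ) ∈ Set.Icc (n : ℝ) (n + 1))
      (⟨by linarith, le_refl _⟩ : (n : ℝ) + 1 ∈ Set.Icc (n : ℝ) (n + 1))
  simp only [add_sub_cancel_left, norm_one, mul_one] at this
  refine le_trans (le_of_eq ?_) this
  congr 1
  simp [blockTerm]
  try ring

lemma differentiable_blockTerm {n : ℕ} (hn : 1 ≤ n) : Differentiable ℂ (blockTerm n) := by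
  have h1 : (n : ℂ) ≠ 0 := by exact_mod_cast (by omega : n ≠ 0)
  have h2 : ((n + 1 : ℕ) : ℂ) ≠ 0 := by exact_mod_cast (by omega : n + 1 ≠ 0)
  unfold blockTerm
  intro s
  have e1 : DifferentiableAt ℂ (fun s : ℂ => (n : ℂ) ^ (-s)) s :=
    DifferentiableAt.const_cpow (by fun_prop) (Or.inl h1)
  have e2 : DifferentiableAt ℂ (fun s : ℂ => ((n + 1 : ℕ) : ℂ) ^ (1 - s)) s :=
    DifferentiableAt.const_cpow (by fun_prop) (Or.inl h2)
  have e3 : DifferentiableAt ℂ (fun s : ℂ => (n : ℂ) ^ (1 - s)) s :=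
    DifferentiableAt.const_cpow (by fun_prop) (Or.inl h1)
  fun_prop

lemma summable_shift_rpow {p : ℝ} (hp : p < -1) : Summable fun n : ℕ => ((n + 1 : ℕ) : ℝ) ^ p :=
  (summable_nat_add_iff 1).2 (Real.summable_nat_rpow.2 hp)

lemma hasSum_blockTerm_of_one_lt {s : ℂ} (hs : 1 < s.re) :
    HasSum (fun n : ℕ => blockTerm (n + 1) s) (riemannZeta₁ s - 1) := by
  have hs1 : s ≠ 1 := by rintro rfl; simp at hs
  have h1 : HasSum (fun n : ℕ => 1 / ((n : ℂ) + 1) ^ s) (riemannZeta s) := by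
    rw [zeta_eq_tsum_one_div_nat_add_one_cpow hs]
    have := (Complex.summable_one_div_nat_cpow (p := s)).2 hs
    have := (summable_nat_add_iff 1).2 this
    exact (by simpa using this : Summable fun n : ℕ => 1 / ((n : ℂ) + 1) ^ s).hasSum
  have h2 : HasSum (fun n : ℕ => ((n + 1 + 1 : ℕ) : ℂ) ^ (1 - s) - ((n + 1 : ℕ) : ℂ) ^ (1 - s))
      (0 - 1) := by
    -- Unconditional summability of the telescoping series is needed before its value can be read
    -- off partial sums. It holds because each term is a block term minus (s-1) times a term of the
    -- zeta series.
    have hsm : Summable (fun n : ℕ => ((n + 1 + 1 : ℕ) : ℂ) ^ (1 - s) - ((n + 1 : ℕ) : ℂ) ^ (1 - s)) := by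
      have hb : Summable fun n : ℕ => ‖s - 1‖ * (2 * ‖s‖ ^ (1 / 2 : ℝ) * ((n + 1 : ℕ) : ℝ) ^ (-s.re - 1 / 2)) +
          ‖s - 1‖ * ((n + 1 : ℕ) : ℝ) ^ (-s.re) := by
        refine Summable.add (Summable.mul_left _ (Summable.mul_left _ ?_)) (Summable.mul_left _ ?_) <;>
        exact summable_shift_rpow (by linarith)
      refine Summable.of_norm_bounded hb fun n => ?_
      have hb1 := norm_blockTerm_le (n := n + 1) (by omega) (s := s) (by linarith) (β := 1 / 2)
        (by norm_num) (by norm_num)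
      have : ((n + 1 + 1 : ℕ) : ℂ) ^ (1 - s) - ((n + 1 : ℕ) : ℂ) ^ (1 - s) = blockTerm (n + 1) s -
        (s - 1) * ((n + 1 : ℕ) : ℂ) ^ (-s) := by
        simp only [blockTerm]; ring
      rw [this]
      refine (norm_sub_le _ _).trans (add_le_add hb1 ?_)
      rw [norm_mul]
      gcongr
      rw [← Complex.ofReal_natCast, Complex.norm_cpow_eq_rpow_re_of_pos (by positivity)]
      simp
    refine (hsm.hasSum_iff_tendsto_nat).2 ?_
    have : ∀ N, ∑ n ∈ Finset.range N, (((n + 1 + 1 : ℕ) : ℂ) ^ (1 - s) - ((n + 1 : ℕ) : ℂ) ^ (1 - s)) =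
        ((N + 1 : ℕ) : ℂ) ^ (1 - s) - 1 := by
      intro N
      rw [Finset.sum_range_sub (fun n => ((n + 1 : ℕ) : ℂ) ^ (1 - s))]
      simp
    simp_rw [this]
    refine Tendsto.sub_const ?_ _
    rw [tendsto_zero_iff_norm_tendsto_zero]
    have h3 : ∀ N : ℕ, ‖((N + 1 : ℕ) : ℂ) ^ (1 - s)‖ = ((N + 1 : ℕ) : ℝ) ^ (-(s.re - 1)) := by
      intro N
      rw [← Complex.ofReal_natCast, Complex.norm_cpow_eq_rpow_re_of_pos (by positivity)]
      simp
    simp_rw [h3]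
    exact ((tendsto_rpow_neg_atTop (by linarith)).comp tendsto_natCast_atTop_atTop).comp
      (tendsto_add_atTop_nat 1)
  have h3 := (h1.mul_left (s - 1)).add h2
  convert! h3 using 1
  · ext n
    simp only [blockTerm, Complex.cpow_neg]
    push_cast
    ring
  · rw [riemannZeta_eq_inv_sub_mul hs1]
    have : s - 1 ≠ 0 := sub_ne_zero_of_ne hs1
    field_simp
    ring

/-- Both sides are analytic on Re s > 0 and agree near 2, so the identity theorem applies. -/
lemma riemannZeta₁_eq {s : ℂ} (hs : 0 < s.re) :
    riemannZeta₁ s = 1 + ∑' n : ℕ, blockTerm (n + 1) s := by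
  have hdiff : DifferentiableOn ℂ (fun s => 1 + ∑' n : ℕ, blockTerm (n + 1) s) {s | 0 < s.re} := by
    refine DifferentiableOn.const_add _ ?_
    intro s₀ (hs₀ : 0 < s₀.re)
    set U := {s : ℂ | s₀.re / 2 < s.re} ∩ Metric.ball 0 (‖s₀‖ + 1) with hU
    have hUo : IsOpen U := (isOpen_lt continuous_const Complex.continuous_re).inter Metric.isOpen_ball
    have hmem : s₀ ∈ U := ⟨by simp only [Set.mem_ofPred_eq]; linarith, by simp⟩
    -- On the neighbourhood Re s > Re s₀/2 this β makes the exponent -Re s - β at most -1 - Re s₀/4,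
    -- so the majorant is summable.
    set β : ℝ := 1 - min (s₀.re / 4) (1 / 2) with hβ
    have hm0 : 0 < min (s₀.re / 4) (1 / 2) := lt_min (by linarith) (by norm_num)
    have hm1 : min (s₀.re / 4) (1 / 2) ≤ 1 / 2 := min_le_right _ _
    have hm2 : min (s₀.re / 4) (1 / 2) ≤ s₀.re / 4 := min_le_left _ _
    have := Complex.differentiableOn_tsum_of_summable_norm (F := fun n : ℕ => blockTerm (n + 1))
      (u := fun n : ℕ => (‖s₀‖ + 2) * (2 * (‖s₀‖ + 1) ^ β *
        ((n + 1 : ℕ) : ℝ) ^ (-(s₀.re / 2) - β))) (U := U)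
      (Summable.mul_left _ (Summable.mul_left _ (summable_shift_rpow (by linarith))))
      (fun n => (differentiable_blockTerm (by omega)).differentiableOn) hUo (by
        intro n w hw
        have hw1 : s₀.re / 2 < w.re := hw.1
        have hw2 : ‖w‖ < ‖s₀‖ + 1 := by simpa using hw.2
        refine (norm_blockTerm_le (by omega) (by linarith) (β := β) (by linarith) (by linarith)).trans ?_
        have : ‖w - 1‖ ≤ ‖s₀‖ + 2 := (norm_sub_le _ _).trans (by rw [norm_one]; linarith)
        gcongr
        · linarith
        · simp)
    exact ((this s₀ hmem).differentiableAt (hUo.mem_nhds hmem)).differentiableWithinAt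
  have hopen : IsOpen {s : ℂ | 0 < s.re} := isOpen_lt continuous_const Complex.continuous_re
  have hA := (differentiable_riemannZeta₁.differentiableOn (s := {s : ℂ | 0 < s.re})).analyticOnNhd hopen
  have hB := hdiff.analyticOnNhd hopen
  have hpre : IsPreconnected {s : ℂ | 0 < s.re} := (convex_halfSpace_re_gt 0).isPreconnected
  refine hA.eqOn_of_preconnected_of_eventuallyEq hB hpre (z₀ := 2) (by simp) ?_ hs
  have : {s : ℂ | 1 < s.re} ∈ 𝓝 (2 : ℂ) :=
    (isOpen_lt continuous_const Complex.continuous_re).mem_nhds (by simp)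
  filter_upwards [this] with w hw
  rw [(hasSum_blockTerm_of_one_lt hw).tsum_eq]; ring

lemma norm_riemannZeta₁_le {β : ℝ} (hβ : 0 < β) (hβ1 : β < 1) :
    ∃ C : ℝ, 0 < C ∧ ∀ s : ℂ, 1 - β / 2 ≤ s.re → ‖riemannZeta₁ s‖ ≤ C * (1 + ‖s‖) ^ (1 + β) := by
  set S := ∑' n : ℕ, ((n + 1 : ℕ) : ℝ) ^ (-(1 + β / 2)) with hS
  have hsm : Summable fun n : ℕ => ((n + 1 : ℕ) : ℝ) ^ (-(1 + β / 2)) :=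
    summable_shift_rpow (by linarith)
  have hS0 : 0 ≤ S := tsum_nonneg fun n => by positivity
  refine ⟨1 + 2 * S, by positivity, fun s hs => ?_⟩
  have hre : 0 < s.re := by linarith
  rw [riemannZeta₁_eq hre]
  have hb : ∀ n : ℕ, ‖blockTerm (n + 1) s‖ ≤ (‖s - 1‖ * (2 * ‖s‖ ^ β)) * ((n + 1 : ℕ) : ℝ) ^ (-(1 + β / 2)) := by
    intro n
    refine (norm_blockTerm_le (by omega) hre hβ hβ1).trans ?_
    rw [← mul_assoc]
    gcongr
    · simp
    · linarith
  have h1 : ‖∑' n : ℕ, blockTerm (n + 1) s‖ ≤ (‖s - 1‖ * (2 * ‖s‖ ^ β)) * S :=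
    tsum_of_norm_bounded (hsm.hasSum.mul_left _) hb
  have h2 : ‖s - 1‖ ≤ 1 + ‖s‖ := (norm_sub_le _ _).trans (by rw [norm_one]; linarith)
  have h3 : (1 : ℝ) ≤ (1 + ‖s‖) ^ (1 + β) :=
    Real.one_le_rpow (by linarith [norm_nonneg s]) (by linarith)
  have h4 : (1 + ‖s‖) ^ (1 + β) = (1 + ‖s‖) * (1 + ‖s‖) ^ β := by
    rw [Real.rpow_add (by positivity), Real.rpow_one]
  calc _ ≤ ‖(1 : ℂ)‖ + (‖s - 1‖ * (2 * ‖s‖ ^ β)) * S := (norm_add_le _ _).trans (by gcongr)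
    _ ≤ 1 * (1 + ‖s‖) ^ (1 + β) + ((1 + ‖s‖) * (2 * (1 + ‖s‖) ^ β)) * S := by
      rw [norm_one]
      gcongr
      · linarith
      · linarith
    _ = _ := by rw [h4]; ring

/-- Cauchy's estimate on a circle of radius β/2, which stays inside the half plane Re s ≥ 1 - β/2
where the growth bound holds. -/
lemma norm_iteratedDeriv_riemannZeta₁_le {β : ℝ} (hβ : 0 < β) (hβ1 : β < 1) (j : ℕ) :
    ∃ C : ℝ, 0 < C ∧ ∀ s : ℂ, 1 ≤ s.re →
      ‖iteratedDeriv j riemannZeta₁ s‖ ≤ C * ‖s‖ ^ (1 + β) := by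
  obtain ⟨C, hC, h⟩ := norm_riemannZeta₁_le hβ hβ1
  refine ⟨j.factorial * (C * 3 ^ (1 + β)) / (β / 2) ^ j, by positivity, fun s hs => ?_⟩
  have hs1 : 1 ≤ ‖s‖ := hs.trans (Complex.re_le_norm s)
  have := Complex.norm_iteratedDeriv_le_of_forall_mem_sphere_norm_le j (c := s) (R := β / 2)
    (C := C * (3 * ‖s‖) ^ (1 + β)) (f := riemannZeta₁) (by positivity)
    (differentiable_riemannZeta₁.diffContOnCl) (by
      intro z hz
      have hz' : ‖z - s‖ = β / 2 := by simpa [dist_eq_norm] using hz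
      have h1 : |(z - s).re| ≤ ‖z - s‖ := Complex.abs_re_le_norm _
      have h2 := (abs_le.1 h1).1
      simp only [Complex.sub_re] at h2
      refine (h z (by linarith)).trans ?_
      have h3 : ‖z‖ ≤ ‖z - s‖ + ‖s‖ := by simpa using norm_add_le (z - s) s
      gcongr
      linarith)
  refine this.trans (le_of_eq ?_)
  rw [Real.mul_rpow (by norm_num) (norm_nonneg _)]
  ring

end ZetaBound

/-! ### Lower bounds for (s-1)ζ(s) to the right of Re s = 1, and the logarithmic derivative. -/

namespace ZetaBound

lemma riemannZeta₁_eq_mul {s : ℂ} (hs : s ≠ 1) : riemannZeta₁ s = (s - 1) * riemannZeta s := by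
  rw [riemannZeta_eq_inv_sub_mul hs]
  field_simp [sub_ne_zero_of_ne hs]

lemma one_le_norm_riemannZeta_product {x : ℝ} (hx : 0 < x) (y : ℝ) :
    1 ≤ ‖riemannZeta (1 + x)‖ ^ 3 * ‖riemannZeta (1 + x + Complex.I * y)‖ ^ 4 *
      ‖riemannZeta (1 + x + 2 * Complex.I * y)‖ := by
  have := DirichletCharacter.norm_LFunction_product_ge_one (N := 1) (1 : DirichletCharacter ℂ 1) hx y
  simpa [DirichletCharacter.LFunctionTrivChar, DirichletCharacter.LFunction_modOne_eq] using this

lemma riemannZeta₁_ne_zero {s : ℂ} (hs : 1 ≤ s.re) : riemannZeta₁ s ≠ 0 := by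
  by_cases h : s = 1
  · simp [h]
  · rw [riemannZeta₁_eq_mul h]
    exact mul_ne_zero (sub_ne_zero_of_ne h) (riemannZeta_ne_zero_of_one_le_re hs)

/-- In the 3-4-1 inequality insert ζ(1+x) = O(1/x) and ζ(1+x+2it) = O(|t|^β), then take fourth
roots. The bound degenerates as x → 0, hence the need for `le_norm_riemannZeta₁`. -/
lemma le_norm_riemannZeta₁_of_far {β : ℝ} (hβ : 0 < β) (hβ1 : β < 1) :
    ∃ c : ℝ, 0 < c ∧ ∀ x t : ℝ, 0 < x → x ≤ 1 → 1 ≤ |t| →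
      c * x ^ (3 / 4 : ℝ) * |t| ^ (1 - β / 4) ≤ ‖riemannZeta₁ (1 + x + Complex.I * t)‖ := by
  obtain ⟨C, hC, hb⟩ := norm_riemannZeta₁_le hβ hβ1
  set A := C * 3 ^ (1 + β) with hA
  set B := C * 5 ^ (1 + β) with hB
  have hA0 : 0 < A := by positivity
  have hB0 : 0 < B := by positivity
  refine ⟨(A ^ 3 * B)⁻¹ ^ (1 / 4 : ℝ), by positivity, fun x t hx hx1 ht => ?_⟩
  have ht0 : t ≠ 0 := by rintro rfl; norm_num at ht
  have h := one_le_norm_riemannZeta_product hx t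
  have e0 : ‖riemannZeta (1 + x)‖ ≤ A / x := by
    have hne : (1 + x : ℂ) ≠ 1 := by
      simpa using hx.ne'
    rw [riemannZeta_eq_inv_sub_mul hne, norm_mul, norm_inv]
    have h1 := hb (1 + x) (by simp; linarith)
    have h2 : ‖(1 + x : ℂ)‖ ≤ 2 := by
      refine (norm_add_le _ _).trans ?_
      rw [norm_one, Complex.norm_real, Real.norm_eq_abs, abs_of_pos hx]; linarith
    have h3 : ‖(1 + x - 1 : ℂ)‖ = x := by simp [abs_of_pos hx]
    rw [h3, div_eq_inv_mul]
    gcongr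
    refine h1.trans ?_
    rw [hA]
    gcongr
    linarith
  have e2 : ‖riemannZeta (1 + x + 2 * Complex.I * t)‖ ≤ B * |t| ^ β := by
    have him : (1 + x + 2 * Complex.I * t - 1 : ℂ).im = 2 * t := by simp
    have hne : (1 + x + 2 * Complex.I * t : ℂ) ≠ 1 := by
      intro h
      rw [h] at him
      simp at him
      exact ht0 him
    rw [riemannZeta_eq_inv_sub_mul hne, norm_mul, norm_inv]
    have h1 := hb (1 + x + 2 * Complex.I * t) (by simp; linarith)
    have h2 : ‖(1 + x + 2 * Complex.I * t : ℂ)‖ ≤ 4 * |t| := by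
      refine (norm_add_le _ _).trans ?_
      have : ‖(1 + x : ℂ)‖ ≤ 2 := by
        refine (norm_add_le _ _).trans ?_
        rw [norm_one, Complex.norm_real, Real.norm_eq_abs, abs_of_pos hx]; linarith
      have h4 : ‖2 * Complex.I * (t : ℂ)‖ = 2 * |t| := by simp
      rw [h4]; linarith
    have h3 : |t| ≤ ‖(1 + x + 2 * Complex.I * t - 1 : ℂ)‖ := by
      refine le_trans ?_ (Complex.abs_im_le_norm _)
      rw [him, abs_mul]; norm_num; linarith
    have htp : 0 < |t| := by linarith
    have h5 : (1 + ‖(1 + x + 2 * Complex.I * t : ℂ)‖) ^ (1 + β) ≤ 5 ^ (1 + β) * (|t| * |t| ^ β) := by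
      rw [show |t| * |t| ^ β = |t| ^ (1 + β) by rw [Real.rpow_add htp, Real.rpow_one],
        ← Real.mul_rpow (by norm_num) htp.le]
      gcongr
      linarith
    calc _ ≤ |t|⁻¹ * (C * (5 ^ (1 + β) * (|t| * |t| ^ β))) := by
          gcongr
          exact h1.trans (by gcongr)
      _ = _ := by rw [hB]; field_simp
  have hne : (1 + x + Complex.I * t : ℂ) ≠ 1 := by
    intro h
    have him : (1 + x + Complex.I * t : ℂ).im = t := by simp
    rw [h] at him
    simp at him
    exact ht0 him.symm
  have hfin : (A ^ 3 * B)⁻¹ * x ^ 3 * |t| ^ (-β) ≤ ‖riemannZeta (1 + x + Complex.I * t)‖ ^ 4 := by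
    have htp : 0 < |t| := by linarith
    have h6 : 1 ≤ (A / x) ^ 3 * ‖riemannZeta (1 + x + Complex.I * t)‖ ^ 4 * (B * |t| ^ β) := by
      refine h.trans ?_
      gcongr
    rw [Real.rpow_neg htp.le]
    have : 0 < |t| ^ β := by positivity
    rw [inv_mul_eq_div, mul_inv_le_iff₀ this, div_le_iff₀ (by positivity)]
    rw [div_pow] at h6
    have h7 : 1 * x ^ 3 ≤ (A ^ 3 / x ^ 3 * ‖riemannZeta (1 + x + Complex.I * t)‖ ^ 4 * (B * |t| ^ β)) * x ^ 3 := by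
      gcongr
    refine (one_mul (x ^ 3)).symm.le.trans (h7.trans (le_of_eq ?_))
    field_simp
  rw [riemannZeta₁_eq_mul hne, norm_mul]
  have htp : 0 < |t| := by linarith
  have h8 : |t| ≤ ‖(1 + x + Complex.I * t - 1 : ℂ)‖ := by
    refine le_trans (le_of_eq ?_) (Complex.abs_im_le_norm _)
    simp
  have h9 : (A ^ 3 * B)⁻¹ ^ (1 / 4 : ℝ) * x ^ (3 / 4 : ℝ) * |t| ^ (-(β / 4)) ≤
      ‖riemannZeta (1 + x + Complex.I * t)‖ := by
    have := Real.rpow_le_rpow (z := 1 / 4) (by positivity) hfin (by norm_num)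
    rw [← Real.rpow_natCast ‖riemannZeta (1 + x + Complex.I * t)‖ 4, ← Real.rpow_mul (norm_nonneg _)] at this
    norm_num at this
    rw [Real.mul_rpow (by positivity) (by positivity), Real.mul_rpow (by positivity) (by positivity),
      ← Real.rpow_mul htp.le, ← Real.rpow_natCast x 3, ← Real.rpow_mul hx.le] at this
    norm_num at this ⊢
    convert this using 2
    ring_nf
  calc (A ^ 3 * B)⁻¹ ^ (1 / 4 : ℝ) * x ^ (3 / 4 : ℝ) * |t| ^ (1 - β / 4)
      = |t| * ((A ^ 3 * B)⁻¹ ^ (1 / 4 : ℝ) * x ^ (3 / 4 : ℝ) * |t| ^ (-(β / 4))) := by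
        rw [sub_eq_add_neg, Real.rpow_add htp, Real.rpow_one]; ring
    _ ≤ _ := by gcongr

/-- For x at least some x₀ the 3-4-1 bound suffices. For smaller x one moves horizontally to x₀, and
the derivative bound shows that at most half of the value is lost. -/
lemma le_norm_riemannZeta₁ {β : ℝ} (hβ : 0 < β) (hβ1 : β < 1) :
    ∃ c : ℝ, 0 < c ∧ ∀ x t : ℝ, 0 < x → x ≤ 1 → 1 ≤ |t| →
      c * |t| ^ (1 - 4 * β) ≤ ‖riemannZeta₁ (1 + x + Complex.I * t)‖ := by
  obtain ⟨c, hc, hfar⟩ := le_norm_riemannZeta₁_of_far hβ hβ1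
  obtain ⟨C, hC, hd⟩ := norm_iteratedDeriv_riemannZeta₁_le hβ hβ1 1
  set D := C * 3 ^ (1 + β) with hD
  have hD0 : 0 < D := by positivity
  set r := min (c / (2 * D)) 1 with hr
  have hr0 : 0 < r := by positivity
  have hr1 : r ≤ 1 := min_le_right _ _
  have hr2 : D * r ≤ c / 2 := by
    have : r ≤ c / (2 * D) := min_le_left _ _
    calc D * r ≤ D * (c / (2 * D)) := by gcongr
      _ = c / 2 := by field_simp
  refine ⟨c / 2 * r ^ 3, by positivity, fun x t hx hx1 ht => ?_⟩
  have htp : 0 < |t| := by linarith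
  set q := |t| ^ (-(5 / 4 * β)) with hq
  have hq0 : 0 < q := by positivity
  have hq1 : q ≤ 1 := Real.rpow_le_one_of_one_le_of_nonpos ht (by linarith)
  -- With x₀ = r⁴|t|^{-5β} the lower bound at x₀ is of order r³|t|^{1-4β} and the horizontal
  -- variation is of order r⁴|t|^{1-4β}. The powers of |t| match and the choice of r settles the
  -- constants.
  set x₀ := (r * q) ^ 4 with hx₀
  have hrq : 0 < r * q := by positivity
  have hrq1 : r * q ≤ 1 := mul_le_one₀ hr1 hq0.le hq1
  have hx₀0 : 0 < x₀ := by positivity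
  have hx₀1 : x₀ ≤ 1 := pow_le_one₀ hrq.le hrq1
  have hx₀34 : x₀ ^ (3 / 4 : ℝ) = (r * q) ^ 3 := by
    rw [hx₀, ← Real.rpow_natCast, ← Real.rpow_mul hrq.le, ← Real.rpow_natCast]
    norm_num
  have hq3 : q ^ 3 * |t| ^ (1 - β / 4) = |t| ^ (1 - 4 * β) := by
    rw [hq, ← Real.rpow_natCast, ← Real.rpow_mul htp.le, ← Real.rpow_add htp]
    congr 1; push_cast; ring
  have hq4 : q ^ 4 * |t| ^ (1 + β) = |t| ^ (1 - 4 * β) := by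
    rw [hq, ← Real.rpow_natCast, ← Real.rpow_mul htp.le, ← Real.rpow_add htp]
    congr 1; push_cast; ring
  rcases le_total x₀ x with h | h
  · refine le_trans ?_ (hfar x t hx hx1 ht)
    have : x₀ ^ (3 / 4 : ℝ) ≤ x ^ (3 / 4 : ℝ) := Real.rpow_le_rpow hx₀0.le h (by norm_num)
    calc c / 2 * r ^ 3 * |t| ^ (1 - 4 * β) = c / 2 * x₀ ^ (3 / 4 : ℝ) * |t| ^ (1 - β / 4) := by
          rw [hx₀34, ← hq3]; ring
      _ ≤ c * x ^ (3 / 4 : ℝ) * |t| ^ (1 - β / 4) := by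
        gcongr
        linarith
  · have h1 := hfar x₀ t hx₀0 hx₀1 ht
    have hder : ∀ y ∈ Set.Icc x x₀, HasDerivWithinAt
        (fun y : ℝ => riemannZeta₁ (1 + y + Complex.I * t))
        (deriv riemannZeta₁ (1 + y + Complex.I * t)) (Set.Icc x x₀) y := by
      intro y _
      have h2 : HasDerivAt (fun y : ℝ => (1 + y + Complex.I * t : ℂ)) 1 y := by
        simpa using ((Complex.ofRealCLM.hasDerivAt (x := y)).const_add 1).add_const (Complex.I * t)
      have := (differentiable_riemannZeta₁ (1 + y + Complex.I * t)).hasDerivAt.comp y h2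
      simpa using! this.hasDerivWithinAt
    have h3 := Convex.norm_image_sub_le_of_norm_hasDerivWithin_le (C := D * |t| ^ (1 + β)) hder (by
      intro y hy
      have hy0 : 0 < y := by linarith [hy.1]
      have hy1 : y ≤ 1 := by linarith [hy.2]
      have := hd (1 + y + Complex.I * t) (by simp; linarith)
      rw [iteratedDeriv_one] at this
      refine this.trans ?_
      rw [hD, mul_assoc, ← Real.mul_rpow (by norm_num) htp.le]
      gcongr
      calc ‖(1 + y + Complex.I * t : ℂ)‖ ≤ ‖(1 : ℂ)‖ + ‖(y : ℂ)‖ + ‖Complex.I * t‖ := norm_add₃_le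
        _ = 1 + y + |t| := by simp [abs_of_pos hy0]
        _ ≤ _ := by linarith) (convex_Icc _ _)
      (⟨le_refl _, h⟩ : x ∈ Set.Icc x x₀) (⟨h, le_refl _⟩ : x₀ ∈ Set.Icc x x₀)
    have h4 : D * |t| ^ (1 + β) * ‖x₀ - x‖ ≤ c / 2 * r ^ 3 * |t| ^ (1 - 4 * β) := by
      have : ‖x₀ - x‖ ≤ x₀ := by rw [Real.norm_eq_abs, abs_of_nonneg (by linarith)]; linarith
      calc _ ≤ D * |t| ^ (1 + β) * x₀ := by gcongr
        _ = (D * r) * r ^ 3 * |t| ^ (1 - 4 * β) := by rw [hx₀, ← hq4]; ring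
        _ ≤ _ := by gcongr
    have h5 : c * x₀ ^ (3 / 4 : ℝ) * |t| ^ (1 - β / 4) = c * r ^ 3 * |t| ^ (1 - 4 * β) := by
      rw [hx₀34, ← hq3]; ring
    rw [h5] at h1
    have h6 := norm_sub_norm_le (riemannZeta₁ (1 + x₀ + Complex.I * t)) (riemannZeta₁ (1 + x + Complex.I * t))
    linarith

lemma deriv_deriv_logDeriv_riemannZeta₁ {s : ℂ} (hs : riemannZeta₁ s ≠ 0) :
    deriv (deriv (logDeriv riemannZeta₁)) s =
      iteratedDeriv 3 riemannZeta₁ s / riemannZeta₁ s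
      - 3 * (iteratedDeriv 1 riemannZeta₁ s / riemannZeta₁ s) *
        (iteratedDeriv 2 riemannZeta₁ s / riemannZeta₁ s)
      + 2 * (iteratedDeriv 1 riemannZeta₁ s / riemannZeta₁ s) ^ 3 := by
  have hd : ∀ j, Differentiable ℂ (iteratedDeriv j riemannZeta₁) := fun j =>
    (differentiable_riemannZeta₁.contDiff (n := ⊤)).differentiable_iteratedDeriv j (by simp)
  have hD : ∀ j z, HasDerivAt (iteratedDeriv j riemannZeta₁) (iteratedDeriv (j + 1) riemannZeta₁ z) z := by
    intro j z
    rw [iteratedDeriv_succ]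
    exact (hd j z).hasDerivAt
  have hD0 : ∀ z, HasDerivAt riemannZeta₁ (iteratedDeriv 1 riemannZeta₁ z) z := by
    intro z; simpa using hD 0 z
  have hev : ∀ᶠ z in 𝓝 s, riemannZeta₁ z ≠ 0 :=
    differentiable_riemannZeta₁.continuous.continuousAt.eventually_ne hs
  have hlog : logDeriv riemannZeta₁ = fun z => iteratedDeriv 1 riemannZeta₁ z / riemannZeta₁ z := by
    ext z; rw [logDeriv_apply, iteratedDeriv_one]
  have h1 : deriv (logDeriv riemannZeta₁) =ᶠ[𝓝 s] fun z =>
      (iteratedDeriv 2 riemannZeta₁ z * riemannZeta₁ z - iteratedDeriv 1 riemannZeta₁ z *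
        iteratedDeriv 1 riemannZeta₁ z) / riemannZeta₁ z ^ 2 := by
    filter_upwards [hev] with z hz
    rw [hlog]
    exact ((hD 1 z).div (hD0 z) hz).deriv
  rw [h1.deriv_eq]
  have h2 := ((((hD 2 s).mul (hD0 s)).sub ((hD 1 s).mul (hD 1 s))).div ((hD0 s).pow 2)
    (pow_ne_zero 2 hs)).deriv
  refine Eq.trans ?_ (h2.trans ?_)
  · rfl
  · simp only [Pi.mul_apply, Pi.sub_apply, Pi.pow_apply]
    field_simp
    push_cast
    ring

/-- On the half plane `1 < re s ≤ 2`, the second derivative of the logarithmic derivative of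
`(s - 1) ζ(s)` grows at most linearly. -/
theorem norm_deriv_deriv_logDeriv_riemannZeta₁_le :
    ∃ K : ℝ, 0 < K ∧ ∀ x t : ℝ, 0 < x → x ≤ 1 →
      ‖deriv (deriv (logDeriv riemannZeta₁)) (1 + x + Complex.I * t)‖ ≤ K * (1 + |t|) := by
  -- Each quotient of a derivative by the function is O(|t|^{(1+β)-(1-4β)}) = O(|t|^{5β}). The
  -- choice β = 1/15 gives |t|^{1/3}, whose cube is the allowed |t|.
  have hβ : (0 : ℝ) < 1 / 15 := by norm_num
  have hβ1 : (1 / 15 : ℝ) < 1 := by norm_num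
  obtain ⟨c, hc, hlow⟩ := le_norm_riemannZeta₁ hβ hβ1
  obtain ⟨C1, hC1, hd1⟩ := norm_iteratedDeriv_riemannZeta₁_le hβ hβ1 1
  obtain ⟨C2, hC2, hd2⟩ := norm_iteratedDeriv_riemannZeta₁_le hβ hβ1 2
  obtain ⟨C3, hC3, hd3⟩ := norm_iteratedDeriv_riemannZeta₁_le hβ hβ1 3
  -- the compact part
  set S : Set ℂ := Set.Icc 1 2 ×ℂ Set.Icc (-1) 1 with hS
  have hScpt : IsCompact S := isCompact_Icc.reProdIm isCompact_Icc
  have hd : ∀ j, Differentiable ℂ (iteratedDeriv j riemannZeta₁) := fun j =>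
    (differentiable_riemannZeta₁.contDiff (n := ⊤)).differentiable_iteratedDeriv j (by simp)
  have hne : ∀ s ∈ S, riemannZeta₁ s ≠ 0 := fun s hs => riemannZeta₁_ne_zero hs.1.1
  have hcont : ContinuousOn (deriv (deriv (logDeriv riemannZeta₁))) S := by
    have : ContinuousOn (fun s => iteratedDeriv 3 riemannZeta₁ s / riemannZeta₁ s
      - 3 * (iteratedDeriv 1 riemannZeta₁ s / riemannZeta₁ s) *
        (iteratedDeriv 2 riemannZeta₁ s / riemannZeta₁ s)
      + 2 * (iteratedDeriv 1 riemannZeta₁ s / riemannZeta₁ s) ^ 3) S := by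
      have hq : ∀ j, ContinuousOn (fun s => iteratedDeriv j riemannZeta₁ s / riemannZeta₁ s) S :=
        fun j => (hd j).continuous.continuousOn.div
          differentiable_riemannZeta₁.continuous.continuousOn hne
      exact ((hq 3).sub ((continuousOn_const.mul (hq 1)).mul (hq 2))).add
        (continuousOn_const.mul ((hq 1).pow 3))
    exact this.congr fun s hs => deriv_deriv_logDeriv_riemannZeta₁ (hne s hs)
  obtain ⟨K0, hK0⟩ := hScpt.exists_bound_of_continuousOn hcont
  set E := 3 ^ (1 + 1 / 15 : ℝ) / c with hE
  have hE0 : 0 < E := by positivity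
  refine ⟨max K0 0 + (C3 * E + 3 * (C1 * E) * (C2 * E) + 2 * (C1 * E) ^ 3), by positivity,
    fun x t hx hx1 => ?_⟩
  set s : ℂ := 1 + x + Complex.I * t with hs
  have hre : s.re = 1 + x := by simp [hs]
  have him : s.im = t := by simp [hs]
  rcases le_total |t| 1 with ht | ht
  · have hmem : s ∈ S := by
      rw [hS, Complex.mem_reProdIm, hre, him]
      exact ⟨⟨by linarith, by linarith⟩, abs_le.1 ht⟩
    have h1 : K0 ≤ max K0 0 := le_max_left _ _
    have h2 : 0 ≤ C3 * E + 3 * (C1 * E) * (C2 * E) + 2 * (C1 * E) ^ 3 := by positivity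
    have h3 := hK0 s hmem
    have h4 : 0 ≤ max K0 0 := le_max_right _ _
    nlinarith [abs_nonneg t]
  · have htp : 0 < |t| := by linarith
    have hs0 : riemannZeta₁ s ≠ 0 := riemannZeta₁_ne_zero (by rw [hre]; linarith)
    have hns : ‖s‖ ≤ 3 * |t| := by
      calc ‖(1 + x + Complex.I * t : ℂ)‖ ≤ ‖(1 : ℂ)‖ + ‖(x : ℂ)‖ + ‖Complex.I * t‖ := norm_add₃_le
        _ = 1 + x + |t| := by simp [abs_of_pos hx]
        _ ≤ _ := by linarith
    have hl := hlow x t hx hx1 ht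
    have key : ∀ j C, 0 < C → ‖iteratedDeriv j riemannZeta₁ s‖ ≤ C * ‖s‖ ^ (1 + 1 / 15 : ℝ) →
        ‖iteratedDeriv j riemannZeta₁ s / riemannZeta₁ s‖ ≤ C * E * |t| ^ (1 / 3 : ℝ) := by
      intro j C hC h
      rw [norm_div, div_le_iff₀ (by positivity)]
      have e1 : |t| ^ (1 + 1 / 15 : ℝ) = |t| ^ (1 / 3 : ℝ) * |t| ^ (1 - 4 * (1 / 15) : ℝ) := by
        rw [← Real.rpow_add htp]; norm_num
      calc _ ≤ C * (3 * |t|) ^ (1 + 1 / 15 : ℝ) := h.trans (by gcongr)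
        _ = C * E * |t| ^ (1 / 3 : ℝ) * (c * |t| ^ (1 - 4 * (1 / 15) : ℝ)) := by
          rw [Real.mul_rpow (by norm_num) htp.le, e1, hE]
          field_simp
        _ ≤ _ := by gcongr
    have hsre : 1 ≤ s.re := by rw [hre]; linarith
    have k1 := key 1 C1 hC1 (hd1 s hsre)
    have k2 := key 2 C2 hC2 (hd2 s hsre)
    have k3 := key 3 C3 hC3 (hd3 s hsre)
    rw [deriv_deriv_logDeriv_riemannZeta₁ hs0]
    set w := |t| ^ (1 / 3 : ℝ) with hw
    have hw3 : w ^ 3 = |t| := by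
      rw [hw, ← Real.rpow_natCast, ← Real.rpow_mul htp.le]; norm_num
    have hw1 : 1 ≤ w := Real.one_le_rpow ht (by norm_num)
    have hw_le : w ≤ |t| := by rw [← hw3]; nlinarith [sq_nonneg w, mul_self_nonneg (w - 1)]
    have hw2_le : w ^ 2 ≤ |t| := by rw [← hw3]; nlinarith [sq_nonneg w]
    calc _ ≤ ‖iteratedDeriv 3 riemannZeta₁ s / riemannZeta₁ s‖
          + 3 * ‖iteratedDeriv 1 riemannZeta₁ s / riemannZeta₁ s‖ *
            ‖iteratedDeriv 2 riemannZeta₁ s / riemannZeta₁ s‖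
          + 2 * ‖iteratedDeriv 1 riemannZeta₁ s / riemannZeta₁ s‖ ^ 3 := by
          refine (norm_add_le _ _).trans (add_le_add ((norm_sub_le _ _).trans ?_) ?_)
          · rw [norm_mul, norm_mul]; simp
          · rw [norm_mul, norm_pow]; simp
      _ ≤ C3 * E * w + 3 * (C1 * E * w) * (C2 * E * w) + 2 * (C1 * E * w) ^ 3 := by gcongr
      _ = C3 * E * w + 3 * (C1 * E) * (C2 * E) * w ^ 2 + 2 * (C1 * E) ^ 3 * w ^ 3 := by ring
      _ ≤ C3 * E * |t| + 3 * (C1 * E) * (C2 * E) * |t| + 2 * (C1 * E) ^ 3 * |t| := by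
          rw [← hw3] at hw_le hw2_le ⊢
          gcongr
      _ = (0 + (C3 * E + 3 * (C1 * E) * (C2 * E) + 2 * (C1 * E) ^ 3)) * |t| := by ring
      _ ≤ _ := by
          gcongr
          · exact le_max_right _ _
          · linarith

end ZetaBound

/-! ### A Tauberian theorem with error term. -/

namespace Tauberian

open scoped FourierTransform ContDiff in
/-- A smooth bump on `(0,1)` written as a Fourier integral. -/
lemma exists_bump : ∃ (g : ℝ → ℝ) (G : ℝ → ℂ) (B : ℝ), Continuous g ∧ (∀ v, 0 ≤ g v) ∧
    (∀ v, g v ≠ 0 → 0 < v ∧ v < 1) ∧ 1 / 2 ≤ (∫ v, g v) ∧ Continuous G ∧ Integrable G ∧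
    (∀ w, ‖G w‖ ≤ B) ∧ ∀ v : ℝ, (g v : ℂ) = ∫ w : ℝ, G w * Complex.exp (2 * Real.pi * v * w * Complex.I) := by
  let b : ContDiffBump (1 / 2 : ℝ) := ⟨1 / 4, 1 / 2, by norm_num, by norm_num⟩
  have hb : ContDiff ℝ ∞ (fun v => (b v : ℂ)) := Complex.ofRealCLM.contDiff.comp b.contDiff
  have hbc : HasCompactSupport (fun v => (b v : ℂ)) :=
    b.hasCompactSupport.comp_left (g := fun x : ℝ => (x : ℂ)) (by simp)
  set f := hbc.toSchwartzMap hb with hf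
  have hfa : ∀ v, f v = (b v : ℂ) := fun v => rfl
  refine ⟨b, (𝓕 f : SchwartzMap ℝ ℂ), ‖(SchwartzMap.toLp f 1 volume)‖, b.continuous, fun v => b.nonneg, ?_, ?_, (𝓕 f : SchwartzMap ℝ ℂ).continuous,
    (𝓕 f : SchwartzMap ℝ ℂ).integrable, fun w => SchwartzMap.norm_fourier_apply_le_toLp_one f w, ?_⟩
  · intro v hv
    have : v ∈ Function.support b := hv
    rw [b.support_eq, Metric.mem_ball, Real.dist_eq, abs_lt] at this
    have h1 : b.rOut = 1 / 2 := rfl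
    rw [h1] at this
    constructor <;> linarith [this.1, this.2]
  · have h1 : ∫ v in Set.Icc (1 / 4 : ℝ) (3 / 4), (1 : ℝ) = 1 / 2 := by
      simp; norm_num
    refine h1.symm.le.trans ?_
    refine (setIntegral_mono_on (by simp) (b.continuous.integrable_of_hasCompactSupport b.hasCompactSupport).integrableOn measurableSet_Icc ?_).trans
      (setIntegral_le_integral (b.continuous.integrable_of_hasCompactSupport b.hasCompactSupport)
        (ae_of_all _ fun v => b.nonneg))
    intro v hv
    rw [b.one_of_mem_closedBall]
    rw [Metric.mem_closedBall, Real.dist_eq, abs_le]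
    have h1 : b.rIn = 1 / 4 := rfl
    rw [h1]
    constructor <;> linarith [hv.1, hv.2]
  · intro v
    have : 𝓕⁻ (𝓕 (f : ℝ → ℂ)) v = f v := by
      have h0 := f.continuous.fourierInv_fourier_eq f.integrable (𝓕 f : SchwartzMap ℝ ℂ).integrable
      exact congrFun h0 v
    rw [← hfa, ← this, Real.fourierInv_eq', SchwartzMap.fourier_coe]
    congr 1
    ext w
    rw [smul_eq_mul, mul_comm]
    congr 2
    simp
    ring

/-- Fubini: averages against a rescaled bump in terms of the Laplace transform. -/
lemma integral_mul_bump {G : ℝ → ℂ} {g : ℝ → ℝ} (hG : Integrable G)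
    (hgG : ∀ v : ℝ, (g v : ℂ) = ∫ w : ℝ, G w * Complex.exp (2 * Real.pi * v * w * Complex.I))
    {f : ℝ → ℂ} (hf : IntegrableOn f (Set.Ioi 0)) (u₁ N : ℝ) :
    ∫ u in Set.Ioi (0 : ℝ), f u * (g ((u - u₁) * N) : ℂ) =
      ∫ w : ℝ, G w * Complex.exp (-(2 * Real.pi * u₁ * N * w * Complex.I)) *
        ∫ u in Set.Ioi (0 : ℝ), f u * Complex.exp (2 * Real.pi * N * w * u * Complex.I) := by
  have h1 : ∀ u w : ℝ, f u * (G w * Complex.exp (2 * Real.pi * ((u - u₁) * N : ℝ) * w * Complex.I)) =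
      G w * Complex.exp (-(2 * Real.pi * u₁ * N * w * Complex.I)) *
      (f u * Complex.exp (2 * Real.pi * N * w * u * Complex.I)) := by
    intro u w
    have : Complex.exp (2 * Real.pi * ((u - u₁) * N : ℝ) * w * Complex.I) =
      Complex.exp (-(2 * Real.pi * u₁ * N * w * Complex.I)) *
        Complex.exp (2 * Real.pi * N * w * u * Complex.I) := by
      rw [← Complex.exp_add]; congr 1; push_cast; ring
    rw [this]; ring
  simp_rw [hgG, ← integral_const_mul, h1]
  rw [integral_integral_swap]
  have hprod := hf.mul_prod hG
  have hnorm : ∀ r : ℝ, ‖Complex.exp (r * Complex.I)‖ = 1 := Complex.norm_exp_ofReal_mul_I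
  refine (hprod.bdd_mul (c := 1) (f := fun z : ℝ × ℝ => Complex.exp (((2 * Real.pi * ((z.1 - u₁) * N) * z.2 : ℝ) : ℂ) * Complex.I)) ?_ ?_).congr ?_
  · exact (by fun_prop : Continuous _).aestronglyMeasurable
  · exact ae_of_all _ fun z => (hnorm _).le
  · refine ae_of_all _ fun z => ?_
    simp only [Function.uncurry]
    rw [← h1]
    push_cast
    ring

/-- The bound does not depend on N. In the frequency t = 2πNw, the range |w| ≤ 1/N has length 2/N
and there the Laplace transform is O(N). Outside it |t| ≥ 1, so the quotient (1+|t|)/|1/N - it| is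
at most 2. -/
lemma norm_integral_mul_bump_le {G : ℝ → ℂ} {g : ℝ → ℝ} {B K N : ℝ} 
    (hG : Integrable G) (hGB : ∀ w, ‖G w‖ ≤ B)
    (hgG : ∀ v : ℝ, (g v : ℂ) = ∫ w : ℝ, G w * Complex.exp (2 * Real.pi * v * w * Complex.I))
    {f : ℝ → ℂ} (hf : IntegrableOn f (Set.Ioi 0)) (u₁ : ℝ) (hN : 1 ≤ N) (hK : 0 ≤ K)
    (hL : ∀ t : ℝ, ‖∫ u in Set.Ioi (0 : ℝ), f u * Complex.exp (t * u * Complex.I)‖ ≤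
      K * (1 + |t|) / ‖(1 / N - t * Complex.I : ℂ)‖) :
    ‖∫ u in Set.Ioi (0 : ℝ), f u * (g ((u - u₁) * N) : ℂ)‖ ≤
      K * (2 * B + 2 * ∫ w, ‖G w‖) := by
  rw [integral_mul_bump hG hgG hf]
  have hN0 : 0 < N := by linarith
  have hB0 : 0 ≤ B := (norm_nonneg _).trans (hGB 0)
  have hbound : ∀ w : ℝ, ‖G w * Complex.exp (-(2 * Real.pi * u₁ * N * w * Complex.I)) *
        ∫ u in Set.Ioi (0 : ℝ), f u * Complex.exp (2 * Real.pi * N * w * u * Complex.I)‖ ≤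
      K * (Set.indicator (Set.Icc (-(1 / N)) (1 / N)) (fun _ => B * N) w + 2 * ‖G w‖) := by
    intro w
    have he : ‖Complex.exp (-(2 * Real.pi * u₁ * N * w * Complex.I))‖ = 1 := by
      have := Complex.norm_exp_ofReal_mul_I (-(2 * Real.pi * u₁ * N * w))
      rw [← this]; congr 2; push_cast; ring
    rw [norm_mul, norm_mul, he, mul_one]
    set t : ℝ := 2 * Real.pi * N * w with ht
    have hLt := hL t
    have hcast : ∀ u : ℝ, (2 * Real.pi * N * w * u * Complex.I : ℂ) = (t * u * Complex.I : ℂ) := by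
      intro u; rw [ht]; push_cast; ring
    simp_rw [hcast]
    set z : ℂ := (1 / N - t * Complex.I : ℂ) with hz
    have hzre : z.re = 1 / N := by
      have : (1 / (N : ℂ)).re = 1 / N := by rw [← Complex.ofReal_one, ← Complex.ofReal_div, Complex.ofReal_re]
      rw [hz, Complex.sub_re, this]; simp
    have hzim : z.im = -t := by
      have : (1 / (N : ℂ)).im = 0 := by rw [← Complex.ofReal_one, ← Complex.ofReal_div, Complex.ofReal_im]
      rw [hz, Complex.sub_im, this]; simp
    have hz1 : 1 / N ≤ ‖z‖ := by rw [← hzre]; exact Complex.re_le_norm z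
    have hz2 : |t| ≤ ‖z‖ := by
      have := Complex.abs_im_le_norm z
      rwa [hzim, abs_neg] at this
    have hz0 : 0 < ‖z‖ := lt_of_lt_of_le (by positivity) hz1
    have h2 : K * (1 + |t|) / ‖z‖ ≤ K * (1 / ‖z‖ + 1) := by
      rw [mul_div_assoc, add_div]
      gcongr
      exact (div_le_one hz0).2 hz2
    have h3 : ‖G w‖ * (1 / ‖z‖) ≤ Set.indicator (Set.Icc (-(1 / N)) (1 / N)) (fun _ => B * N) w + ‖G w‖ := by
      by_cases hw : w ∈ Set.Icc (-(1 / N)) (1 / N)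
      · rw [Set.indicator_of_mem hw]
        have : 1 / ‖z‖ ≤ N := by
          rw [div_le_iff₀ hz0]
          calc 1 = N * (1 / N) := by field_simp
            _ ≤ _ := by gcongr
        have := mul_le_mul (hGB w) this (by positivity) hB0
        linarith [norm_nonneg (G w)]
      · rw [Set.indicator_of_notMem hw, zero_add]
        have hw' : 1 / N ≤ |w| := by
          by_contra hcon
          push Not at hcon
          exact hw (abs_le.1 hcon.le)
        have h4 : 1 ≤ |t| := by
          rw [ht, abs_mul, abs_of_pos (by positivity : 0 < 2 * Real.pi * N)]
          have : 1 ≤ N * |w| := by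
            calc 1 = N * (1 / N) := by field_simp
              _ ≤ _ := by gcongr
          have hpi := Real.pi_gt_three
          nlinarith
        have : 1 / ‖z‖ ≤ 1 := by
          rw [div_le_one hz0]; linarith
        exact mul_le_of_le_one_right (norm_nonneg _) this
    calc _ ≤ ‖G w‖ * (K * (1 / ‖z‖ + 1)) := by gcongr; exact hLt.trans h2
      _ = K * (‖G w‖ * (1 / ‖z‖) + ‖G w‖) := by ring
      _ ≤ K * ((Set.indicator (Set.Icc (-(1 / N)) (1 / N)) (fun _ => B * N) w + ‖G w‖) + ‖G w‖) := by gcongr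
      _ = _ := by ring
  have hint1 : Integrable (Set.indicator (Set.Icc (-(1 / N)) (1 / N)) (fun _ : ℝ => B * N)) := by
    rw [integrable_indicator_iff measurableSet_Icc]
    exact integrableOn_const (by simp)
  have hint : Integrable (fun w => K * (Set.indicator (Set.Icc (-(1 / N)) (1 / N)) (fun _ => B * N) w + 2 * ‖G w‖)) :=
    (hint1.add (hG.norm.const_mul 2)).const_mul K
  refine (norm_integral_le_of_norm_le hint (ae_of_all _ hbound)).trans (le_of_eq ?_)
  rw [integral_const_mul, integral_add hint1 (hG.norm.const_mul 2), integral_indicator measurableSet_Icc,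
    integral_const_mul (2 : ℝ)]
  congr 2
  simp only [one_div, integral_const, MeasurableSet.univ, measureReal_restrict_apply,
    Set.univ_inter, Real.volume_real_Icc, sub_neg_eq_add, smul_eq_mul]
  rw [max_eq_left (by positivity)]
  field_simp
  ring

lemma integral_bump_scale {g : ℝ → ℝ} (hg : ∀ v, g v ≠ 0 → 0 < v ∧ v < 1) {u₁ N : ℝ}
    (hu₁ : 0 ≤ u₁) (hN : 0 < N) :
    ∫ u in Set.Ioi (0 : ℝ), g ((u - u₁) * N) = (∫ v, g v) / N := by
  have h1 : ∫ u in Set.Ioi (0 : ℝ), g ((u - u₁) * N) = ∫ u, g ((u - u₁) * N) := by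
    refine setIntegral_eq_integral_of_forall_compl_eq_zero fun u hu => ?_
    by_contra hne
    have := (hg _ hne).1
    have h2 : u - u₁ ≤ 0 := by
      have : u ≤ 0 := by simpa using hu
      linarith
    nlinarith
  rw [h1, integral_sub_right_eq_self (fun u => g (u * N)) u₁, Measure.integral_comp_mul_right]
  rw [abs_of_pos (inv_pos.2 hN), smul_eq_mul]
  field_simp

/-- Test against a bump on a window of length 1/N with N = u. The smoothed integral is O(1), so the
average of A(v) - v³/3 over the window is O(u). On such a window v³/3 changes by O(u), and
monotonicity of A passes from the average to the value at an endpoint. -/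
theorem abs_sub_cube_le {A : ℝ → ℝ} (hA : Monotone A) {K : ℝ} (hK : 0 ≤ K)
    (hint : ∀ δ : ℝ, 0 < δ → IntegrableOn (fun u => (A u - u ^ 3 / 3) * Real.exp (-(δ * u))) (Set.Ioi 0))
    (hF : ∀ δ t : ℝ, 0 < δ → δ ≤ 1 →
      ‖∫ u in Set.Ioi (0 : ℝ), ((A u - u ^ 3 / 3 : ℝ) : ℂ) * Complex.exp (-((δ - t * Complex.I) * u))‖ ≤
        K * (1 + |t|) / ‖(δ - t * Complex.I : ℂ)‖) :
    ∃ C : ℝ, 0 < C ∧ ∀ u : ℝ, 1 ≤ u → |A u - u ^ 3 / 3| ≤ C * u := by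
  obtain ⟨g, G, B, hgc, hg0, hgs, hgi, -, hG, hGB, hgG⟩ := exists_bump
  set M := K * (2 * B + 2 * ∫ w, ‖G w‖) with hM
  have hB0 : 0 ≤ B := (norm_nonneg _).trans (hGB 0)
  have hM0 : 0 ≤ M := by
    have : 0 ≤ ∫ w, ‖G w‖ := integral_nonneg fun _ => norm_nonneg _
    positivity
  have hg_le : ∃ b, ∀ v, g v ≤ b := by
    have hcs : HasCompactSupport g := by
      refine HasCompactSupport.intro (isCompact_Icc (a := (0 : ℝ)) (b := 1)) fun v hv => ?_
      by_contra hne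
      exact hv ⟨(hgs v hne).1.le, (hgs v hne).2.le⟩
    obtain ⟨x, hx⟩ := hgc.exists_forall_ge_of_hasCompactSupport hcs
    exact ⟨g x, hx⟩
  obtain ⟨b, hb⟩ := hg_le
  -- the smoothed bound
  have hsm : ∀ N u₁ : ℝ, 1 ≤ N →
      |∫ u in Set.Ioi (0 : ℝ), ((A u - u ^ 3 / 3) * Real.exp (-(1 / N * u))) * g ((u - u₁) * N)| ≤ M := by
    intro N u₁ hN
    have hN0 : 0 < N := by linarith
    have hfi := hint (1 / N) (by positivity)
    have hfi' : IntegrableOn (fun u : ℝ => (((A u - u ^ 3 / 3) * Real.exp (-(1 / N * u)) : ℝ) : ℂ)) (Set.Ioi 0) :=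
      hfi.ofReal
    have := norm_integral_mul_bump_le hG hGB hgG hfi' u₁ hN hK (by
      intro t
      have h1 := hF (1 / N) t (by positivity) (by rw [div_le_one hN0]; exact hN)
      have e : ∀ u : ℝ, (((A u - u ^ 3 / 3) * Real.exp (-(1 / N * u)) : ℝ) : ℂ) * Complex.exp (t * u * Complex.I)
          = ((A u - u ^ 3 / 3 : ℝ) : ℂ) * Complex.exp (-((((1 / N : ℝ) : ℂ) - t * Complex.I) * u)) := by
        intro u
        push_cast
        rw [mul_assoc, ← Complex.exp_add]
        congr 2
        ring
      simp_rw [e]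
      convert h1 using 3
      push_cast; rfl)
    rw [← Real.norm_eq_abs, ← Complex.norm_real, ← integral_complex_ofReal]
    convert! this using 2
    push_cast
    rfl
  -- comparison on a window
  have hwin : ∀ N u₁ : ℝ, 1 ≤ N → 0 ≤ u₁ → ∀ m : ℝ, 0 ≤ m → ∀ σ : ℝ,
      (∀ u, u₁ ≤ u → u ≤ u₁ + 1 / N → m ≤ σ * (A u - u ^ 3 / 3)) → u₁ ≤ N → |σ| = 1 →
      m ≤ 2 * Real.exp 2 * M * N := by
    intro N u₁ hN hu₁ m hm σ hσ hu₁N hσ1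
    have hN0 : 0 < N := by linarith
    have hbi : IntegrableOn (fun u => g ((u - u₁) * N)) (Set.Ioi 0) := by
      have h0 : Integrable g := by
        refine hgc.integrable_of_hasCompactSupport ?_
        refine HasCompactSupport.intro (isCompact_Icc (a := (0 : ℝ)) (b := 1)) fun v hv => ?_
        by_contra hne
        exact hv ⟨(hgs v hne).1.le, (hgs v hne).2.le⟩
      exact ((h0.comp_mul_right' hN0.ne').comp_sub_right u₁).integrableOn
    have h1 : ∫ u in Set.Ioi (0 : ℝ), m * Real.exp (-2) * g ((u - u₁) * N) ≤
        ∫ u in Set.Ioi (0 : ℝ), σ * (((A u - u ^ 3 / 3) * Real.exp (-(1 / N * u))) * g ((u - u₁) * N)) := by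
      refine setIntegral_mono_on (hbi.const_mul _) ?_ measurableSet_Ioi ?_
      · refine Integrable.const_mul ?_ _
        refine (hint (1 / N) (by positivity)).mul_bdd (c := b)
          (hgc.comp (by fun_prop : Continuous fun u : ℝ => (u - u₁) * N)).aestronglyMeasurable ?_
        exact ae_of_all _ fun u => by
          rw [Real.norm_eq_abs, abs_of_nonneg (hg0 _)]; exact hb _
      · intro u hu
        by_cases hne : g ((u - u₁) * N) = 0
        · rw [hne]; simp
        · obtain ⟨h2, h3⟩ := hgs _ hne
          have h4 : u₁ < u := by
            by_contra hc
            push Not at hc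
            nlinarith
          have h5 : u < u₁ + 1 / N := by
            have : u - u₁ < 1 / N := by rw [lt_div_iff₀ hN0]; exact h3
            linarith
          have h6 := hσ u h4.le h5.le
          -- On the window u ≤ N + 1/N ≤ N + 1, so the damping exponent u/N is at most 2.
          have h7 : Real.exp (-2) ≤ Real.exp (-(1 / N * u)) := by
            apply Real.exp_le_exp.2
            have h8 : 1 / N ≤ 1 := by rw [div_le_one hN0]; exact hN
            have h9 : 1 / N * u ≤ 1 / N * (N + 1) := by gcongr; linarith
            have h10 : 1 / N * (N + 1) = 1 + 1 / N := by field_simp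
            linarith
          calc _ ≤ (σ * (A u - u ^ 3 / 3)) * Real.exp (-(1 / N * u)) * g ((u - u₁) * N) := by
                have := hg0 ((u - u₁) * N)
                have h11 : 0 ≤ σ * (A u - u ^ 3 / 3) := hm.trans h6
                gcongr
            _ = _ := by ring
    rw [integral_const_mul, integral_bump_scale hgs hu₁ hN0, integral_const_mul] at h1
    have h2 := hsm N u₁ hN
    have h3 : σ * (∫ u in Set.Ioi (0 : ℝ), ((A u - u ^ 3 / 3) * Real.exp (-(1 / N * u))) * g ((u - u₁) * N)) ≤ M := by
      refine (le_abs_self _).trans ?_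
      rw [abs_mul, hσ1, one_mul]; exact h2
    have h4 : m * Real.exp (-2) * ((1 / 2) / N) ≤ M := by
      refine le_trans ?_ (h1.trans h3)
      gcongr
    rw [Real.exp_neg] at h4
    have he : 0 < Real.exp 2 := Real.exp_pos 2
    calc m = (m * (Real.exp 2)⁻¹ * ((1 / 2) / N)) * (2 * Real.exp 2 * N) := by field_simp
      _ ≤ M * (2 * Real.exp 2 * N) := by gcongr
      _ = _ := by ring
  refine ⟨3 + 2 * Real.exp 2 * M, by positivity, fun u hu => ?_⟩
  have hu0 : 0 < u := by linarith
  have hui : 1 / u ≤ 1 := by rw [div_le_one hu0]; exact hu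
  have huu : u * (1 / u) = 1 := by field_simp
  have hui0 : 0 < 1 / u := by positivity
  rw [abs_le]
  constructor
  · by_cases h : 0 ≤ -(A u - u ^ 3 / 3) - 3 * u
    -- For the lower bound the window ends at u, since there A(v) ≤ A(u). The upper bound uses the
    -- window that begins at u.
    · have := hwin u (u - 1 / u) hu (by linarith) _ h (-1) (by
        intro v hv1 hv2
        have hvu : v ≤ u := by linarith
        have hAv := hA hvu
        have h1 : u ^ 3 - v ^ 3 ≤ 3 * u := by
          have h0 : 0 ≤ v := by linarith
          have h2 : u ^ 3 - v ^ 3 = (u - v) * (u ^ 2 + u * v + v ^ 2) := by ring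
          have h3 : (u - v) ≤ 1 / u := by linarith
          calc u ^ 3 - v ^ 3 = (u - v) * (u ^ 2 + u * v + v ^ 2) := h2
            _ ≤ (1 / u) * (u ^ 2 + u * u + u ^ 2) := by gcongr
            _ = _ := by field_simp; ring
        linarith) (by linarith) (by simp)
      linarith
    · push Not at h
      have : 0 ≤ 2 * Real.exp 2 * M * u := by positivity
      linarith
  · by_cases h : 0 ≤ (A u - u ^ 3 / 3) - 3 * u
    · have := hwin u u hu hu0.le _ h 1 (by
        intro v hv1 hv2
        have hAv := hA hv1
        have h1 : v ^ 3 - u ^ 3 ≤ 9 * u := by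
          have h0 : 0 ≤ v := by linarith
          have h2 : v ^ 3 - u ^ 3 = (v - u) * (v ^ 2 + v * u + u ^ 2) := by ring
          have h3 : (v - u) ≤ 1 / u := by linarith
          have h4 : v ≤ u + 1 / u := hv2
          calc v ^ 3 - u ^ 3 = (v - u) * (v ^ 2 + v * u + u ^ 2) := h2
            _ ≤ (1 / u) * ((u + 1 / u) ^ 2 + (u + 1 / u) * u + u ^ 2) := by gcongr
            _ = 3 * u + 3 * (1 / u) + (1 / u) ^ 3 := by field_simp; ring
            _ ≤ 3 * u + 3 * 1 + 1 ^ 3 := by gcongr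
            _ ≤ _ := by linarith
        linarith) le_rfl (by simp)
      linarith
    · push Not at h
      have : 0 ≤ 2 * Real.exp 2 * M * u := by positivity
      linarith

end Tauberian

/-! ### The prime number theorem for the weights Λ(n)(log n)²/n. -/

namespace Tauberian
open ArithmeticFunction in
/-- The weights `Λ(n) (log n)² / n`. -/
noncomputable def mangoldtWeight (n : ℕ) : ℝ := vonMangoldt n * Real.log n ^ 2 / n

/-- The summatory function of `Λ(n) (log n)² / n`. -/
noncomputable def mangoldtSum (x : ℝ) : ℝ := ∑ k ∈ Finset.Icc 1 ⌊x⌋₊, mangoldtWeight k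

lemma mangoldtWeight_nonneg (n : ℕ) : 0 ≤ mangoldtWeight n := by
  have := ArithmeticFunction.vonMangoldt_nonneg (n := n)
  unfold mangoldtWeight
  positivity

lemma mangoldtSum_nonneg (x : ℝ) : 0 ≤ mangoldtSum x :=
  Finset.sum_nonneg fun _ _ => mangoldtWeight_nonneg _

lemma mangoldtSum_mono : Monotone mangoldtSum := fun _ _ h =>
  Finset.sum_le_sum_of_subset_of_nonneg (Finset.Icc_subset_Icc le_rfl (Nat.floor_mono h))
    fun _ _ _ => mangoldtWeight_nonneg _

lemma abscissa_vonMangoldt_lt {s : ℂ} (hs : 1 < s.re) :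
    LSeries.abscissaOfAbsConv (fun n => (ArithmeticFunction.vonMangoldt n : ℂ)) < s.re := by
  have h : LSeriesSummable (fun n => (ArithmeticFunction.vonMangoldt n : ℂ)) (((1 + s.re) / 2 : ℝ) : ℂ) :=
    ArithmeticFunction.LSeriesSummable_vonMangoldt (by rw [Complex.ofReal_re]; linarith)
  refine lt_of_le_of_lt h.abscissaOfAbsConv_le ?_
  rw [Complex.ofReal_re]
  exact_mod_cast (by linarith : (1 + s.re) / 2 < s.re)

lemma term_mangoldtWeight (s : ℂ) (n : ℕ) :
    LSeries.term (fun n => (mangoldtWeight n : ℂ)) s n =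
      LSeries.term (LSeries.logMul (LSeries.logMul fun n => (ArithmeticFunction.vonMangoldt n : ℂ))) (1 + s) n := by
  rcases eq_or_ne n 0 with rfl | hn
  · simp
  have hn' : (n : ℂ) ≠ 0 := by exact_mod_cast hn
  rw [LSeries.term_of_ne_zero hn, LSeries.term_of_ne_zero hn, Complex.cpow_add _ _ hn', Complex.cpow_one]
  simp only [mangoldtWeight, LSeries.logMul]
  rw [← Complex.natCast_log]
  push_cast
  field_simp

lemma LSeriesSummable_mangoldtWeight {s : ℂ} (hs : 0 < s.re) :
    LSeriesSummable (fun n => (mangoldtWeight n : ℂ)) s := by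
  unfold LSeriesSummable
  have : LSeries.term (fun n => (mangoldtWeight n : ℂ)) s = LSeries.term (LSeries.logMul (LSeries.logMul fun n => (ArithmeticFunction.vonMangoldt n : ℂ))) (1 + s) :=
    funext (term_mangoldtWeight s)
  rw [this]
  refine LSeriesSummable_of_abscissaOfAbsConv_lt_re ?_
  rw [LSeries.abscissaOfAbsConv_logMul, LSeries.abscissaOfAbsConv_logMul]
  exact abscissa_vonMangoldt_lt (by simp; linarith)

lemma LSeries_vonMangoldt_eq_logDeriv {w : ℂ} (hw : 1 < w.re) :
    LSeries (fun n => (ArithmeticFunction.vonMangoldt n : ℂ)) w =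
      (w - 1)⁻¹ - logDeriv riemannZeta₁ w := by
  have hw1 : w ≠ 1 := by rintro rfl; simp at hw
  have h0 := ZetaBound.riemannZeta₁_ne_zero hw.le
  have h1 := sub_ne_zero_of_ne hw1
  rw [ArithmeticFunction.LSeries_vonMangoldt_eq_deriv_riemannZeta_div hw,
    deriv_riemannZeta_eq_neg_inv_sub_sq_mul_add hw1, riemannZeta_eq_inv_sub_mul hw1, logDeriv_apply]
  field_simp
  ring

/-- Dividing by n shifts the argument by 1 and each factor log n is a differentiation up to sign.
Two differentiations of -ζ'/ζ turn its simple pole into 2/s³ and leave exactly the function bounded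
in `norm_deriv_deriv_logDeriv_riemannZeta₁_le`. -/
lemma LSeries_mangoldtWeight {s : ℂ} (hs : 0 < s.re) :
    LSeries (fun n => (mangoldtWeight n : ℂ)) s =
      2 / s ^ 3 - deriv (deriv (logDeriv riemannZeta₁)) (1 + s) := by
  set Λ : ℕ → ℂ := fun n => (ArithmeticFunction.vonMangoldt n : ℂ) with hΛ
  have hU : IsOpen {w : ℂ | 1 < w.re} := isOpen_lt continuous_const Complex.continuous_re
  have hmem : (1 + s) ∈ {w : ℂ | 1 < w.re} := by simpa using hs
  have h1 : LSeries (fun n => (mangoldtWeight n : ℂ)) s = iteratedDeriv 2 (LSeries Λ) (1 + s) := by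
    rw [LSeries_iteratedDeriv 2 (abscissa_vonMangoldt_lt hmem)]
    simp only [even_two, Even.neg_pow, one_pow, one_mul]
    exact tsum_congr (term_mangoldtWeight s)
  have hne : ∀ w ∈ {w : ℂ | 1 < w.re}, w - 1 ≠ 0 := by
    intro w hw h
    have h2 : w = 1 := sub_eq_zero.1 h
    have hw' : 1 < w.re := hw
    simp [h2] at hw'
  have hlog : ∀ w ∈ {w : ℂ | 1 < w.re}, DifferentiableAt ℂ (logDeriv riemannZeta₁) w := by
    intro w hw
    exact (differentiable_riemannZeta₁.deriv w).div (differentiable_riemannZeta₁ w)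
      (ZetaBound.riemannZeta₁_ne_zero (le_of_lt hw))
  have hlogOn : DifferentiableOn ℂ (logDeriv riemannZeta₁) {w : ℂ | 1 < w.re} :=
    fun w hw => (hlog w hw).differentiableWithinAt
  have hlog' : ∀ w ∈ {w : ℂ | 1 < w.re}, DifferentiableAt ℂ (deriv (logDeriv riemannZeta₁)) w :=
    fun w hw => (hlogOn.deriv hU).differentiableAt (hU.mem_nhds hw)
  have hd1 : ∀ w ∈ {w : ℂ | 1 < w.re}, deriv (LSeries Λ) w = -((w - 1) ^ 2)⁻¹ - deriv (logDeriv riemannZeta₁) w := by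
    intro w hw
    have he : LSeries Λ =ᶠ[𝓝 w] fun w => (w - 1)⁻¹ - logDeriv riemannZeta₁ w := by
      filter_upwards [hU.mem_nhds hw] with z hz using LSeries_vonMangoldt_eq_logDeriv hz
    rw [he.deriv_eq]
    have := ((((hasDerivAt_id w).sub_const 1).inv (hne w hw)).sub (hlog w hw).hasDerivAt).deriv
    refine Eq.trans ?_ (this.trans ?_)
    · rfl
    · simp [neg_div]
  rw [h1, iteratedDeriv_succ, iteratedDeriv_one]
  have he : deriv (LSeries Λ) =ᶠ[𝓝 (1 + s)] fun w => -((w - 1) ^ 2)⁻¹ - deriv (logDeriv riemannZeta₁) w := by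
    filter_upwards [hU.mem_nhds hmem] with z hz using hd1 z hz
  rw [he.deriv_eq]
  have := ((((((hasDerivAt_id (1 + s)).sub_const 1).pow 2).inv (pow_ne_zero 2 (hne _ hmem))).neg).sub
    (hlog' _ hmem).hasDerivAt).deriv
  refine Eq.trans ?_ (this.trans ?_)
  · rfl
  · have hs0 : s ≠ 0 := by rintro rfl; simp at hs
    simp
    field_simp

/-- Rankin's trick: (x/k)^r ≥ 1 for k ≤ x, and the Dirichlet series converges at every r > 0. -/
lemma mangoldtSum_le_rpow {r : ℝ} (hr : 0 < r) :
    ∃ C : ℝ, 0 ≤ C ∧ ∀ x : ℝ, 0 ≤ x → mangoldtSum x ≤ C * x ^ r := by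
  have h := (LSeriesSummable_mangoldtWeight (s := (r : ℂ)) (by simpa using hr)).norm
  have hn : ∀ k : ℕ, 1 ≤ k → ‖LSeries.term (fun n => (mangoldtWeight n : ℂ)) (r : ℂ) k‖ = mangoldtWeight k / (k : ℝ) ^ r := by
    intro k hk
    rw [LSeries.term_of_ne_zero (by omega), norm_div, Complex.norm_real, Real.norm_eq_abs,
      abs_of_nonneg (mangoldtWeight_nonneg k), ← Complex.ofReal_natCast,
      Complex.norm_cpow_eq_rpow_re_of_pos (by exact_mod_cast hk), Complex.ofReal_re]
  refine ⟨∑' k, ‖LSeries.term (fun n => (mangoldtWeight n : ℂ)) (r : ℂ) k‖, tsum_nonneg fun _ => norm_nonneg _, fun x hx => ?_⟩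
  calc mangoldtSum x ≤ ∑ k ∈ Finset.Icc 1 ⌊x⌋₊, ‖LSeries.term (fun n => (mangoldtWeight n : ℂ)) (r : ℂ) k‖ * x ^ r := by
        refine Finset.sum_le_sum fun k hk => ?_
        obtain ⟨hk1, hk2⟩ := Finset.mem_Icc.1 hk
        have hk0 : (0 : ℝ) < k := by exact_mod_cast hk1
        rw [hn k hk1, div_mul_eq_mul_div, le_div_iff₀ (by positivity)]
        gcongr
        · exact mangoldtWeight_nonneg k
        · exact (Nat.le_floor_iff hx).1 hk2
    _ ≤ _ := by
        rw [← Finset.sum_mul]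
        gcongr
        exact h.sum_le_tsum _ fun _ _ => norm_nonneg _

lemma LSeries_mangoldtWeight_eq_integral {s : ℂ} (hs : 0 < s.re) :
    LSeries (fun n => (mangoldtWeight n : ℂ)) s =
      s * ∫ u in Set.Ioi (0 : ℝ), (mangoldtSum (Real.exp u) : ℂ) * Complex.exp (-(s * u)) := by
  obtain ⟨C, hC, hb⟩ := mangoldtSum_le_rpow (r := s.re / 2) (by linarith)
  rw [LSeries_eq_mul_integral_of_nonneg mangoldtWeight (r := s.re / 2) (by linarith) (by linarith) ?_ mangoldtWeight_nonneg]
  · congr 1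
    have := integral_comp_exp_Ioi (fun t : ℝ => (∑ k ∈ Finset.Icc 1 ⌊t⌋₊, (mangoldtWeight k : ℂ)) * (t : ℂ) ^ (-(s + 1))) 0
    rw [Real.exp_zero] at this
    rw [← this]
    refine setIntegral_congr_fun measurableSet_Ioi fun u _ => ?_
    have h1 : ((Real.exp u : ℝ) : ℂ) ^ (-(s + 1)) = Complex.exp (-(s * u)) * Complex.exp (-u) := by
      rw [Complex.cpow_def_of_ne_zero (by exact_mod_cast (Real.exp_pos u).ne'), ← Complex.ofReal_log (Real.exp_pos u).le,
        Real.log_exp, ← Complex.exp_add]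
      congr 1; ring
    simp only [mangoldtSum]
    rw [Complex.real_smul, h1, Complex.exp_neg (u : ℂ)]
    push_cast
    field_simp [Complex.exp_ne_zero]
  · refine Asymptotics.isBigO_iff.2 ⟨C, Eventually.of_forall fun n => ?_⟩
    have := hb n (by positivity)
    simp only [mangoldtSum, Nat.floor_natCast] at this
    rw [Real.norm_eq_abs, Real.norm_eq_abs, abs_of_nonneg (by positivity : (0 : ℝ) ≤ (n : ℝ) ^ (s.re / 2)),
      abs_of_nonneg (Finset.sum_nonneg fun _ _ => mangoldtWeight_nonneg _)]
    exact this

lemma integrableOn_exp_growth {f : ℝ → ℂ} (hf : AEStronglyMeasurable f (volume.restrict (Set.Ioi 0)))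
    {C : ℝ} {s : ℂ} (hs : 0 < s.re) (hb : ∀ u : ℝ, 0 < u → ‖f u‖ ≤ C * Real.exp (s.re / 2 * u)) :
    IntegrableOn (fun u : ℝ => f u * Complex.exp (-(s * u))) (Set.Ioi 0) := by
  have h1 : IntegrableOn (fun u : ℝ => C * Real.exp (-(s.re / 2) * u)) (Set.Ioi 0) :=
    (integrableOn_exp_mul_Ioi (by linarith) 0).const_mul C
  refine h1.mono' (hf.mul (by fun_prop : Continuous fun u : ℝ => Complex.exp (-(s * u))).aestronglyMeasurable) ?_
  refine (ae_restrict_iff' measurableSet_Ioi).2 (ae_of_all _ fun u hu => ?_)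
  rw [norm_mul, Complex.norm_exp]
  have : (-(s * u)).re = -(s.re * u) := by simp
  rw [this]
  calc _ ≤ C * Real.exp (s.re / 2 * u) * Real.exp (-(s.re * u)) := by gcongr; exact hb u hu
    _ = _ := by rw [mul_assoc, ← Real.exp_add]; congr 2; ring

lemma cube_le_exp {r u : ℝ} (hr : 0 < r) (hu : 0 ≤ u) : u ^ 3 ≤ 6 / r ^ 3 * Real.exp (r * u) := by
  have := Real.pow_div_factorial_le_exp (r * u) (by positivity) 3
  rw [div_mul_eq_mul_div, le_div_iff₀ (by positivity)]
  have h : (r * u) ^ 3 / (Nat.factorial 3 : ℝ) = r ^ 3 * u ^ 3 / 6 := by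
    norm_num [Nat.factorial]; ring
  rw [h] at this
  linarith

lemma integral_cube_mul_exp {s : ℂ} (hs : 0 < s.re) :
    ∫ u in Set.Ioi (0 : ℝ), ((u ^ 3 / 3 : ℝ) : ℂ) * Complex.exp (-(s * u)) = 2 / s ^ 4 := by
  have hs0 : s ≠ 0 := by rintro rfl; simp at hs
  have hint : IntegrableOn (fun u : ℝ => ((u ^ 3 / 3 : ℝ) : ℂ) * Complex.exp (-(s * u))) (Set.Ioi 0) := by
    refine integrableOn_exp_growth (C := 6 / (s.re / 2) ^ 3 / 3) (Continuous.aestronglyMeasurable (by fun_prop)) hs fun u hu => ?_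
    rw [Complex.norm_real, Real.norm_eq_abs, abs_of_nonneg (by positivity)]
    have := cube_le_exp (r := s.re / 2) (by linarith) hu.le
    rw [div_mul_eq_mul_div]
    gcongr
  set P : ℝ → ℂ := fun u => -((u : ℂ) ^ 3 / s + 3 * (u : ℂ) ^ 2 / s ^ 2 + 6 * u / s ^ 3 + 6 / s ^ 4) / 3 * Complex.exp (-(s * u)) with hP
  have hder : ∀ u : ℝ, HasDerivAt P (((u ^ 3 / 3 : ℝ) : ℂ) * Complex.exp (-(s * u))) u := by
    intro u
    have h0 : HasDerivAt (fun z : ℂ => -(z ^ 3 / s + 3 * z ^ 2 / s ^ 2 + 6 * z / s ^ 3 + 6 / s ^ 4) / 3 * Complex.exp (-(s * z)))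
        (((u ^ 3 / 3 : ℝ) : ℂ) * Complex.exp (-(s * u))) (u : ℂ) := by
      have e1 := ((hasDerivAt_pow 3 (u : ℂ)).div_const s)
      have e2 := (((hasDerivAt_pow 2 (u : ℂ)).const_mul 3).div_const (s ^ 2))
      have e3 := (((hasDerivAt_id (u : ℂ)).const_mul 6).div_const (s ^ 3))
      have e4 := (((((e1.add e2).add e3).add_const (6 / s ^ 4)).neg).div_const 3)
      have e5 := (((hasDerivAt_id (u : ℂ)).const_mul s).neg).cexp
      convert! e4.mul e5 using 1
      simp
      field_simp
      ring
    exact h0.comp_ofReal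
  have hlim : Tendsto P atTop (𝓝 0) := by
    have hk : ∀ k : ℕ, Tendsto (fun u : ℝ => (u : ℂ) ^ k * Complex.exp (-(s * u))) atTop (𝓝 0) := by
      intro k
      rw [tendsto_zero_iff_norm_tendsto_zero]
      have := tendsto_rpow_mul_exp_neg_mul_atTop_nhds_zero k s.re hs
      refine this.congr' ?_
      filter_upwards [eventually_gt_atTop 0] with u hu
      rw [norm_mul, norm_pow, Complex.norm_real, Real.norm_eq_abs, abs_of_pos hu, Complex.norm_exp, Real.rpow_natCast]
      congr 2
      simp
    have h := (((((hk 3).const_mul (1 / s)).add ((hk 2).const_mul (3 / s ^ 2))).add ((hk 1).const_mul (6 / s ^ 3))).add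
      ((hk 0).const_mul (6 / s ^ 4))).const_mul (-(1 / 3))
    simp only [mul_zero, add_zero] at h
    refine h.congr fun u => ?_
    simp only [hP]
    field_simp
  have := integral_Ioi_of_hasDerivAt_of_tendsto (f := P) (a := 0) (m := 0) (hder 0).continuousAt.continuousWithinAt
    (fun u _ => hder u) hint hlim
  rw [this]
  simp [hP]
  field_simp
  norm_num

/-- A form of the prime number theorem: `∑_{n ≤ x} Λ(n) (log n)² / n = (log x)³ / 3 + O(log x)`. -/
theorem abs_mangoldtSum_sub_le :
    ∃ C : ℝ, 0 < C ∧ ∀ u : ℝ, 1 ≤ u → |mangoldtSum (Real.exp u) - u ^ 3 / 3| ≤ C * u := by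
  obtain ⟨K, hK, hbd⟩ := ZetaBound.norm_deriv_deriv_logDeriv_riemannZeta₁_le
  have hmono : Monotone fun u => mangoldtSum (Real.exp u) := mangoldtSum_mono.comp Real.exp_monotone
  have hAint : ∀ s : ℂ, 0 < s.re → IntegrableOn (fun u : ℝ => (mangoldtSum (Real.exp u) : ℂ) * Complex.exp (-(s * u))) (Set.Ioi 0) := by
    intro s hs
    obtain ⟨C, hC, hb⟩ := mangoldtSum_le_rpow (r := s.re / 2) (by linarith)
    refine integrableOn_exp_growth (C := C) (Complex.measurable_ofReal.comp hmono.measurable).aestronglyMeasurable hs fun u hu => ?_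
    rw [Function.comp_apply, Complex.norm_real, Real.norm_eq_abs, abs_of_nonneg (mangoldtSum_nonneg _)]
    refine (hb _ (Real.exp_pos u).le).trans (le_of_eq ?_)
    rw [← Real.exp_mul]; congr 2; ring
  have hcint : ∀ s : ℂ, 0 < s.re → IntegrableOn (fun u : ℝ => ((u ^ 3 / 3 : ℝ) : ℂ) * Complex.exp (-(s * u))) (Set.Ioi 0) := by
    intro s hs
    refine integrableOn_exp_growth (C := 6 / (s.re / 2) ^ 3 / 3) (Continuous.aestronglyMeasurable (by fun_prop)) hs fun u hu => ?_
    rw [Complex.norm_real, Real.norm_eq_abs, abs_of_nonneg (by positivity)]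
    have := cube_le_exp (r := s.re / 2) (by linarith) hu.le
    rw [div_mul_eq_mul_div]
    gcongr
  refine abs_sub_cube_le hmono hK.le ?_ ?_
  · intro δ hδ
    have h := (hAint δ (by simpa using hδ)).sub (hcint δ (by simpa using hδ))
    have h2 := h.re
    refine h2.congr (ae_of_all _ fun u => ?_)
    have e : ∀ x : ℝ, (x : ℂ) * Complex.exp (-((δ : ℂ) * u)) = ((x * Real.exp (-(δ * u)) : ℝ) : ℂ) := by
      intro x; push_cast; rfl
    simp only [Pi.sub_apply, e, RCLike.re_to_complex, Complex.sub_re, Complex.ofReal_re]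
    ring
  · intro δ t hδ hδ1
    set s : ℂ := δ - t * Complex.I with hs
    have hre : s.re = δ := by simp [hs]
    have hre0 : 0 < s.re := by rw [hre]; exact hδ
    have hs0 : s ≠ 0 := by
      intro h
      rw [h] at hre0; simp at hre0
    -- The polar part 2/s³ divided by s is the Laplace transform 2/s⁴ of u³/3, so the subtraction
    -- removes the pole of order four.
    have h1 : ∫ u in Set.Ioi (0 : ℝ), ((mangoldtSum (Real.exp u) - u ^ 3 / 3 : ℝ) : ℂ) * Complex.exp (-(s * u)) =
        -deriv (deriv (logDeriv riemannZeta₁)) (1 + s) / s := by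
      have h2 := LSeries_mangoldtWeight_eq_integral hre0
      rw [LSeries_mangoldtWeight hre0] at h2
      have h3 := integral_cube_mul_exp hre0
      have h4 : ∀ u : ℝ, ((mangoldtSum (Real.exp u) - u ^ 3 / 3 : ℝ) : ℂ) * Complex.exp (-(s * u)) =
          (mangoldtSum (Real.exp u) : ℂ) * Complex.exp (-(s * u)) - ((u ^ 3 / 3 : ℝ) : ℂ) * Complex.exp (-(s * u)) := by
        intro u; rw [Complex.ofReal_sub, sub_mul]
      simp_rw [h4]
      rw [integral_sub (hAint s hre0) (hcint s hre0), h3]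
      rw [eq_div_iff hs0, sub_mul, mul_comm _ s, ← h2]
      field_simp
      ring
    rw [h1, norm_div, norm_neg]
    gcongr
    have := hbd δ (-t) hδ hδ1
    rw [abs_neg] at this
    have e : 1 + s = 1 + δ + Complex.I * ((-t : ℝ) : ℂ) := by rw [hs]; push_cast; ring
    rw [e]
    exact this

end Tauberian

/-! ### Partial summation: the sums of Λ(n)/(n log n) up to a constant. -/

namespace Mertens
open Tauberian

/-- The coefficients `Λ(n) / (n log n)` of `log ζ(1 + s)`. -/
noncomputable def logZetaCoeff (n : ℕ) : ℝ := ArithmeticFunction.vonMangoldt n / (n * Real.log n)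

lemma logZetaCoeff_nonneg (n : ℕ) : 0 ≤ logZetaCoeff n := by
  have := ArithmeticFunction.vonMangoldt_nonneg (n := n)
  have h : 0 ≤ Real.log n := Real.log_natCast_nonneg n
  unfold logZetaCoeff
  positivity

/-- The summatory function of `Λ(n) / (n log n)`. -/
noncomputable def logZetaSum (x : ℝ) : ℝ := ∑ k ∈ Finset.Icc 1 ⌊x⌋₊, logZetaCoeff k

lemma logZetaSum_mono : Monotone logZetaSum := fun _ _ h =>
  Finset.sum_le_sum_of_subset_of_nonneg (Finset.Icc_subset_Icc le_rfl (Nat.floor_mono h))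
    fun _ _ _ => logZetaCoeff_nonneg _

lemma logZetaSum_nonneg (x : ℝ) : 0 ≤ logZetaSum x :=
  Finset.sum_nonneg fun _ _ => logZetaCoeff_nonneg _

lemma one_le_log_of_exp_le {t : ℝ} (ht : Real.exp 1 ≤ t) : 1 ≤ Real.log t := by
  rw [← Real.log_exp 1]; exact Real.log_le_log (Real.exp_pos 1) ht

lemma exists_limit_of_log_sq_bound {h : ℝ → ℝ} {C : ℝ}
    (hC : ∀ x y, Real.exp 1 ≤ x → x ≤ y → |h y - h x| ≤ C / Real.log x ^ 2) :
    ∃ M, ∀ x, Real.exp 1 ≤ x → |h x - M| ≤ C / Real.log x ^ 2 := by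
  have hlim : Tendsto (fun x => C / Real.log x ^ 2) atTop (𝓝 0) :=
    ((tendsto_pow_atTop (two_ne_zero)).comp Real.tendsto_log_atTop).const_div_atTop C
  have hcs : CauchySeq h := by
    rw [Metric.cauchySeq_iff']
    intro ε hε
    obtain ⟨N, hN1, hN2⟩ := ((hlim.eventually (gt_mem_nhds hε)).and (eventually_ge_atTop (Real.exp 1))).exists
    exact ⟨N, fun n hn => (hC N n hN2 hn).trans_lt hN1⟩
  obtain ⟨M, hM⟩ := cauchySeq_tendsto_of_complete hcs
  refine ⟨M, fun x hx => ?_⟩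
  rw [abs_sub_comm]
  refine le_of_tendsto ((hM.sub_const (h x)).abs) ?_
  filter_upwards [eventually_ge_atTop x] with y hy using hC x y hx hy

lemma hasDerivAt_inv_log_pow {t : ℝ} (ht : Real.exp 1 ≤ t) (k : ℕ) :
    HasDerivAt (fun t => (Real.log t ^ (k + 1))⁻¹) (-(k + 1) / (t * Real.log t ^ (k + 2))) t := by
  have ht0 : 0 < t := (Real.exp_pos 1).trans_le ht
  have hl := one_le_log_of_exp_le ht
  have hl0 : Real.log t ≠ 0 := by positivity
  have := ((Real.hasDerivAt_log ht0.ne').pow (k + 1)).inv (pow_ne_zero _ hl0)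
  convert! this using 1
  simp
  field_simp
  ring

lemma hasDerivAt_log_log {t : ℝ} (ht : Real.exp 1 ≤ t) :
    HasDerivAt (fun t => Real.log (Real.log t)) (1 / (t * Real.log t)) t := by
  have ht0 : 0 < t := (Real.exp_pos 1).trans_le ht
  have hl := one_le_log_of_exp_le ht
  have hl0 : Real.log t ≠ 0 := by positivity
  have := (Real.hasDerivAt_log hl0).comp t (Real.hasDerivAt_log ht0.ne')
  convert! this using 1
  field_simp

lemma continuousOn_inv_mul_log_pow {x y : ℝ} (hx : Real.exp 1 ≤ x) (c : ℝ) (k : ℕ) :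
    ContinuousOn (fun t => c / (t * Real.log t ^ k)) (Set.Icc x y) := by
  have h0 : ∀ t ∈ Set.Icc x y, 0 < t := fun t ht => (Real.exp_pos 1).trans_le (hx.trans ht.1)
  refine continuousOn_const.div (continuousOn_id.mul ((Real.continuousOn_log.mono fun t ht => (h0 t ht).ne').pow k)) ?_
  intro t ht
  have h1 := h0 t ht
  have h2 := one_le_log_of_exp_le (hx.trans ht.1)
  positivity

/-- Partial summation against (log t)^{-3}, since Λ(n)/(n log n) is Λ(n)(log n)²/n divided by (log
n)³. -/
lemma sum_logZetaCoeff_Ioc {x y : ℝ} (hx : Real.exp 1 ≤ x) (hxy : x ≤ y) :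
    logZetaSum y - logZetaSum x = mangoldtSum y / Real.log y ^ 3 - mangoldtSum x / Real.log x ^ 3 +
      ∫ t in x..y, 3 / (t * Real.log t ^ 4) * mangoldtSum t := by
  have hx0 : 0 < x := (Real.exp_pos 1).trans_le hx
  have hIcc : ∀ z : ℝ, ∑ k ∈ Finset.Icc 0 ⌊z⌋₊, mangoldtWeight k = mangoldtSum z := by
    intro z
    rw [mangoldtSum, ← Finset.add_sum_Ioc_eq_sum_Icc (Nat.zero_le _)]
    simp [mangoldtWeight]
    rfl
  have hder : ∀ t ∈ Set.Icc x y, HasDerivAt (fun t => (Real.log t ^ (2 + 1))⁻¹) (-3 / (t * Real.log t ^ 4)) t := by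
    intro t ht
    have := hasDerivAt_inv_log_pow (hx.trans ht.1) 2
    convert this using 1
    push_cast; norm_num
  have key := sum_mul_eq_sub_sub_integral_mul mangoldtWeight (f := fun t => (Real.log t ^ (2 + 1))⁻¹)
    hx0.le hxy (fun t ht => (hder t ht).differentiableAt) (by
      refine (ContinuousOn.integrableOn_Icc ((continuousOn_inv_mul_log_pow hx (-3) 4).congr ?_))
      intro t ht
      exact (hder t ht).deriv)
  simp only [hIcc] at key
  have e1 : ∑ k ∈ Finset.Ioc ⌊x⌋₊ ⌊y⌋₊, (Real.log k ^ (2 + 1))⁻¹ * mangoldtWeight k = logZetaSum y - logZetaSum x := by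
    have hsub : logZetaSum y = logZetaSum x + ∑ k ∈ Finset.Ioc ⌊x⌋₊ ⌊y⌋₊, logZetaCoeff k := by
      unfold logZetaSum
      have : ∀ n : ℕ, Finset.Icc 1 n = Finset.Ioc 0 n := fun n => rfl
      rw [this, this, ← Finset.sum_Ioc_consecutive _ (Nat.zero_le _) (Nat.floor_mono hxy)]
    rw [hsub, add_sub_cancel_left]
    refine Finset.sum_congr rfl fun k hk => ?_
    have hk1 : ⌊x⌋₊ < k := (Finset.mem_Ioc.1 hk).1
    have hk2 : x < k := (Nat.floor_lt hx0.le).1 hk1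
    have hl := one_le_log_of_exp_le (hx.trans hk2.le)
    have hk0 : (0 : ℝ) < k := hx0.trans hk2
    unfold mangoldtWeight logZetaCoeff
    norm_num
    field_simp
  rw [e1] at key
  rw [key, intervalIntegral.integral_of_le hxy]
  have e2 : ∫ t in Set.Ioc x y, deriv (fun t => (Real.log t ^ (2 + 1))⁻¹) t * mangoldtSum t =
      -∫ t in Set.Ioc x y, 3 / (t * Real.log t ^ 4) * mangoldtSum t := by
    rw [← integral_neg]
    refine setIntegral_congr_fun measurableSet_Ioc fun t ht => ?_
    rw [(hder t ⟨ht.1.le, ht.2⟩).deriv]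
    ring
  rw [e2]
  ring

/-- With (log t)³/3 inserted in the partial summation formula, the two boundary terms 1/3 cancel and
the integral of 1/(t log t) gives log log. The error O(log t) contributes the integral of 1/(t log³
t), of order 1/log² x. The value of the constant is not visible from this argument. -/
lemma exists_logZetaSum_asymp :
    ∃ M C : ℝ, 0 ≤ C ∧ ∀ x, Real.exp 1 ≤ x →
      |logZetaSum x - Real.log (Real.log x) - M| ≤ C / Real.log x ^ 2 := by
  obtain ⟨C, hC, hb⟩ := abs_mangoldtSum_sub_le
  have hE : ∀ t, Real.exp 1 ≤ t → |mangoldtSum t - Real.log t ^ 3 / 3| ≤ C * Real.log t := by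
    intro t ht
    have := hb (Real.log t) (one_le_log_of_exp_le ht)
    rwa [Real.exp_log ((Real.exp_pos 1).trans_le ht)] at this
  -- The factor 7/2 is 1 + 1 from the two boundary terms plus 3/2 from the integral of 3/(t log³ t).
  suffices h : ∀ x y, Real.exp 1 ≤ x → x ≤ y →
      |(logZetaSum y - Real.log (Real.log y)) - (logZetaSum x - Real.log (Real.log x))| ≤ (7 / 2 * C) / Real.log x ^ 2 by
    obtain ⟨M, hM⟩ := exists_limit_of_log_sq_bound h
    exact ⟨M, 7 / 2 * C, by positivity, hM⟩
  intro x y hx hxy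
  have hx0 : 0 < x := (Real.exp_pos 1).trans_le hx
  have hy := hx.trans hxy
  have hlx := one_le_log_of_exp_le hx
  have hly := one_le_log_of_exp_le hy
  have hlxy : Real.log x ≤ Real.log y := Real.log_le_log hx0 hxy
  have hmeas : IntervalIntegrable (fun t => 3 / (t * Real.log t ^ 4) * mangoldtSum t) volume x y := by
    refine IntervalIntegrable.continuousOn_mul (mangoldtSum_mono.intervalIntegrable) ?_
    rw [Set.uIcc_of_le hxy]
    exact continuousOn_inv_mul_log_pow hx 3 4
  have hmain : ∫ t in x..y, 1 / (t * Real.log t) = Real.log (Real.log y) - Real.log (Real.log x) := by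
    refine intervalIntegral.integral_eq_sub_of_hasDerivAt (f := fun t => Real.log (Real.log t)) ?_ ?_
    · intro t ht
      rw [Set.uIcc_of_le hxy] at ht
      exact hasDerivAt_log_log (hx.trans ht.1)
    · have := continuousOn_inv_mul_log_pow (y := y) hx 1 1
      simp only [pow_one] at this
      exact ContinuousOn.intervalIntegrable (by rwa [Set.uIcc_of_le hxy])
  have hmi : IntervalIntegrable (fun t => 1 / (t * Real.log t)) volume x y := by
    have := continuousOn_inv_mul_log_pow (y := y) hx 1 1
    simp only [pow_one] at this
    exact ContinuousOn.intervalIntegrable (by rwa [Set.uIcc_of_le hxy])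
  have herr : ∫ t in x..y, (3 * C) / (t * Real.log t ^ 3) = 3 / 2 * C * ((Real.log x ^ 2)⁻¹ - (Real.log y ^ 2)⁻¹) := by
    have := intervalIntegral.integral_eq_sub_of_hasDerivAt (a := x) (b := y)
      (f := fun t => -(3 / 2 * C) * (Real.log t ^ (1 + 1))⁻¹) (f' := fun t => (3 * C) / (t * Real.log t ^ 3)) ?_ ?_
    · rw [this]; ring
    · intro t ht
      rw [Set.uIcc_of_le hxy] at ht
      have h1 := (hasDerivAt_inv_log_pow (hx.trans ht.1) 1).const_mul (-(3 / 2 * C))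
      refine h1.congr_deriv ?_
      norm_num
      ring
    · exact ContinuousOn.intervalIntegrable (by rw [Set.uIcc_of_le hxy]; exact continuousOn_inv_mul_log_pow hx _ 3)
  have hdiff : |∫ t in x..y, (3 / (t * Real.log t ^ 4) * mangoldtSum t - 1 / (t * Real.log t))| ≤
      3 / 2 * C * ((Real.log x ^ 2)⁻¹ - (Real.log y ^ 2)⁻¹) := by
    rw [← herr, ← Real.norm_eq_abs]
    refine intervalIntegral.norm_integral_le_of_norm_le hxy ?_ ?_
    · refine ae_of_all _ fun t ht => ?_
      have ht1 : Real.exp 1 ≤ t := hx.trans ht.1.le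
      have ht0 : 0 < t := hx0.trans ht.1
      have hl := one_le_log_of_exp_le ht1
      have : 3 / (t * Real.log t ^ 4) * mangoldtSum t - 1 / (t * Real.log t) =
          3 / (t * Real.log t ^ 4) * (mangoldtSum t - Real.log t ^ 3 / 3) := by
        field_simp
      rw [this, norm_mul, Real.norm_eq_abs, Real.norm_eq_abs, abs_of_pos (by positivity)]
      calc _ ≤ 3 / (t * Real.log t ^ 4) * (C * Real.log t) := by gcongr; exact hE t ht1
        _ = _ := by field_simp
    · exact ContinuousOn.intervalIntegrable (by rw [Set.uIcc_of_le hxy]; exact continuousOn_inv_mul_log_pow hx _ 3)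
  rw [intervalIntegral.integral_sub hmeas hmi, hmain] at hdiff
  have hfrac : ∀ t, Real.exp 1 ≤ t → |mangoldtSum t / Real.log t ^ 3 - 1 / 3| ≤ C / Real.log t ^ 2 := by
    intro t ht
    have hl := one_le_log_of_exp_le ht
    have : mangoldtSum t / Real.log t ^ 3 - 1 / 3 = (mangoldtSum t - Real.log t ^ 3 / 3) / Real.log t ^ 3 := by
      field_simp
    rw [this, abs_div, abs_of_pos (by positivity : 0 < Real.log t ^ 3), div_le_iff₀ (by positivity)]
    refine (hE t ht).trans (le_of_eq ?_)
    field_simp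
  have hfx := abs_le.1 (hfrac x hx)
  have hfy := abs_le.1 (hfrac y hy)
  have hlt : C / Real.log y ^ 2 ≤ C / Real.log x ^ 2 := by gcongr
  have hinv : 0 ≤ (Real.log y ^ 2)⁻¹ := by positivity
  have hd := abs_le.1 hdiff
  have hsum := sum_logZetaCoeff_Ioc hx hxy
  have e1 : 7 / 2 * C / Real.log x ^ 2 = 2 * (C / Real.log x ^ 2) + 3 / 2 * C * (Real.log x ^ 2)⁻¹ := by
    field_simp; ring
  have h0 : 0 ≤ 3 / 2 * C * (Real.log y ^ 2)⁻¹ := by positivity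
  rw [e1, abs_le]
  constructor <;> linarith [hd.1, hd.2, hfx.1, hfx.2, hfy.1, hfy.2]

end Mertens

/-! ### The constant is Euler's constant. -/

namespace Mertens
open Tauberian

lemma integrableOn_abs_log_mul_exp_neg :
    IntegrableOn (fun v : ℝ => |Real.log v| * Real.exp (-v)) (Set.Ioi 0) := by
  have h1 := Real.GammaIntegral_convergent (s := 2) (by norm_num)
  have h2 := (Real.GammaIntegral_convergent (s := 1 / 2) (by norm_num)).const_mul 2
  refine (h1.add h2).mono' (Measurable.aestronglyMeasurable (by fun_prop)) ?_
  refine (ae_restrict_iff' measurableSet_Ioi).2 (ae_of_all _ fun v hv => ?_)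
  have hv0 : (0 : ℝ) < v := hv
  have : |Real.log v| ≤ v + 2 * v ^ (-(1 / 2) : ℝ) := by
    rw [abs_le]
    have h3 := Real.log_le_self hv0.le
    have h4 := Real.log_le_rpow_div (x := v⁻¹) (by positivity) (ε := 1 / 2) (by norm_num)
    rw [Real.log_inv, Real.inv_rpow hv0.le, ← Real.rpow_neg hv0.le] at h4
    have h5 : 0 < v ^ (-(1 / 2) : ℝ) := by positivity
    constructor <;> linarith
  rw [Real.norm_eq_abs, abs_of_nonneg (by positivity)]
  calc _ ≤ (v + 2 * v ^ (-(1 / 2) : ℝ)) * Real.exp (-v) := by gcongr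
    _ = _ := by
      simp only [Pi.add_apply]
      norm_num
      ring

/-- This is Γ'(1) = -γ, computed by differentiating Euler's integral. -/
lemma integral_log_mul_exp_neg :
    ∫ v in Set.Ioi (0 : ℝ), Real.log v * Real.exp (-v) = -Real.eulerMascheroniConstant := by
  have h1 := Complex.hasDerivAt_GammaIntegral (s := 1) (by simp)
  have h2 := Complex.hasDerivAt_Gamma_one
  have h3 : Complex.Gamma =ᶠ[𝓝 1] Complex.GammaIntegral := by
    have : {s : ℂ | 0 < s.re} ∈ 𝓝 (1 : ℂ) :=
      (isOpen_lt continuous_const Complex.continuous_re).mem_nhds (by simp)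
    filter_upwards [this] with s hs using Complex.Gamma_eq_integral hs
  have h4 := (h2.congr_of_eventuallyEq h3.symm).unique h1
  have h5 : ∫ v in Set.Ioi (0 : ℝ), (v : ℂ) ^ ((1 : ℂ) - 1) * (Real.log v * Real.exp (-v)) =
      ((∫ v in Set.Ioi (0 : ℝ), Real.log v * Real.exp (-v) : ℝ) : ℂ) := by
    rw [← integral_complex_ofReal]
    congr 1; ext v; simp
  rw [h5] at h4
  have h6 : ((∫ v in Set.Ioi (0 : ℝ), Real.log v * Real.exp (-v) : ℝ) : ℂ) = ((-Real.eulerMascheroniConstant : ℝ) : ℂ) := by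
    rw [← h4]; push_cast; rfl
  exact_mod_cast h6

/-- The inequality amounts to (log n)³ ≥ 1 where Λ(n) is non-zero, and n = 2 is the only such n for
which this fails. -/
lemma logZetaCoeff_le (n : ℕ) (hn : n ≠ 2) : logZetaCoeff n ≤ mangoldtWeight n := by
  have hv := ArithmeticFunction.vonMangoldt_nonneg (n := n)
  rcases Nat.lt_or_ge n 3 with h | h
  · interval_cases n
    · simp [logZetaCoeff, mangoldtWeight]
    · simp [logZetaCoeff, mangoldtWeight]
    · exact absurd rfl hn
  · have h3 : (3 : ℝ) ≤ n := by exact_mod_cast h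
    have hl : 1 ≤ Real.log n := one_le_log_of_exp_le (by linarith [Real.exp_one_lt_d9])
    unfold logZetaCoeff mangoldtWeight
    rw [div_le_div_iff₀ (by positivity) (by positivity)]
    have h4 : 1 ≤ Real.log n ^ 2 * Real.log n := by
      have := one_le_pow₀ hl (n := 3)
      linarith [pow_succ (Real.log n) 2]
    calc _ = ArithmeticFunction.vonMangoldt n * n * 1 := by ring
      _ ≤ ArithmeticFunction.vonMangoldt n * n * (Real.log n ^ 2 * Real.log n) := by gcongr
      _ = _ := by ring

lemma logZetaCoeff_two : logZetaCoeff 2 = 1 / 2 := by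
  have : Real.log 2 ≠ 0 := (Real.log_pos (by norm_num)).ne'
  simp [logZetaCoeff, ArithmeticFunction.vonMangoldt_apply_prime Nat.prime_two]
  field_simp

lemma logZetaSum_le (x : ℝ) : logZetaSum x ≤ 1 / 2 + mangoldtSum x := by
  unfold logZetaSum mangoldtSum
  have : ∀ k ∈ Finset.Icc 1 ⌊x⌋₊, logZetaCoeff k ≤ (if k = 2 then 1 / 2 else 0) + mangoldtWeight k := by
    intro k _
    by_cases h : k = 2
    · subst h
      rw [logZetaCoeff_two, if_pos rfl]
      linarith [mangoldtWeight_nonneg 2]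
    · rw [if_neg h, zero_add]
      exact logZetaCoeff_le k h
  refine (Finset.sum_le_sum this).trans ?_
  rw [Finset.sum_add_distrib]
  gcongr
  rw [Finset.sum_ite_eq']
  split_ifs <;> norm_num

/-- Abel summation of log ζ(1+δ), followed by t = e^{v/δ}. In this scaling δ → 0 only moves the
argument of the summatory function. -/
lemma log_riemannZeta_eq_integral {δ : ℝ} (hδ : 0 < δ) :
    Real.log (riemannZeta ((1 + δ : ℝ) : ℂ)).re =
      ∫ v in Set.Ioi (0 : ℝ), logZetaSum (Real.exp (v / δ)) * Real.exp (-v) := by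
  obtain ⟨C, hC, hb⟩ := mangoldtSum_le_rpow (r := δ / 2) (by linarith)
  have h1 := LSeries_eq_mul_integral_of_nonneg logZetaCoeff (r := δ / 2) (s := (δ : ℂ)) (by linarith) (by simp; linarith)
    (by
      refine Asymptotics.isBigO_iff.2 ⟨1 / 2 + C, ?_⟩
      filter_upwards [eventually_ge_atTop 1] with n hn
      have hn1 : (1 : ℝ) ≤ n := by exact_mod_cast hn
      have h2 := logZetaSum_le n
      have h3 := hb n (by positivity)
      have h4 : (1 : ℝ) ≤ (n : ℝ) ^ (δ / 2) := Real.one_le_rpow hn1 (by linarith)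
      simp only [logZetaSum, Nat.floor_natCast] at h2
      rw [Real.norm_eq_abs, Real.norm_eq_abs, abs_of_nonneg (by positivity : (0 : ℝ) ≤ (n : ℝ) ^ (δ / 2)),
        abs_of_nonneg (Finset.sum_nonneg fun _ _ => logZetaCoeff_nonneg _)]
      linarith) logZetaCoeff_nonneg
  have h2 : LSeries (fun n => (logZetaCoeff n : ℂ)) δ = ((Real.log (riemannZeta ((1 + δ : ℝ) : ℂ)).re : ℝ) : ℂ) := by
    rw [log_riemannZeta_eq (by linarith), Complex.ofReal_tsum]
    refine tsum_congr fun n => ?_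
    rcases eq_or_ne n 0 with rfl | hn
    · simp
    have hn0 : (0 : ℝ) < n := by positivity
    rw [LSeries.term_of_ne_zero hn, ← Complex.ofReal_natCast, ← Complex.ofReal_cpow hn0.le, ← Complex.ofReal_div]
    congr 1
    rw [Real.rpow_add hn0, Real.rpow_one]
    unfold logZetaCoeff
    rw [div_div]
    congr 1
    ring
  have h3 := integral_comp_exp_Ioi (fun t : ℝ => logZetaSum t * t ^ (-(δ + 1))) 0
  rw [Real.exp_zero] at h3
  have h4 : ∫ t in Set.Ioi (1 : ℝ), (∑ k ∈ Finset.Icc 1 ⌊t⌋₊, (logZetaCoeff k : ℂ)) * (t : ℂ) ^ (-((δ : ℂ) + 1)) =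
      ((∫ t in Set.Ioi (1 : ℝ), logZetaSum t * t ^ (-(δ + 1)) : ℝ) : ℂ) := by
    rw [← integral_complex_ofReal]
    refine setIntegral_congr_fun measurableSet_Ioi fun t ht => ?_
    have ht0 : (0 : ℝ) ≤ t := by linarith [Set.mem_Ioi.1 ht]
    simp only [logZetaSum]
    push_cast [Complex.ofReal_cpow ht0]
    rfl
  rw [h2, h4] at h1
  have h5 : Real.log (riemannZeta ((1 + δ : ℝ) : ℂ)).re = δ * ∫ t in Set.Ioi (1 : ℝ), logZetaSum t * t ^ (-(δ + 1)) := by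
    exact_mod_cast h1
  rw [h5, ← h3]
  have h6 := integral_comp_mul_left_Ioi (fun v : ℝ => logZetaSum (Real.exp (v / δ)) * Real.exp (-v)) 0 hδ
  rw [mul_zero, smul_eq_mul] at h6
  have h7 : ∫ u in Set.Ioi (0 : ℝ), Real.exp u • (logZetaSum (Real.exp u) * Real.exp u ^ (-(δ + 1))) =
      ∫ u in Set.Ioi (0 : ℝ), logZetaSum (Real.exp (δ * u / δ)) * Real.exp (-(δ * u)) := by
    refine setIntegral_congr_fun measurableSet_Ioi fun u _ => ?_
    have : δ * u / δ = u := by field_simp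
    simp only [smul_eq_mul, this]
    rw [← Real.exp_mul, mul_left_comm, ← Real.exp_add]
    congr 2; ring
  rw [h7, h6]
  field_simp

/-- Inserting log log x + M into the integral for log ζ(1+δ) gives -log δ + M - γ + o(1), by Γ'(1) =
-γ and dominated convergence. Since log ζ(1+δ) + log δ → 0, it follows that M = γ. -/
theorem exists_logZetaSum_sub_le :
    ∃ C : ℝ, 0 ≤ C ∧ ∀ x, Real.exp 1 ≤ x →
      |logZetaSum x - Real.log (Real.log x) - Real.eulerMascheroniConstant| ≤ C / Real.log x ^ 2 := by
  obtain ⟨M, C, hC, hb⟩ := exists_logZetaSum_asymp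
  suffices hM : M = Real.eulerMascheroniConstant by
    rw [← hM]; exact ⟨C, hC, hb⟩
  set ε : ℝ → ℝ := fun u => logZetaSum (Real.exp u) - Real.log u - M with hε
  have hε1 : ∀ u, 1 ≤ u → |ε u| ≤ C / u ^ 2 := by
    intro u hu
    have := hb (Real.exp u) (Real.exp_le_exp.2 hu)
    rwa [Real.log_exp] at this
  set D := C + logZetaSum (Real.exp 1) + |M| with hD
  have hS := logZetaSum_nonneg (Real.exp 1)
  -- A majorant uniform in δ: when v/δ ≥ 1 the error is bounded, and when v ≤ v/δ ≤ 1 its logarithm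
  -- is at most |log v| in absolute value.
  have hε2 : ∀ δ v : ℝ, 0 < δ → δ ≤ 1 → 0 < v → |ε (v / δ)| ≤ D + |Real.log v| := by
    intro δ v hδ hδ1 hv
    have hvd : v ≤ v / δ := by rw [le_div_iff₀ hδ]; nlinarith
    rcases le_total 1 (v / δ) with h | h
    · have h1 := hε1 _ h
      have h2 : C / (v / δ) ^ 2 ≤ C := div_le_self hC (one_le_pow₀ h)
      have := abs_nonneg M
      have := abs_nonneg (Real.log v)
      linarith
    · have h0 : 0 < v / δ := by positivity
      have h1 : |Real.log (v / δ)| ≤ |Real.log v| := by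
        rw [abs_of_nonpos (Real.log_nonpos h0.le h), abs_of_nonpos (Real.log_nonpos hv.le (hvd.trans h))]
        exact neg_le_neg (Real.log_le_log hv hvd)
      have h2 : |logZetaSum (Real.exp (v / δ))| ≤ logZetaSum (Real.exp 1) := by
        rw [abs_of_nonneg (logZetaSum_nonneg _)]
        exact logZetaSum_mono (Real.exp_le_exp.2 h)
      have h3 : |ε (v / δ)| ≤ |logZetaSum (Real.exp (v / δ))| + |Real.log (v / δ)| + |M| := by
        simp only [hε]
        refine (abs_sub _ _).trans ?_
        gcongr
        exact abs_sub _ _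
      linarith
  have hexp : IntegrableOn (fun v : ℝ => Real.exp (-v)) (Set.Ioi 0) := by
    simpa using integrableOn_exp_mul_Ioi (a := -1) (by norm_num) 0
  have hlogint : IntegrableOn (fun v : ℝ => Real.log v * Real.exp (-v)) (Set.Ioi 0) := by
    refine integrableOn_abs_log_mul_exp_neg.mono' (Measurable.aestronglyMeasurable (by fun_prop)) (ae_of_all _ fun v => ?_)
    rw [norm_mul, Real.norm_eq_abs, Real.norm_eq_abs, abs_of_pos (Real.exp_pos _)]
  have hdom : IntegrableOn (fun v : ℝ => (D + |Real.log v|) * Real.exp (-v)) (Set.Ioi 0) := by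
    refine ((hexp.const_mul D).add integrableOn_abs_log_mul_exp_neg).congr (ae_of_all _ fun v => ?_)
    simp only [Pi.add_apply]; ring
  have hεmeas : ∀ δ : ℝ, AEStronglyMeasurable (fun v => ε (v / δ) * Real.exp (-v)) (volume.restrict (Set.Ioi 0)) := by
    intro δ
    refine Measurable.aestronglyMeasurable ?_
    have h1 : Measurable fun v : ℝ => logZetaSum (Real.exp (v / δ)) :=
      logZetaSum_mono.measurable.comp (by fun_prop)
    simp only [hε]
    fun_prop
  have hεint : ∀ δ : ℝ, 0 < δ → δ ≤ 1 → IntegrableOn (fun v => ε (v / δ) * Real.exp (-v)) (Set.Ioi 0) := by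
    intro δ hδ hδ1
    refine hdom.mono' (hεmeas δ) ((ae_restrict_iff' measurableSet_Ioi).2 (ae_of_all _ fun v hv => ?_))
    rw [norm_mul, Real.norm_eq_abs, Real.norm_eq_abs, abs_of_pos (Real.exp_pos _)]
    gcongr
    exact hε2 δ v hδ hδ1 hv
  have hform : ∀ δ : ℝ, 0 < δ → δ ≤ 1 → Real.log (riemannZeta ((1 + δ : ℝ) : ℂ)).re + Real.log δ =
      M - Real.eulerMascheroniConstant + ∫ v in Set.Ioi (0 : ℝ), ε (v / δ) * Real.exp (-v) := by
    intro δ hδ hδ1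
    rw [log_riemannZeta_eq_integral hδ]
    have h1 : ∫ v in Set.Ioi (0 : ℝ), logZetaSum (Real.exp (v / δ)) * Real.exp (-v) =
        ∫ v in Set.Ioi (0 : ℝ), ((Real.log v * Real.exp (-v) + (M - Real.log δ) * Real.exp (-v)) + ε (v / δ) * Real.exp (-v)) := by
      refine setIntegral_congr_fun measurableSet_Ioi fun v hv => ?_
      have hv0 : (v : ℝ) ≠ 0 := (Set.mem_Ioi.1 hv).ne'
      simp only [hε]
      rw [Real.log_div hv0 hδ.ne']
      ring
    have h2 : ∫ v in Set.Ioi (0 : ℝ), Real.exp (-v) = 1 := integral_exp_neg_Ioi_zero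
    have h3 : IntegrableOn (fun v : ℝ => Real.log v * Real.exp (-v) + (M - Real.log δ) * Real.exp (-v)) (Set.Ioi 0) :=
      hlogint.add (hexp.const_mul _)
    rw [h1, integral_add h3 (hεint δ hδ hδ1),
      integral_add hlogint (hexp.const_mul _), integral_log_mul_exp_neg, integral_const_mul, h2]
    ring
  have hδn : Tendsto (fun n : ℕ => 1 / ((n : ℝ) + 1)) atTop (𝓝 0) := tendsto_one_div_add_atTop_nhds_zero_nat
  have hδpos : ∀ n : ℕ, 0 < 1 / ((n : ℝ) + 1) := fun n => by positivity
  have hδle : ∀ n : ℕ, 1 / ((n : ℝ) + 1) ≤ 1 := fun n => by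
    rw [div_le_one (by positivity)]; linarith [(Nat.cast_nonneg n : (0 : ℝ) ≤ n)]
  have hlim1 : Tendsto (fun n : ℕ => ∫ v in Set.Ioi (0 : ℝ), ε (v / (1 / ((n : ℝ) + 1))) * Real.exp (-v)) atTop
      (𝓝 (∫ v in Set.Ioi (0 : ℝ), (0 : ℝ))) := by
    refine tendsto_integral_of_dominated_convergence (fun v : ℝ => (D + |Real.log v|) * Real.exp (-v))
      (fun n => hεmeas _) hdom (fun n => ?_) ?_
    · refine (ae_restrict_iff' measurableSet_Ioi).2 (ae_of_all _ fun v hv => ?_)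
      rw [norm_mul, Real.norm_eq_abs, Real.norm_eq_abs, abs_of_pos (Real.exp_pos _)]
      gcongr
      exact hε2 _ v (hδpos n) (hδle n) hv
    · refine (ae_restrict_iff' measurableSet_Ioi).2 (ae_of_all _ fun v hv => ?_)
      have hv0 : (0 : ℝ) < v := hv
      have h1 : Tendsto (fun n : ℕ => v / (1 / ((n : ℝ) + 1))) atTop atTop := by
        have : ∀ n : ℕ, v / (1 / ((n : ℝ) + 1)) = v * ((n : ℝ) + 1) := fun n => by field_simp
        simp_rw [this]
        exact (tendsto_atTop_add_const_right _ _ tendsto_natCast_atTop_atTop).const_mul_atTop hv0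
      have h2 : Tendsto ε atTop (𝓝 0) := by
        refine squeeze_zero_norm' (a := fun u => C / u ^ 2) ?_ ((tendsto_pow_atTop two_ne_zero).const_div_atTop C)
        filter_upwards [eventually_ge_atTop 1] with u hu using hε1 u hu
      simpa using (h2.comp h1).mul_const (Real.exp (-v))
  have hlim2 : Tendsto (fun n : ℕ => Real.log (riemannZeta ((1 + 1 / ((n : ℝ) + 1) : ℝ) : ℂ)).re + Real.log (1 / ((n : ℝ) + 1)))
      atTop (𝓝 0) := by
    have h1 := (Asymptotics.isLittleO_one_iff ℝ).1 log_riemannZeta_add_log_sub_isLittleO_ofReal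
    have h2 : Tendsto (fun n : ℕ => 1 + 1 / ((n : ℝ) + 1)) atTop (𝓝[>] 1) := by
      refine tendsto_nhdsWithin_iff.2 ⟨by simpa using hδn.const_add 1, Eventually.of_forall fun n => ?_⟩
      have := hδpos n
      simp only [Set.mem_Ioi]; linarith
    have h3 := h1.comp h2
    refine h3.congr fun n => ?_
    simp only [Function.comp_apply, add_sub_cancel_left]
  have hlim3 := hlim2.congr fun n => hform _ (hδpos n) (hδle n)
  have hlim4 := hlim1.const_add (M - Real.eulerMascheroniConstant)
  have := tendsto_nhds_unique hlim3 hlim4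
  simp at this
  linarith

end Mertens

/-! ### From Λ(n)/(n log n) to Euler factors at primes, for both signs. -/

namespace Mertens
open Tauberian

lemma log_pow_le_rpow (n : ℕ) {a : ℝ} (ha : 0 < a) (k : ℕ) :
    Real.log n ^ k ≤ (n : ℝ) ^ (a * k) / a ^ k := by
  have h := Real.log_le_rpow_div (x := n) (by positivity) ha
  have h0 : 0 ≤ Real.log n := Real.log_natCast_nonneg n
  calc Real.log n ^ k ≤ ((n : ℝ) ^ a / a) ^ k := by gcongr
    _ = _ := by rw [div_pow, ← Real.rpow_natCast, ← Real.rpow_mul (by positivity)]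

/-- ψ - θ is O(√x), so the Dirichlet series of Λ over proper prime powers converges to the right of
1/2. The point 3/4 leaves room for logarithms. -/
lemma summable_vonMangoldt_nonprime :
    Summable fun n : ℕ => (if n.Prime then 0 else ArithmeticFunction.vonMangoldt n) * (n : ℝ) ^ (-(3 / 4) : ℝ) := by
  set f : ℕ → ℝ := fun n => if n.Prime then 0 else ArithmeticFunction.vonMangoldt n with hf
  have hf0 : ∀ n, 0 ≤ f n := fun n => by
    simp only [hf]; split_ifs
    · exact le_rfl
    · exact ArithmeticFunction.vonMangoldt_nonneg
  have h := LSeriesSummable_of_sum_norm_bigO_and_nonneg (f := f) (r := 1 / 2) (s := ((3 / 4 : ℝ) : ℂ)) ?_ hf0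
    (by norm_num) (by rw [Complex.ofReal_re]; norm_num)
  · have h2 := h.norm
    refine h2.congr fun n => ?_
    rcases eq_or_ne n 0 with rfl | hn
    · simp
    rw [LSeries.term_of_ne_zero hn, norm_div, Complex.norm_real, Real.norm_eq_abs, abs_of_nonneg (hf0 n),
      ← Complex.ofReal_natCast, Complex.norm_cpow_eq_rpow_re_of_pos (by positivity), Complex.ofReal_re,
      Real.rpow_neg (by positivity), div_eq_mul_inv]
  · have h1 := Chebyshev.isBigO_psi_sub_theta_sqrt.comp_tendsto tendsto_natCast_atTop_atTop
    refine (h1.congr_left fun n => ?_).trans (Asymptotics.isBigO_of_le _ fun n => ?_)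
    · simp only [Function.comp_apply, Pi.sub_apply]
      rw [Chebyshev.psi_sub_theta_eq_sum_not_prime, Nat.floor_natCast, Finset.sum_filter]
      have : Finset.Icc 1 n = Finset.Ioc 0 n := rfl
      rw [this]
      refine Finset.sum_congr rfl fun k _ => ?_
      simp only [hf]
      split_ifs <;> simp_all
    · simp only [Function.comp_apply]
      rw [Real.sqrt_eq_rpow]

/-- The summand `-log (1 - 1/p)` at primes. -/
noncomputable def mertensWeight (n : ℕ) : ℝ := if n.Prime then -Real.log (1 - 1 / n) else 0

lemma neg_log_one_sub_sub_le {x : ℝ} (hx : 0 ≤ x) (hx1 : x ≤ 1 / 2) :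
    0 ≤ -Real.log (1 - x) - x ∧ -Real.log (1 - x) - x ≤ 2 * x ^ 2 := by
  have h1 := Real.log_le_sub_one_of_pos (x := 1 - x) (by linarith)
  have h2 := Real.one_sub_inv_le_log_of_pos (x := 1 - x) (by linarith)
  refine ⟨by linarith, ?_⟩
  have h := Real.abs_log_sub_add_sum_range_le (x := x) (by rw [abs_of_nonneg hx]; linarith) 1
  simp only [Finset.sum_range_one, zero_add, pow_one, Nat.cast_zero, div_one, Nat.reduceAdd] at h
  have h3 := (abs_le.1 h).1
  rw [abs_of_nonneg hx] at h3
  have h4 : x ^ (1 + 1) / (1 - x) ≤ 2 * x ^ 2 := by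
    rw [div_le_iff₀ (by linarith)]
    norm_num
    nlinarith [sq_nonneg x, mul_nonneg (sq_nonneg x) (sub_nonneg.2 hx1)]
  norm_num at h3 h4
  linarith

lemma vonMangoldt_prime_div {p : ℕ} (hp : p.Prime) : logZetaCoeff p = 1 / p := by
  have : Real.log p ≠ 0 := (Real.log_pos (by exact_mod_cast hp.one_lt)).ne'
  have h0 : (p : ℝ) ≠ 0 := by exact_mod_cast hp.ne_zero
  rw [logZetaCoeff, ArithmeticFunction.vonMangoldt_apply_prime hp]
  field_simp

/-- At primes the difference is O(p^{-2}). Otherwise it is a term of the proper prime power series.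
The factor log³ makes tails of the difference small enough for an error 1/log² x. -/
lemma summable_abs_mertensWeight_sub :
    Summable fun n : ℕ => |mertensWeight n - logZetaCoeff n| * Real.log n ^ 3 := by
  have hs1 : Summable fun n : ℕ => 432 * (n : ℝ) ^ (-(3 / 2) : ℝ) :=
    (Real.summable_nat_rpow.2 (by norm_num)).mul_left _
  have hs2 := summable_vonMangoldt_nonprime.mul_left 64
  refine Summable.of_nonneg_of_le (fun n => ?_) (fun n => ?_) (hs1.add hs2)
  · have : 0 ≤ Real.log n := Real.log_natCast_nonneg n
    positivity
  · rcases eq_or_ne n 0 with rfl | hn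
    · simp
    have hn0 : (0 : ℝ) < n := by positivity
    have hl : 0 ≤ Real.log n := Real.log_natCast_nonneg n
    by_cases hp : n.Prime
    · rw [vonMangoldt_prime_div hp, mertensWeight, if_pos hp, if_pos hp]
      have h2 : (2 : ℝ) ≤ n := by exact_mod_cast hp.two_le
      have h3 : 1 / (n : ℝ) ≤ 1 / 2 := by gcongr
      have h4 : 0 ≤ 1 / (n : ℝ) := by positivity
      obtain ⟨h5, h6⟩ := neg_log_one_sub_sub_le h4 h3
      rw [abs_of_nonneg h5]
      have h7 := log_pow_le_rpow n (a := 1 / 6) (by norm_num) 3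
      calc _ ≤ 2 * (1 / (n : ℝ)) ^ 2 * ((n : ℝ) ^ ((1 / 6) * (3 : ℕ) : ℝ) / (1 / 6) ^ 3) := by gcongr
        _ = 432 * ((n : ℝ) ^ (-2 : ℝ) * (n : ℝ) ^ ((1 / 6) * (3 : ℕ) : ℝ)) := by
          rw [Real.rpow_neg hn0.le, Real.rpow_two]
          field_simp
          norm_num
        _ = 432 * (n : ℝ) ^ (-(3 / 2) : ℝ) := by
          rw [← Real.rpow_add hn0]; norm_num
        _ ≤ _ := by simp
    · rw [mertensWeight, if_neg hp, if_neg hp, zero_sub, abs_neg, abs_of_nonneg (logZetaCoeff_nonneg n)]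
      have hv := ArithmeticFunction.vonMangoldt_nonneg (n := n)
      have h7 := log_pow_le_rpow n (a := 1 / 8) (by norm_num) 2
      calc logZetaCoeff n * Real.log n ^ 3 ≤ ArithmeticFunction.vonMangoldt n * Real.log n ^ 2 / n := by
            rcases hl.eq_or_lt with h | h
            · rw [← h]; simp
            · unfold logZetaCoeff; apply le_of_eq; field_simp
        _ ≤ ArithmeticFunction.vonMangoldt n * ((n : ℝ) ^ ((1 / 8) * (2 : ℕ) : ℝ) / (1 / 8) ^ 2) / n := by gcongr
        _ = 64 * (ArithmeticFunction.vonMangoldt n * ((n : ℝ) ^ ((1 / 8) * (2 : ℕ) : ℝ) * (n : ℝ) ^ (-1 : ℝ))) := by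
          rw [Real.rpow_neg_one]
          field_simp
          norm_num
        _ = 64 * (ArithmeticFunction.vonMangoldt n * (n : ℝ) ^ (-(3 / 4) : ℝ)) := by
          rw [← Real.rpow_add hn0]; norm_num
        _ ≤ _ := by
          have : 0 ≤ 432 * (n : ℝ) ^ (-(3 / 2) : ℝ) := by positivity
          linarith

lemma summable_of_mul_log_cube {e : ℕ → ℝ} (h : Summable fun n : ℕ => |e n| * Real.log n ^ 3) : Summable e := by
  refine Summable.of_norm_bounded_eventually_nat h ?_
  filter_upwards [eventually_ge_atTop 3] with n hn
  have h3 : (3 : ℝ) ≤ n := by exact_mod_cast hn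
  have hl : 1 ≤ Real.log n := one_le_log_of_exp_le (by linarith [Real.exp_one_lt_d9])
  rw [Real.norm_eq_abs]
  exact le_mul_of_one_le_right (abs_nonneg _) (one_le_pow₀ hl)

/-- Partial sums approach the total at rate `(log x)^{-2}`. -/
lemma abs_sum_sub_tsum_le {e : ℕ → ℝ} (h0 : e 0 = 0) (h : Summable fun n : ℕ => |e n| * Real.log n ^ 3) {x : ℝ}
    (hx : Real.exp 1 ≤ x) :
    |∑ k ∈ Finset.Icc 1 ⌊x⌋₊, e k - ∑' k, e k| ≤ (∑' n : ℕ, |e n| * Real.log n ^ 3) / Real.log x ^ 2 := by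
  have hs := summable_of_mul_log_cube h
  have hx0 : 0 < x := (Real.exp_pos 1).trans_le hx
  have hlx := one_le_log_of_exp_le hx
  have h1 : ∑ k ∈ Finset.Icc 1 ⌊x⌋₊, e k = ∑ k ∈ Finset.range (⌊x⌋₊ + 1), e k := by
    rw [Finset.range_eq_Ico, Finset.sum_eq_sum_Ico_succ_bot (Nat.succ_pos _), h0, zero_add]
    rfl
  rw [h1, ← hs.sum_add_tsum_nat_add (⌊x⌋₊ + 1), sub_add_cancel_left, abs_neg]
  have hsh := (summable_nat_add_iff (⌊x⌋₊ + 1)).2 h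
  have hbd : ∀ n : ℕ, ‖e (n + (⌊x⌋₊ + 1))‖ ≤ (|e (n + (⌊x⌋₊ + 1))| * Real.log ((n + (⌊x⌋₊ + 1) : ℕ) : ℝ) ^ 3) / Real.log x ^ 2 := by
    intro n
    rw [le_div_iff₀ (by positivity), Real.norm_eq_abs]
    have h2 : x ≤ ((n + (⌊x⌋₊ + 1) : ℕ) : ℝ) := by
      have := Nat.lt_floor_add_one x
      push_cast
      linarith [(Nat.cast_nonneg n : (0 : ℝ) ≤ n)]
    have h3 := Real.log_le_log hx0 h2
    gcongr
    calc Real.log x ^ 2 ≤ Real.log x ^ 3 := pow_le_pow_right₀ hlx (by norm_num)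
      _ ≤ _ := by gcongr
  refine (tsum_of_norm_bounded (hsh.div_const (Real.log x ^ 2)).hasSum hbd).trans ?_
  rw [tsum_div_const]
  refine div_le_div_of_nonneg_right ?_ (by positivity)
  rw [← h.sum_add_tsum_nat_add (⌊x⌋₊ + 1)]
  have : 0 ≤ ∑ i ∈ Finset.range (⌊x⌋₊ + 1), |e i| * Real.log i ^ 3 :=
    Finset.sum_nonneg fun i _ => by
      have : 0 ≤ Real.log i := Real.log_natCast_nonneg i
      positivity
  linarith

/-- For each p the series -log(1 - 1/p) - 1/p = ∑_{k≥2} 1/(k p^k) consists exactly of the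
coefficients at proper powers of p. Replacing one weight by the other therefore leaves the constant
γ unchanged. -/
lemma tsum_mertensWeight_sub : ∑' n : ℕ, (mertensWeight n - logZetaCoeff n) = 0 := by
  have hs := summable_of_mul_log_cube summable_abs_mertensWeight_sub
  -- split into primes and non-primes
  set f : ℕ → ℝ := fun n => if n.Prime then 0 else logZetaCoeff n with hf
  set g : ℕ → ℝ := fun n => if n.Prime then mertensWeight n - 1 / n else 0 with hg
  have hfg : ∀ n, mertensWeight n - logZetaCoeff n = g n - f n := by
    intro n
    simp only [hf, hg]
    split_ifs with h
    · rw [vonMangoldt_prime_div h]; ring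
    · simp [mertensWeight, h]
  have hsf : Summable f := by
    refine Summable.of_norm_bounded hs.abs fun n => ?_
    rw [hfg]; simp only [hf, hg]
    split_ifs with h
    · simp
    · simp
  have hsg : Summable g := by
    refine Summable.of_norm_bounded hs.abs fun n => ?_
    rw [hfg]; simp only [hf, hg]
    split_ifs with h
    · simp
    · simp
  simp_rw [hfg]
  rw [hsg.tsum_sub hsf, sub_eq_zero]
  have h1 : ∑' n, f n = ∑' n : {n : ℕ // IsPrimePow n}, f n := by
    refine (tsum_subtype_eq_of_support_subset (s := {n : ℕ | IsPrimePow n}) ?_).symm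
    intro n hn
    contrapose! hn
    have : ArithmeticFunction.vonMangoldt n = 0 := ArithmeticFunction.vonMangoldt_eq_zero_iff.2 hn
    simp [hf, logZetaCoeff, this]
  have h2 : ∑' n, g n = ∑' p : Nat.Primes, g p := by
    refine (tsum_subtype_eq_of_support_subset (s := {n : ℕ | n.Prime}) ?_).symm
    intro n hn
    contrapose! hn
    have : ¬ n.Prime := hn
    simp [hg, this]
  rw [h1, h2, ← tsum_primes_pow_eq (f := f) (hsf.comp_injective Subtype.coe_injective)]
  refine tsum_congr fun p => ?_
  have hp := p.2
  have hp2 : (2 : ℝ) ≤ (p : ℕ) := by exact_mod_cast hp.two_le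
  have hx1 : 1 / ((p : ℕ) : ℝ) ≤ 1 / 2 := by gcongr
  have hx0 : 0 < 1 / ((p : ℕ) : ℝ) := by positivity
  have hsum := Real.hasSum_pow_div_log_of_abs_lt_one (x := 1 / ((p : ℕ) : ℝ)) (by rw [abs_of_pos hx0]; linarith)
  have hsum1 := (hasSum_nat_add_iff' 1).2 hsum
  have hgp : g p = -Real.log (1 - 1 / ((p : ℕ) : ℝ)) - 1 / ((p : ℕ) : ℝ) := by
    simp only [hg, if_pos hp, mertensWeight]
  have hfp : ∀ k : ℕ, f ((p : ℕ) ^ (k + 1)) = if k = 0 then 0 else (1 / ((p : ℕ) : ℝ)) ^ (k + 1) / (k + 1) := by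
    intro k
    rcases eq_or_ne k 0 with rfl | hk
    · simp [hf, hp]
    · have hnp : ¬ ((p : ℕ) ^ (k + 1)).Prime := Nat.Prime.not_prime_pow (by omega)
      have hlog : Real.log (p : ℕ) ≠ 0 := (Real.log_pos (by linarith)).ne'
      simp only [hf, if_neg hnp, if_neg hk, logZetaCoeff]
      rw [ArithmeticFunction.vonMangoldt_apply_pow (by omega), ArithmeticFunction.vonMangoldt_apply_prime hp]
      push_cast
      rw [Real.log_pow]
      push_cast
      rw [one_div_pow]
      field_simp
  rw [hgp]
  simp_rw [hfp]
  have h3 : Summable fun k : ℕ => if k = 0 then (0 : ℝ) else (1 / ((p : ℕ) : ℝ)) ^ (k + 1) / (k + 1) := by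
    rw [← summable_nat_add_iff 1]
    refine hsum1.summable.congr fun k => ?_
    simp
  rw [← h3.sum_add_tsum_nat_add 1]
  simp only [Finset.sum_range_one, if_pos, Nat.add_eq_zero_iff, one_ne_zero, and_false, if_false, zero_add]
  rw [hsum1.tsum_eq]
  simp

/-- The summand `-ε log (1 - ε/p)` at primes, for a sign `ε`. -/
noncomputable def eulerWeight (ε : ℝ) (n : ℕ) : ℝ := if n.Prime then -ε * Real.log (1 - ε / n) else 0

/-- `∑_{p ≤ x} -ε log (1 - ε/p)`. -/
noncomputable def eulerSum (ε x : ℝ) : ℝ := ∑ k ∈ Finset.Icc 1 ⌊x⌋₊, eulerWeight ε k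

/-- The constant term of `eulerSum ε`. -/
noncomputable def eulerConst (ε : ℝ) : ℝ :=
  Real.eulerMascheroniConstant - if ε = 1 then 0 else Real.log (Real.pi ^ 2 / 6)

lemma eulerWeight_one (n : ℕ) : eulerWeight 1 n = mertensWeight n := by
  simp [eulerWeight, mertensWeight]

theorem exists_eulerSum_one_sub_le :
    ∃ C : ℝ, 0 ≤ C ∧ ∀ x : ℝ, Real.exp 1 ≤ x →
      |eulerSum 1 x - Real.log (Real.log x) - eulerConst 1| ≤ C / Real.log x ^ 2 := by
  obtain ⟨C, hC, h⟩ := exists_logZetaSum_sub_le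
  refine ⟨C + ∑' n : ℕ, |mertensWeight n - logZetaCoeff n| * Real.log n ^ 3, add_nonneg hC (tsum_nonneg fun n => ?_), fun x hx => ?_⟩
  · have : 0 ≤ Real.log n := Real.log_natCast_nonneg n
    positivity
  have h1 := abs_sum_sub_tsum_le (e := fun n => mertensWeight n - logZetaCoeff n) (by simp [mertensWeight, logZetaCoeff])
    summable_abs_mertensWeight_sub hx
  rw [tsum_mertensWeight_sub, sub_zero, Finset.sum_sub_distrib] at h1
  have h2 : eulerSum 1 x - Real.log (Real.log x) - eulerConst 1 =
      (logZetaSum x - Real.log (Real.log x) - Real.eulerMascheroniConstant) +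
      (∑ k ∈ Finset.Icc 1 ⌊x⌋₊, mertensWeight k - ∑ k ∈ Finset.Icc 1 ⌊x⌋₊, logZetaCoeff k) := by
    simp only [eulerSum, eulerWeight_one, logZetaSum, eulerConst]
    simp only [if_true]
    ring
  rw [h2, add_div]
  exact (abs_add_le _ _).trans (add_le_add (h x hx) h1)

/-- From 1 - 1/p² = (1 - 1/p)(1 + 1/p). The extra terms sum to -log ζ(2), which is where π²/6 enters
the lower tail. -/
lemma eulerWeight_neg_one (n : ℕ) :
    eulerWeight (-1) n = mertensWeight n + if n.Prime then Real.log (1 - 1 / (n : ℝ) ^ 2) else 0 := by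
  unfold eulerWeight mertensWeight
  split_ifs with h
  · have h2 : (2 : ℝ) ≤ n := by exact_mod_cast h.two_le
    have h3 : 1 / (n : ℝ) ≤ 1 / 2 := by gcongr
    have h4 : 0 ≤ 1 / (n : ℝ) := by positivity
    have h5 : 1 - 1 / (n : ℝ) ^ 2 = (1 - 1 / n) * (1 + 1 / n) := by ring
    rw [h5, Real.log_mul (by linarith) (by linarith), neg_div, sub_neg_eq_add]
    ring
  · simp

lemma abs_log_one_sub_sq_le {n : ℕ} (hn : n.Prime) : |Real.log (1 - 1 / (n : ℝ) ^ 2)| ≤ 2 * (n : ℝ) ^ (-2 : ℝ) := by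
  have h2 : (2 : ℝ) ≤ n := by exact_mod_cast hn.two_le
  have h4 : 0 < 1 / (n : ℝ) ^ 2 := by positivity
  have h3 : 1 / (n : ℝ) ^ 2 ≤ 1 / 2 := by
    gcongr
    nlinarith
  have h5 := neg_log_one_sub_sub_le h4.le h3
  rw [Real.rpow_neg (by positivity), Real.rpow_two, ← one_div, abs_of_nonpos]
  · nlinarith
  · linarith

lemma tsum_log_one_sub_sq :
    ∑' n : ℕ, (if n.Prime then Real.log (1 - 1 / (n : ℝ) ^ 2) else 0) = -Real.log (Real.pi ^ 2 / 6) := by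
  have h1 := riemannZeta_eulerProduct_exp_log (s := 2) (by norm_num)
  have h2 : ∑' n : ℕ, (if n.Prime then Real.log (1 - 1 / (n : ℝ) ^ 2) else 0) =
      ∑' p : Nat.Primes, Real.log (1 - 1 / ((p : ℕ) : ℝ) ^ 2) := by
    rw [← tsum_subtype_eq_of_support_subset (s := {n : ℕ | n.Prime})]
    · exact tsum_congr fun p => if_pos p.2
    · intro n hn
      contrapose! hn
      have : ¬ n.Prime := hn
      simp [this]
  have h3 : ∑' p : Nat.Primes, -Complex.log (1 - (p : ℂ) ^ (-2 : ℂ)) =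
      ((-∑' p : Nat.Primes, Real.log (1 - 1 / ((p : ℕ) : ℝ) ^ 2) : ℝ) : ℂ) := by
    rw [← tsum_neg, Complex.ofReal_tsum]
    refine tsum_congr fun p => ?_
    have h2 : (2 : ℝ) ≤ (p : ℕ) := by exact_mod_cast p.2.two_le
    have h3 : 1 / ((p : ℕ) : ℝ) ^ 2 ≤ 1 / 2 := by
      gcongr
      nlinarith
    rw [Complex.ofReal_neg, Complex.ofReal_log (by linarith)]
    push_cast
    rw [Complex.cpow_neg]
    norm_num
  rw [h3, riemannZeta_two] at h1
  have h4 : Real.exp (-∑' p : Nat.Primes, Real.log (1 - 1 / ((p : ℕ) : ℝ) ^ 2)) = Real.pi ^ 2 / 6 := by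
    exact_mod_cast h1
  rw [h2, ← h4, Real.log_exp, neg_neg]

theorem exists_eulerSum_neg_one_sub_le :
    ∃ C : ℝ, 0 ≤ C ∧ ∀ x : ℝ, Real.exp 1 ≤ x →
      |eulerSum (-1) x - Real.log (Real.log x) - eulerConst (-1)| ≤ C / Real.log x ^ 2 := by
  obtain ⟨C, hC, h⟩ := exists_eulerSum_one_sub_le
  set e : ℕ → ℝ := fun n => if n.Prime then Real.log (1 - 1 / (n : ℝ) ^ 2) else 0 with he
  have hs : Summable fun n : ℕ => |e n| * Real.log n ^ 3 := by
    refine Summable.of_nonneg_of_le (fun n => ?_) (fun n => ?_)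
      ((Real.summable_nat_rpow.2 (show (-(3 / 2) : ℝ) < -1 by norm_num)).mul_left 432)
    · have : 0 ≤ Real.log n := Real.log_natCast_nonneg n
      positivity
    · by_cases hn : n.Prime
      · have hn0 : (0 : ℝ) < n := by exact_mod_cast hn.pos
        have hl : 0 ≤ Real.log n := Real.log_natCast_nonneg n
        have h7 := log_pow_le_rpow n (a := 1 / 6) (by norm_num) 3
        simp only [he, if_pos hn]
        calc _ ≤ 2 * (n : ℝ) ^ (-2 : ℝ) * ((n : ℝ) ^ ((1 / 6) * (3 : ℕ) : ℝ) / (1 / 6) ^ 3) := by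
              gcongr
              exact abs_log_one_sub_sq_le hn
          _ = 432 * ((n : ℝ) ^ (-2 : ℝ) * (n : ℝ) ^ ((1 / 6) * (3 : ℕ) : ℝ)) := by ring
          _ = _ := by rw [← Real.rpow_add hn0]; norm_num
      · simp only [he, if_neg hn, abs_zero, zero_mul]
        positivity
  refine ⟨C + ∑' n : ℕ, |e n| * Real.log n ^ 3, add_nonneg hC (tsum_nonneg fun n => ?_), fun x hx => ?_⟩
  · have : 0 ≤ Real.log n := Real.log_natCast_nonneg n
    positivity
  have h1 := abs_sum_sub_tsum_le (e := e) (by simp [he]) hs hx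
  have h2 : eulerSum (-1) x - Real.log (Real.log x) - eulerConst (-1) =
      (eulerSum 1 x - Real.log (Real.log x) - eulerConst 1) +
      (∑ k ∈ Finset.Icc 1 ⌊x⌋₊, e k - ∑' k, e k) := by
    rw [he, tsum_log_one_sub_sq]
    simp only [eulerSum, eulerWeight_one, eulerWeight_neg_one, eulerConst, Finset.sum_add_distrib]
    norm_num
    ring
  rw [h2, add_div]
  exact (abs_add_le _ _).trans (add_le_add (h x hx) h1)

/-- Mertens' third theorem with error term `(log x)⁻²`, for both signs. -/
theorem exists_eulerSum_sub_le {ε : ℝ} (hε : ε = 1 ∨ ε = -1) :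
    ∃ C : ℝ, 0 ≤ C ∧ ∀ x : ℝ, Real.exp 1 ≤ x →
      |eulerSum ε x - Real.log (Real.log x) - eulerConst ε| ≤ C / Real.log x ^ 2 := by
  rcases hε with rfl | rfl
  · exact exists_eulerSum_one_sub_le
  · exact exists_eulerSum_neg_one_sub_le

end Mertens

/-! ### Fourier analysis on the circle and the Bessel function as a moment generating function. -/

namespace RandomEuler
open scoped ComplexConjugate

lemma integral_unifCircle {E : Type*} [NormedAddCommGroup E] [NormedSpace ℝ E] {f : ℂ → E} (hf : Continuous f) :
    ∫ x, f x ∂unifCircle = (2 * Real.pi)⁻¹ • ∫ θ in (0 : ℝ)..(2 * Real.pi), f (Complex.exp (θ * Complex.I)) := by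
  have h2 : (0 : ℝ) ≤ 2 * Real.pi := by positivity
  have hm : Measurable fun θ : ℝ => Complex.exp (θ * Complex.I) := by fun_prop
  by_cases hE : CompleteSpace E
  · rw [unifCircle, integral_map hm.aemeasurable, ProbabilityTheory.cond, integral_smul_measure,
      intervalIntegral.integral_of_le h2]
    · congr 1
      rw [Real.volume_Ioc, sub_zero, ENNReal.toReal_inv, ENNReal.toReal_ofReal h2]
    · exact hf.stronglyMeasurable.aestronglyMeasurable
  -- Without completeness both integrals take the default value zero.
  · simp [intervalIntegral, integral, hE]

instance : IsProbabilityMeasure (ProbabilityTheory.cond volume (Set.Ioc (0 : ℝ) (2 * Real.pi))) :=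
  cond_isProbabilityMeasure_of_finite (by simp [Real.pi_pos]) (by rw [Real.volume_Ioc]; exact ENNReal.ofReal_ne_top)

instance : IsProbabilityMeasure unifCircle :=
  Measure.isProbabilityMeasure_map (by fun_prop)

lemma ae_norm_eq_one : ∀ᵐ x ∂unifCircle, ‖x‖ = 1 := by
  rw [unifCircle, ae_map_iff (by fun_prop) (measurableSet_eq_fun (by fun_prop) (by fun_prop))]
  exact ae_of_all _ fun θ => Complex.norm_exp_ofReal_mul_I θ

lemma integral_pow_mul_conj_pow (n m : ℕ) :
    ∫ x, x ^ n * conj x ^ m ∂unifCircle = if n = m then 1 else 0 := by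
  rw [integral_unifCircle (by fun_prop)]
  have h1 : ∀ θ : ℝ, Complex.exp (θ * Complex.I) ^ n * conj (Complex.exp (θ * Complex.I)) ^ m =
      Complex.exp ((((n : ℂ) - m) * Complex.I) * θ) := by
    intro θ
    rw [← Complex.exp_conj, ← Complex.exp_nat_mul, ← Complex.exp_nat_mul, ← Complex.exp_add]
    congr 1
    simp
    ring
  simp_rw [h1]
  split_ifs with h
  · subst h
    have : (Real.pi : ℂ) ≠ 0 := by exact_mod_cast Real.pi_pos.ne'
    simp
    field_simp
  · have hne : ((n : ℂ) - m) * Complex.I ≠ 0 :=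
      mul_ne_zero (sub_ne_zero.2 (by exact_mod_cast h)) Complex.I_ne_zero
    rw [integral_exp_mul_complex hne]
    have : Complex.exp (((n : ℂ) - m) * Complex.I * ((2 * Real.pi : ℝ) : ℂ)) = 1 := by
      rw [Complex.exp_eq_one_iff]
      exact ⟨n - m, by push_cast; ring⟩
    rw [this]
    simp

/-- Parseval's identity on the unit circle. -/
lemma integral_tsum_mul_tsum_conj {a b : ℕ → ℂ} (ha : Summable fun n => ‖a n‖) (hb : Summable fun n => ‖b n‖) :
    ∫ x, (∑' n, a n * x ^ n) * (∑' n, b n * conj x ^ n) ∂unifCircle = ∑' n, a n * b n := by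
  have hint : ∀ p : ℕ × ℕ, Integrable (fun x : ℂ => (a p.1 * x ^ p.1) * (b p.2 * conj x ^ p.2)) unifCircle := by
    intro p
    refine Integrable.of_bound (C := ‖a p.1‖ * ‖b p.2‖) (by fun_prop) ?_
    filter_upwards [ae_norm_eq_one] with x hx
    simp [hx]
  have hnorm : ∀ p : ℕ × ℕ, ∫ x, ‖(a p.1 * x ^ p.1) * (b p.2 * conj x ^ p.2)‖ ∂unifCircle = ‖a p.1‖ * ‖b p.2‖ := by
    intro p
    have : (fun x : ℂ => ‖(a p.1 * x ^ p.1) * (b p.2 * conj x ^ p.2)‖) =ᵐ[unifCircle] fun _ => ‖a p.1‖ * ‖b p.2‖ := by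
      filter_upwards [ae_norm_eq_one] with x hx
      simp [hx]
    rw [integral_congr_ae this]
    simp
  have hab := ha.mul_of_nonneg hb (fun n => norm_nonneg _) (fun n => norm_nonneg _)
  have h1 := hasSum_integral_of_summable_integral_norm hint (by simp_rw [hnorm]; exact hab)
  have h2 : ∀ᵐ x ∂unifCircle, (∑' n, a n * x ^ n) * (∑' n, b n * conj x ^ n) =
      ∑' p : ℕ × ℕ, (a p.1 * x ^ p.1) * (b p.2 * conj x ^ p.2) := by
    filter_upwards [ae_norm_eq_one] with x hx
    refine tsum_mul_tsum_of_summable_norm (ha.congr fun n => ?_) (hb.congr fun n => ?_) <;> simp [hx]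
  rw [integral_congr_ae h2, ← h1.tsum_eq]
  have h3 : ∀ p : ℕ × ℕ, ∫ x, (a p.1 * x ^ p.1) * (b p.2 * conj x ^ p.2) ∂unifCircle =
      if p.1 = p.2 then a p.1 * b p.2 else 0 := by
    intro p
    have : ∀ x : ℂ, (a p.1 * x ^ p.1) * (b p.2 * conj x ^ p.2) = (a p.1 * b p.2) * (x ^ p.1 * conj x ^ p.2) :=
      fun x => by ring
    simp_rw [this]
    rw [integral_const_mul, integral_pow_mul_conj_pow]
    split_ifs <;> simp
  simp_rw [h3]
  have h4 : Function.Injective fun n : ℕ => (n, n) := fun _ _ h => (Prod.mk.inj h).1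
  rw [← h4.tsum_eq]
  · simp
  · intro p hp
    refine ⟨p.1, ?_⟩
    by_contra h
    apply hp
    refine if_neg fun h' => h ?_
    ext <;> simp [h']

/-- Parseval applied to e^{tx/2} = ∑ (t/2)^n x^n/n!, because e^{tx/2} e^{t x̄/2} = e^{t Re x}. -/
lemma besselI0_eq_mgf (t : ℝ) : besselI0 t = mgf Complex.re unifCircle t := by
  have hs : Summable fun n : ℕ => ‖((t / 2 : ℝ) : ℂ) ^ n / (n.factorial : ℂ)‖ := by
    simpa [norm_div, norm_pow] using Real.summable_pow_div_factorial (|t| / 2)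
  have h := integral_tsum_mul_tsum_conj hs hs
  have he : ∀ z : ℂ, ∑' n : ℕ, ((t / 2 : ℝ) : ℂ) ^ n / (n.factorial : ℂ) * z ^ n = Complex.exp ((t / 2 : ℝ) * z) := by
    intro z
    rw [Complex.exp_eq_exp_ℂ, NormedSpace.exp_eq_tsum_div]
    exact tsum_congr fun n => by rw [mul_pow]; ring
  simp_rw [he] at h
  have h1 : ∀ x : ℂ, Complex.exp ((t / 2 : ℝ) * x) * Complex.exp ((t / 2 : ℝ) * conj x) =
      ((Real.exp (t * x.re) : ℝ) : ℂ) := by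
    intro x
    rw [← Complex.exp_add, ← mul_add, Complex.add_conj, Complex.ofReal_exp]
    congr 1
    push_cast
    ring
  simp_rw [h1] at h
  rw [integral_complex_ofReal] at h
  have h2 : ∑' n : ℕ, ((t / 2 : ℝ) : ℂ) ^ n / (n.factorial : ℂ) * (((t / 2 : ℝ) : ℂ) ^ n / (n.factorial : ℂ)) =
      ((besselI0 t : ℝ) : ℂ) := by
    rw [besselI0, Complex.ofReal_tsum]
    refine tsum_congr fun n => ?_
    push_cast
    ring
  rw [h2] at h
  exact_mod_cast h.symm

end RandomEuler

/-! ### Analysis of log I₀(t) and of log I₀(t)/t. -/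

namespace RandomEuler
open scoped ComplexConjugate

lemma abs_re_le_one_ae : ∀ᵐ x ∂unifCircle, |x.re| ≤ 1 := by
  filter_upwards [ae_norm_eq_one] with x hx using (Complex.abs_re_le_norm x).trans hx.le

lemma integrable_exp_mul_re (t : ℝ) : Integrable (fun x : ℂ => Real.exp (t * x.re)) unifCircle := by
  refine Integrable.of_bound (C := Real.exp |t|) (by fun_prop) ?_
  filter_upwards [abs_re_le_one_ae] with x hx
  rw [Real.norm_eq_abs, Real.abs_exp, Real.exp_le_exp]
  refine (le_abs_self _).trans ?_
  rw [abs_mul]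
  exact mul_le_of_le_one_right (abs_nonneg _) hx

lemma mem_interior_integrableExpSet (t : ℝ) : t ∈ interior (integrableExpSet Complex.re unifCircle) := by
  have : integrableExpSet Complex.re unifCircle = Set.univ := Set.eq_univ_of_forall integrable_exp_mul_re
  rw [this, interior_univ]
  trivial

lemma integral_re_unifCircle : ∫ x, x.re ∂unifCircle = 0 := by
  have h := integral_pow_mul_conj_pow 1 0
  simp only [pow_one, pow_zero, mul_one, one_ne_zero, if_false] at h
  have hi : Integrable (fun x : ℂ => x) unifCircle := by
    refine Integrable.of_bound (C := 1) (by fun_prop) ?_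
    filter_upwards [ae_norm_eq_one] with x hx using hx.le
  have h2 := integral_re hi
  rw [h] at h2
  simpa using h2

/-- `log I₀`. -/
noncomputable def besselLog (t : ℝ) : ℝ := Real.log (besselI0 t)

lemma besselLog_eq_cgf : besselLog = cgf Complex.re unifCircle := by
  ext t
  rw [besselLog, besselI0_eq_mgf, cgf]

lemma besselI0_pos (t : ℝ) : 0 < besselI0 t := by
  rw [besselI0_eq_mgf]
  exact mgf_pos (integrable_exp_mul_re t)

lemma besselLog_zero : besselLog 0 = 0 := by
  rw [besselLog_eq_cgf, cgf_zero]

lemma analyticAt_besselLog (t : ℝ) : AnalyticAt ℝ besselLog t := by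
  rw [besselLog_eq_cgf]
  exact analyticAt_cgf (mem_interior_integrableExpSet t)

lemma differentiable_besselLog : Differentiable ℝ besselLog := fun t => (analyticAt_besselLog t).differentiableAt

lemma continuous_besselLog : Continuous besselLog := differentiable_besselLog.continuous

lemma differentiable_deriv_besselLog : Differentiable ℝ (deriv besselLog) :=
  fun t => (analyticAt_besselLog t).deriv.differentiableAt

lemma deriv_besselLog_zero : deriv besselLog 0 = 0 := by
  rw [besselLog_eq_cgf, deriv_cgf_zero (mem_interior_integrableExpSet 0), integral_re_unifCircle, zero_div]

lemma deriv_deriv_besselLog_nonneg (t : ℝ) : 0 ≤ deriv (deriv besselLog) t := by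
  have h := iteratedDeriv_two_cgf_eq_integral (mem_interior_integrableExpSet t)
  rw [iteratedDeriv_succ, iteratedDeriv_one, ← besselLog_eq_cgf] at h
  rw [h]
  refine div_nonneg (integral_nonneg fun x => by positivity) mgf_nonneg

/-- The second derivative of the cumulant generating function is a variance under the tilted law,
hence at most the second moment, and |Re x| ≤ 1. -/
lemma deriv_deriv_besselLog_le (t : ℝ) : deriv (deriv besselLog) t ≤ 1 := by
  have h := iteratedDeriv_two_cgf (mem_interior_integrableExpSet t)
  rw [iteratedDeriv_succ, iteratedDeriv_one, ← besselLog_eq_cgf] at h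
  rw [h]
  have h1 : (∫ x, x.re ^ 2 * Real.exp (t * x.re) ∂unifCircle) / mgf Complex.re unifCircle t ≤ 1 := by
    rw [div_le_one (mgf_pos (integrable_exp_mul_re t)), mgf]
    refine integral_mono_of_nonneg (ae_of_all _ fun x => by positivity) (integrable_exp_mul_re t) ?_
    filter_upwards [abs_re_le_one_ae] with x hx
    exact mul_le_of_le_one_left (Real.exp_pos _).le ((sq_le_one_iff_abs_le_one _).2 hx)
  linarith [sq_nonneg (deriv besselLog t)]

lemma deriv_besselLog_le_one (t : ℝ) : deriv besselLog t ≤ 1 := by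
  rw [besselLog_eq_cgf, deriv_cgf (mem_interior_integrableExpSet t), div_le_one (mgf_pos (integrable_exp_mul_re t)), mgf]
  have hi : Integrable (fun x : ℂ => x.re * Real.exp (t * x.re)) unifCircle := by
    simpa using integrable_pow_mul_exp_of_mem_interior_integrableExpSet (mem_interior_integrableExpSet t) 1
  refine integral_mono_ae hi (integrable_exp_mul_re t) ?_
  filter_upwards [abs_re_le_one_ae] with x hx
  exact mul_le_of_le_one_left (Real.exp_pos _).le ((le_abs_self _).trans hx)

lemma deriv_besselLog_nonneg {t : ℝ} (ht : 0 ≤ t) : 0 ≤ deriv besselLog t := by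
  rw [← deriv_besselLog_zero]
  exact monotone_of_deriv_nonneg differentiable_deriv_besselLog deriv_deriv_besselLog_nonneg ht

lemma besselLog_nonneg {t : ℝ} (ht : 0 ≤ t) : 0 ≤ besselLog t := by
  rw [← besselLog_zero]
  refine monotoneOn_of_deriv_nonneg (convex_Ici 0) continuous_besselLog.continuousOn
    differentiable_besselLog.differentiableOn (fun x hx => ?_) Set.self_mem_Ici ht ht
  rw [interior_Ici] at hx
  exact deriv_besselLog_nonneg (le_of_lt hx)

lemma besselLog_le {t : ℝ} (ht : 0 ≤ t) : besselLog t ≤ t := by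
  have : MonotoneOn (fun t => t - besselLog t) (Set.Ici 0) := by
    refine monotoneOn_of_deriv_nonneg (convex_Ici 0) (continuous_id.sub continuous_besselLog).continuousOn
      (differentiable_id.sub differentiable_besselLog).differentiableOn (fun x _ => ?_)
    rw [deriv_fun_sub differentiableAt_fun_id (differentiable_besselLog x)]
    simp [deriv_besselLog_le_one]
  have h := this Set.self_mem_Ici ht ht
  simp only [besselLog_zero, sub_zero] at h
  linarith

lemma hasDerivAt_mul_deriv_sub (t : ℝ) :
    HasDerivAt (fun t => t * deriv besselLog t - besselLog t) (t * deriv (deriv besselLog) t) t := by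
  have := ((hasDerivAt_id t).mul (differentiable_deriv_besselLog t).hasDerivAt).sub (differentiable_besselLog t).hasDerivAt
  refine this.congr_deriv ?_
  simp

lemma mul_deriv_sub_nonneg {t : ℝ} (ht : 0 ≤ t) : 0 ≤ t * deriv besselLog t - besselLog t := by
  have : MonotoneOn (fun t => t * deriv besselLog t - besselLog t) (Set.Ici 0) := by
    refine monotoneOn_of_deriv_nonneg (convex_Ici 0) (fun x _ => (hasDerivAt_mul_deriv_sub x).continuousAt.continuousWithinAt)
      (fun x _ => (hasDerivAt_mul_deriv_sub x).differentiableAt.differentiableWithinAt) (fun x hx => ?_)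
    rw [interior_Ici] at hx
    rw [(hasDerivAt_mul_deriv_sub x).deriv]
    exact mul_nonneg (le_of_lt hx) (deriv_deriv_besselLog_nonneg x)
  have h := this Set.self_mem_Ici ht ht
  simpa [besselLog_zero] using h

lemma mul_deriv_sub_le {t : ℝ} (ht : 0 ≤ t) : t * deriv besselLog t - besselLog t ≤ t ^ 2 / 2 := by
  have hd : ∀ t, HasDerivAt (fun t => t ^ 2 / 2 - (t * deriv besselLog t - besselLog t)) (t - t * deriv (deriv besselLog) t) t := by
    intro t
    refine (((hasDerivAt_pow 2 t).div_const 2).sub (hasDerivAt_mul_deriv_sub t)).congr_deriv ?_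
    norm_num
  have : MonotoneOn (fun t => t ^ 2 / 2 - (t * deriv besselLog t - besselLog t)) (Set.Ici 0) := by
    refine monotoneOn_of_deriv_nonneg (convex_Ici 0) (fun x _ => (hd x).continuousAt.continuousWithinAt)
      (fun x _ => (hd x).differentiableAt.differentiableWithinAt) (fun x hx => ?_)
    rw [interior_Ici] at hx
    rw [(hd x).deriv]
    have h0 : 0 < x := hx
    nlinarith [deriv_deriv_besselLog_le x]
  have h := this Set.self_mem_Ici ht ht
  simp only [besselLog_zero] at h
  norm_num at h
  linarith

/-- `I₀(t) ≥ e^{t - 3} / (1 + t)`. -/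
lemma sub_besselLog_le {t : ℝ} (ht : 0 ≤ t) : t - besselLog t ≤ Real.log (1 + t) + 3 := by
  -- On the arc 0 ≤ θ ≤ δ one has t(1 - cos θ) ≤ 1/2. The constant 3 is this 1/2 plus 5/2, which
  -- dominates log 2π.
  set δ : ℝ := 1 / (1 + t) with hδ
  have hδ0 : 0 < δ := by positivity
  have hδ1 : δ ≤ 1 := by rw [hδ, div_le_one (by positivity)]; linarith
  have hδt : t * δ ≤ 1 := by rw [hδ, mul_one_div, div_le_one (by positivity)]; linarith
  have hpi := Real.pi_gt_three
  have h1 : δ * Real.exp (t - 1 / 2) ≤ ∫ θ in (0 : ℝ)..(2 * Real.pi), Real.exp (t * Real.cos θ) := by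
    have hc : Continuous fun θ : ℝ => Real.exp (t * Real.cos θ) := by fun_prop
    calc δ * Real.exp (t - 1 / 2) = ∫ θ in (0 : ℝ)..δ, Real.exp (t - 1 / 2) := by simp
      _ ≤ ∫ θ in (0 : ℝ)..δ, Real.exp (t * Real.cos θ) := by
        refine intervalIntegral.integral_mono_on hδ0.le (by simp) (hc.intervalIntegrable _ _) fun θ hθ => ?_
        rw [Real.exp_le_exp]
        have h2 := Real.one_sub_sq_div_two_le_cos (x := θ)
        have h3 : θ ^ 2 ≤ δ ^ 2 := by have := hθ.1; have := hθ.2; gcongr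
        have h4 : t * δ ^ 2 ≤ 1 := by nlinarith
        nlinarith
      _ ≤ _ := by
        rw [← intervalIntegral.integral_add_adjacent_intervals (hc.intervalIntegrable 0 δ) (hc.intervalIntegrable δ (2 * Real.pi))]
        have : 0 ≤ ∫ θ in δ..(2 * Real.pi), Real.exp (t * Real.cos θ) :=
          intervalIntegral.integral_nonneg (by linarith) fun _ _ => (Real.exp_pos _).le
        linarith
  have h2 : besselI0 t = (2 * Real.pi)⁻¹ * ∫ θ in (0 : ℝ)..(2 * Real.pi), Real.exp (t * Real.cos θ) := by
    rw [besselI0_eq_mgf, mgf, integral_unifCircle (by fun_prop), smul_eq_mul]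
    simp only [Complex.exp_ofReal_mul_I_re]
  have h3 : Real.exp (t - Real.log (1 + t) - 3) ≤ besselI0 t := by
    rw [h2]
    have h4 : 2 * Real.pi ≤ Real.exp (5 / 2) := by
      have h5 : Real.exp (5 / 2) = Real.exp 1 * Real.exp 1 * Real.exp (1 / 2) := by
        rw [← Real.exp_add, ← Real.exp_add]; norm_num
      have h6 := Real.exp_one_gt_d9
      have h7 := Real.add_one_le_exp (1 / 2 : ℝ)
      have h8 := Real.pi_lt_d2
      rw [h5]
      nlinarith [mul_nonneg (sub_nonneg.2 h6.le) (sub_nonneg.2 h6.le)]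
    calc Real.exp (t - Real.log (1 + t) - 3) = (Real.exp (5 / 2))⁻¹ * (δ * Real.exp (t - 1 / 2)) := by
          rw [Real.exp_sub, Real.exp_sub, Real.exp_log (by positivity), Real.exp_sub, hδ,
            show (3 : ℝ) = 5 / 2 + 1 / 2 by norm_num, Real.exp_add]
          field_simp
      _ ≤ _ := by gcongr
  have h4 := Real.log_le_log (Real.exp_pos _) h3
  rw [Real.log_exp] at h4
  unfold besselLog
  linarith

/-- `log I₀(t) / t`. -/
noncomputable def besselSlope (t : ℝ) : ℝ := besselLog t / t

/-- The derivative of `log I₀(t) / t`. -/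
noncomputable def besselSlopeDeriv (t : ℝ) : ℝ := (t * deriv besselLog t - besselLog t) / t ^ 2

lemma hasDerivAt_besselSlope {t : ℝ} (ht : 0 < t) : HasDerivAt besselSlope (besselSlopeDeriv t) t := by
  refine ((differentiable_besselLog t).hasDerivAt.div (hasDerivAt_id t) ht.ne').congr_deriv ?_
  simp only [besselSlopeDeriv, id]
  ring

lemma besselSlope_nonneg {t : ℝ} (ht : 0 ≤ t) : 0 ≤ besselSlope t := div_nonneg (besselLog_nonneg ht) ht

lemma besselSlope_le_one {t : ℝ} (ht : 0 ≤ t) : besselSlope t ≤ 1 := div_le_one_of_le₀ (besselLog_le ht) ht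

lemma one_sub_besselSlope_le {t : ℝ} (ht : 0 < t) : 1 - besselSlope t ≤ (Real.log (1 + t) + 3) / t := by
  rw [le_div_iff₀ ht, besselSlope]
  have := sub_besselLog_le ht.le
  field_simp
  linarith

lemma besselSlopeDeriv_nonneg {t : ℝ} (ht : 0 ≤ t) : 0 ≤ besselSlopeDeriv t :=
  div_nonneg (mul_deriv_sub_nonneg ht) (by positivity)

lemma besselSlopeDeriv_le_half {t : ℝ} (ht : 0 ≤ t) : besselSlopeDeriv t ≤ 1 / 2 := by
  refine div_le_of_le_mul₀ (by positivity) (by norm_num) ?_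
  linarith [mul_deriv_sub_le ht]

lemma log_one_add_le_sqrt {t : ℝ} (ht : 0 ≤ t) : Real.log (1 + t) ≤ 2 * √t := by
  have h1 := Real.log_le_sub_one_of_pos (x := √(1 + t)) (by positivity)
  rw [Real.log_sqrt (by positivity)] at h1
  have h2 : √(1 + t) ≤ 1 + √t := by
    rw [Real.sqrt_le_left (by positivity)]
    nlinarith [Real.sq_sqrt ht, Real.sqrt_nonneg t]
  linarith

/-- As (log I₀)' ≤ 1, the numerator is at most t - log I₀(t) ≤ log(1+t) + 3 ≤ 5√t. -/
lemma besselSlopeDeriv_le {t : ℝ} (ht : 1 ≤ t) : besselSlopeDeriv t ≤ 5 * t ^ (-(3 / 2) : ℝ) := by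
  have h0 : 0 < t := by linarith
  have h1 := sub_besselLog_le h0.le
  have h2 := log_one_add_le_sqrt h0.le
  have h3 := deriv_besselLog_le_one t
  have h4 : 1 ≤ √t := Real.one_le_sqrt.2 ht
  have h5 : t ^ (-(3 / 2) : ℝ) = √t / t ^ 2 := by
    rw [Real.sqrt_eq_rpow, ← Real.rpow_natCast, ← Real.rpow_sub h0]
    norm_num
  rw [h5, besselSlopeDeriv, ← mul_div_assoc]
  gcongr
  nlinarith

lemma measurable_besselSlopeDeriv : Measurable besselSlopeDeriv := by
  have h1 := continuous_besselLog.measurable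
  have h2 := differentiable_deriv_besselLog.continuous.measurable
  unfold besselSlopeDeriv
  fun_prop

lemma tendsto_besselSlope_zero : Tendsto besselSlope (𝓝[>] 0) (𝓝 0) := by
  have h := hasDerivAt_iff_tendsto_slope.1 (differentiable_besselLog 0).hasDerivAt
  rw [deriv_besselLog_zero] at h
  refine (h.mono_left (nhdsWithin_mono 0 fun x hx => (ne_of_gt hx : x ≠ 0))).congr fun x => ?_
  rw [slope_def_field, besselLog_zero, sub_zero, sub_zero, besselSlope]

lemma tendsto_besselSlope_atTop : Tendsto besselSlope atTop (𝓝 1) := by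
  have h : Tendsto (fun t : ℝ => 5 * (t ^ (-(1 / 2) : ℝ))) atTop (𝓝 0) := by
    simpa using (tendsto_rpow_neg_atTop (y := 1 / 2) (by norm_num)).const_mul 5
  have h2 : Tendsto (fun t => 1 - besselSlope t) atTop (𝓝 0) := by
    refine squeeze_zero' ?_ ?_ h
    · filter_upwards [eventually_ge_atTop 0] with t ht using sub_nonneg.2 (besselSlope_le_one ht)
    · filter_upwards [eventually_ge_atTop 1] with t ht
      have h0 : 0 < t := by linarith
      refine (one_sub_besselSlope_le h0).trans ?_
      have h5 : t ^ (-(1 / 2) : ℝ) = √t / t := by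
        rw [Real.sqrt_eq_rpow]
        nth_rw 3 [← Real.rpow_one t]
        rw [← Real.rpow_sub h0]
        norm_num
      rw [h5, ← mul_div_assoc]
      gcongr
      linarith [log_one_add_le_sqrt h0.le, Real.one_le_sqrt.2 ht]
  simpa using (tendsto_const_nhds (x := (1 : ℝ))).sub h2

end RandomEuler

/-! ### The density (log I₀(t)/t)' and its logarithmic moment. -/

namespace RandomEuler

lemma one_sub_besselSlope_le_rpow {t : ℝ} (ht : 1 ≤ t) : 1 - besselSlope t ≤ 5 * t ^ (-(1 / 2) : ℝ) := by
  have h0 : 0 < t := by linarith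
  refine (one_sub_besselSlope_le h0).trans ?_
  have h5 : t ^ (-(1 / 2) : ℝ) = √t / t := by
    rw [Real.sqrt_eq_rpow]
    nth_rw 3 [← Real.rpow_one t]
    rw [← Real.rpow_sub h0]
    norm_num
  rw [h5, ← mul_div_assoc]
  gcongr
  linarith [log_one_add_le_sqrt h0.le, Real.one_le_sqrt.2 ht]

lemma abs_log_le_rpow_neg {t a : ℝ} (ht : 0 < t) (ht1 : t ≤ 1) (ha : 0 < a) : |Real.log t| ≤ t ^ (-a) / a := by
  rw [abs_of_nonpos (Real.log_nonpos ht.le ht1), ← Real.log_inv]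
  refine (Real.log_le_rpow_div (by positivity) ha).trans_eq ?_
  rw [Real.inv_rpow ht.le, Real.rpow_neg ht.le]

/-- The density is bounded near 0 and O(t^{-3/2}) at infinity. The cubed logarithm is the weight
that appears in the error of `exists_eulerSum_div_sub_le`. The constants are 343 = 7³ and 10985 =
5·13³, from 1 + |log t| ≤ 7t^{-1/6} below 1 and 1 + log t ≤ 13t^{1/12} above. -/
lemma integrableOn_besselSlopeDeriv_mul_log_cube :
    IntegrableOn (fun t => besselSlopeDeriv t * (1 + |Real.log t|) ^ 3) (Set.Ioi 0) := by
  have hm : Measurable fun t => besselSlopeDeriv t * (1 + |Real.log t|) ^ 3 := by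
    have := measurable_besselSlopeDeriv
    fun_prop
  rw [← Set.Ioc_union_Ioi_eq_Ioi zero_le_one]
  refine IntegrableOn.union ?_ ?_
  · have h1 : IntegrableOn (fun t : ℝ => 343 * t ^ (-(1 / 2) : ℝ)) (Set.Ioc 0 1) := by
      rw [← intervalIntegrable_iff_integrableOn_Ioc_of_le zero_le_one]
      exact (intervalIntegral.intervalIntegrable_rpow' (by norm_num)).const_mul _
    refine Integrable.mono' h1 hm.aestronglyMeasurable ?_
    refine (ae_restrict_iff' measurableSet_Ioc).2 (ae_of_all _ fun t ht => ?_)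
    have h0 : 0 < t := ht.1
    have h2 := besselSlopeDeriv_nonneg h0.le
    have h3 := besselSlopeDeriv_le_half h0.le
    have h4 := abs_log_le_rpow_neg h0 ht.2 (a := 1 / 6) (by norm_num)
    have h5 : 1 ≤ t ^ (-(1 / 6) : ℝ) := Real.one_le_rpow_of_pos_of_le_one_of_nonpos h0 ht.2 (by norm_num)
    rw [Real.norm_eq_abs, abs_of_nonneg (by positivity)]
    calc besselSlopeDeriv t * (1 + |Real.log t|) ^ 3 ≤ 1 * (7 * t ^ (-(1 / 6) : ℝ)) ^ 3 := by
          gcongr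
          · linarith
          · linarith
      _ = 343 * (t ^ (-(1 / 6) : ℝ)) ^ 3 := by ring
      _ = _ := by
        rw [← Real.rpow_natCast, ← Real.rpow_mul h0.le]; norm_num
  · have h1 : IntegrableOn (fun t : ℝ => 10985 * t ^ (-(5 / 4) : ℝ)) (Set.Ioi 1) :=
      (integrableOn_Ioi_rpow_of_lt (by norm_num) one_pos).const_mul _
    refine Integrable.mono' h1 hm.aestronglyMeasurable ?_
    refine (ae_restrict_iff' measurableSet_Ioi).2 (ae_of_all _ fun t ht => ?_)
    have ht1 : 1 < t := ht
    have h0 : 0 < t := by linarith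
    have h2 := besselSlopeDeriv_nonneg h0.le
    have h3 := besselSlopeDeriv_le ht1.le
    have h4 := Real.log_le_rpow_div (x := t) h0.le (ε := 1 / 12) (by norm_num)
    have h5 : 1 ≤ t ^ (1 / 12 : ℝ) := Real.one_le_rpow ht1.le (by norm_num)
    rw [Real.norm_eq_abs, abs_of_nonneg (by positivity), abs_of_nonneg (Real.log_nonneg ht1.le)]
    have h6 := Real.log_nonneg ht1.le
    calc besselSlopeDeriv t * (1 + Real.log t) ^ 3 ≤ (5 * t ^ (-(3 / 2) : ℝ)) * (13 * t ^ (1 / 12 : ℝ)) ^ 3 := by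
          gcongr
          linarith
      _ = 10985 * (t ^ (-(3 / 2) : ℝ) * (t ^ (1 / 12 : ℝ)) ^ 3) := by ring
      _ = _ := by
        rw [← Real.rpow_natCast, ← Real.rpow_mul h0.le, ← Real.rpow_add h0]; norm_num

lemma integrableOn_besselSlopeDeriv_mul {f : ℝ → ℝ} (hf : Measurable f) {C : ℝ}
    (h : ∀ t, 0 < t → |f t| ≤ C * (1 + |Real.log t|) ^ 3) :
    IntegrableOn (fun t => besselSlopeDeriv t * f t) (Set.Ioi 0) := by
  refine Integrable.mono' (integrableOn_besselSlopeDeriv_mul_log_cube.const_mul C)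
    (measurable_besselSlopeDeriv.mul hf).aestronglyMeasurable ?_
  refine (ae_restrict_iff' measurableSet_Ioi).2 (ae_of_all _ fun t ht => ?_)
  have h2 := besselSlopeDeriv_nonneg (le_of_lt ht)
  rw [norm_mul, Real.norm_eq_abs, Real.norm_eq_abs, abs_of_nonneg h2]
  calc _ ≤ besselSlopeDeriv t * (C * (1 + |Real.log t|) ^ 3) := by gcongr; exact h t ht
    _ = _ := by ring

lemma one_le_log_cube (t : ℝ) : 1 ≤ (1 + |Real.log t|) ^ 3 :=
  one_le_pow₀ (by linarith [abs_nonneg (Real.log t)])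

lemma abs_log_le_log_cube (t : ℝ) : |Real.log t| ≤ (1 + |Real.log t|) ^ 3 := by
  have h := abs_nonneg (Real.log t)
  have := le_self_pow₀ (a := 1 + |Real.log t|) (by linarith) (n := 3) (by norm_num)
  linarith

lemma integrableOn_besselSlopeDeriv : IntegrableOn besselSlopeDeriv (Set.Ioi 0) := by
  simpa using integrableOn_besselSlopeDeriv_mul (f := fun _ => 1) measurable_const (C := 1)
    (fun t _ => by simpa using one_le_log_cube t)

lemma integrableOn_besselSlopeDeriv_mul_log :
    IntegrableOn (fun t => besselSlopeDeriv t * Real.log t) (Set.Ioi 0) :=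
  integrableOn_besselSlopeDeriv_mul (f := Real.log) Real.measurable_log (C := 1)
    (fun t _ => by simpa using abs_log_le_log_cube t)

lemma continuousWithinAt_besselSlope_zero : ContinuousWithinAt besselSlope (Set.Ici 0) 0 := by
  have h : ContinuousWithinAt besselSlope (Set.Ioi 0) 0 := by
    have : besselSlope 0 = 0 := by simp [besselSlope]
    rw [ContinuousWithinAt, this]
    exact tendsto_besselSlope_zero
  exact continuousWithinAt_Ioi_iff_Ici.1 h

/-- The slope runs from 0 at the origin to 1 at infinity, so its non-negative derivative is a
probability density on (0,∞). -/
lemma integral_besselSlopeDeriv : ∫ t in Set.Ioi 0, besselSlopeDeriv t = 1 := by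
  have h := integral_Ioi_of_hasDerivAt_of_tendsto continuousWithinAt_besselSlope_zero
    (fun t ht => hasDerivAt_besselSlope ht) integrableOn_besselSlopeDeriv tendsto_besselSlope_atTop
  rw [h]
  simp [besselSlope]

lemma integral_Ioc_besselSlopeDeriv {x : ℝ} (hx : 0 < x) :
    ∫ t in Set.Ioc 0 x, besselSlopeDeriv t = besselSlope x := by
  rw [← intervalIntegral.integral_of_le hx.le]
  rw [intervalIntegral.integral_eq_sub_of_hasDerivAt_of_tendsto hx (fun t ht => hasDerivAt_besselSlope ht.1) ?_
    tendsto_besselSlope_zero ((hasDerivAt_besselSlope hx).continuousAt.tendsto.mono_left nhdsWithin_le_nhds), sub_zero]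
  rw [intervalIntegrable_iff_integrableOn_Ioc_of_le hx.le]
  exact integrableOn_besselSlopeDeriv.mono_set Set.Ioc_subset_Ioi_self

lemma besselSlope_le_half {x : ℝ} (hx : 0 < x) : besselSlope x ≤ x / 2 := by
  rw [← integral_Ioc_besselSlopeDeriv hx]
  calc ∫ t in Set.Ioc 0 x, besselSlopeDeriv t ≤ ∫ t in Set.Ioc 0 x, (1 / 2 : ℝ) := by
        refine setIntegral_mono_on (integrableOn_besselSlopeDeriv.mono_set Set.Ioc_subset_Ioi_self)
          (by simp) measurableSet_Ioc fun t ht => besselSlopeDeriv_le_half ht.1.le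
    _ = x / 2 := by simp [hx.le]; ring

lemma hasDerivAt_log_div_two {t : ℝ} (ht : 0 < t) : HasDerivAt (fun t : ℝ => Real.log (t / 2)) t⁻¹ t := by
  refine (((hasDerivAt_id t).div_const 2).log (by simp; exact ht.ne')).congr_deriv ?_
  simp only [id]
  field_simp

lemma integrableOn_besselSlopeDeriv_mul_log_div_two :
    IntegrableOn (fun t => besselSlopeDeriv t * Real.log (t / 2)) (Set.Ioi 0) := by
  refine integrableOn_besselSlopeDeriv_mul (f := fun t => Real.log (t / 2)) (by fun_prop) (C := 2) fun t ht => ?_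
  rw [Real.log_div ht.ne' two_ne_zero]
  have h1 := abs_log_le_log_cube t
  have h2 := one_le_log_cube t
  have h3 := Real.log_two_lt_d9
  have h4 := Real.log_two_gt_d9
  have h5 := abs_sub (Real.log t) (Real.log 2)
  rw [abs_of_nonneg (show 0 ≤ Real.log 2 by linarith)] at h5
  linarith

/-- Integration by parts with the primitive log(t/2) of 1/t. It vanishes at t = 2, so splitting
`constC` there creates no boundary term. On (2,∞) the same is done with the slope minus 1, which
decays. -/
lemma integral_besselLog_div_sq :
    ∫ t in Set.Ioc (0 : ℝ) 2, Real.log (besselI0 t) / t ^ 2 =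
      -∫ t in Set.Ioc (0 : ℝ) 2, besselSlopeDeriv t * Real.log (t / 2) := by
  have hi1 : IntervalIntegrable (fun t => besselSlopeDeriv t * Real.log (t / 2)) volume 0 2 := by
    rw [intervalIntegrable_iff_integrableOn_Ioc_of_le (by norm_num)]
    exact integrableOn_besselSlopeDeriv_mul_log_div_two.mono_set Set.Ioc_subset_Ioi_self
  have hi2 : IntervalIntegrable (fun t => Real.log (besselI0 t) / t ^ 2) volume 0 2 := by
    rw [intervalIntegrable_iff_integrableOn_Ioc_of_le (by norm_num)]
    refine Integrable.of_bound (C := 1 / 2) ?_ ?_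
    · have := continuous_besselLog.measurable
      exact Measurable.aestronglyMeasurable (this.div (by fun_prop))
    · refine (ae_restrict_iff' measurableSet_Ioc).2 (ae_of_all _ fun t ht => ?_)
      have h1 := besselSlope_le_half ht.1
      have h2 := besselSlope_nonneg ht.1.le
      have h3 : Real.log (besselI0 t) / t ^ 2 = besselSlope t / t := by
        rw [besselSlope, besselLog, div_div, sq]
      have ht0 := ht.1
      rw [h3, Real.norm_eq_abs, abs_of_nonneg (by positivity), div_le_iff₀ ht0]
      linarith
  have h := intervalIntegral.integral_eq_sub_of_hasDerivAt_of_tendsto (a := 0) (b := 2) (f := fun t => besselSlope t * Real.log (t / 2))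
    (f' := fun t => besselSlopeDeriv t * Real.log (t / 2) + Real.log (besselI0 t) / t ^ 2) (fa := 0) (fb := 0)
    (by norm_num) (fun t ht => ?_) (hi1.add hi2) ?_ ?_
  · rw [intervalIntegral.integral_add hi1 hi2, sub_zero] at h
    rw [← intervalIntegral.integral_of_le (by norm_num), ← intervalIntegral.integral_of_le (by norm_num)]
    linarith
  · refine ((hasDerivAt_besselSlope ht.1).mul (hasDerivAt_log_div_two ht.1)).congr_deriv ?_
    rw [besselSlope, besselLog, sq, ← div_div, div_eq_mul_inv (_ / t)]
  · have h1 : Tendsto (fun t : ℝ => |t / 2 * Real.log (t / 2)|) (𝓝[>] 0) (𝓝 0) := by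
      have : Continuous fun t : ℝ => |t / 2 * Real.log (t / 2)| :=
        (Real.continuous_mul_log.comp (by fun_prop : Continuous fun t : ℝ => t / 2)).abs
      have h2 := this.tendsto 0
      simp only [zero_div, zero_mul, abs_zero] at h2
      exact h2.mono_left nhdsWithin_le_nhds
    refine squeeze_zero_norm' ?_ h1
    filter_upwards [self_mem_nhdsWithin] with t ht
    have ht0 : 0 < t := ht
    rw [norm_mul, abs_mul, Real.norm_eq_abs, Real.norm_eq_abs, abs_of_nonneg (besselSlope_nonneg ht0.le),
      abs_of_pos (half_pos ht0)]
    gcongr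
    exact besselSlope_le_half ht0
  · have h1 := ((hasDerivAt_besselSlope two_pos).continuousAt.mul (hasDerivAt_log_div_two two_pos).continuousAt).tendsto
    rw [Pi.mul_apply, div_self (two_ne_zero (α := ℝ)), Real.log_one, mul_zero] at h1
    refine Tendsto.mono_left ?_ nhdsWithin_le_nhds
    exact h1

lemma integral_besselLog_sub_div_sq :
    ∫ t in Set.Ioi (2 : ℝ), (Real.log (besselI0 t) - t) / t ^ 2 =
      -∫ t in Set.Ioi (2 : ℝ), besselSlopeDeriv t * Real.log (t / 2) := by
  have hsub : Set.Ioi (2 : ℝ) ⊆ Set.Ioi 0 := Set.Ioi_subset_Ioi (by norm_num)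
  have hi1 : IntegrableOn (fun t => besselSlopeDeriv t * Real.log (t / 2)) (Set.Ioi 2) :=
    integrableOn_besselSlopeDeriv_mul_log_div_two.mono_set hsub
  have hi2 : IntegrableOn (fun t => (Real.log (besselI0 t) - t) / t ^ 2) (Set.Ioi 2) := by
    have h1 : IntegrableOn (fun t : ℝ => 5 * t ^ (-(3 / 2) : ℝ)) (Set.Ioi 2) :=
      (integrableOn_Ioi_rpow_of_lt (by norm_num) two_pos).const_mul _
    refine Integrable.mono' h1 ?_ ?_
    · have := continuous_besselLog.measurable
      exact Measurable.aestronglyMeasurable ((this.sub measurable_id).div (by fun_prop))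
    · refine (ae_restrict_iff' measurableSet_Ioi).2 (ae_of_all _ fun t ht => ?_)
      have ht2 : 2 < t := ht
      have ht0 : 0 < t := by linarith
      have h3 : (Real.log (besselI0 t) - t) / t ^ 2 = -((1 - besselSlope t) / t) := by
        rw [besselSlope, besselLog]
        field_simp
        ring
      have h4 := one_sub_besselSlope_le_rpow (t := t) (by linarith)
      have h5 := besselSlope_le_one ht0.le
      have h6 : 0 ≤ (1 - besselSlope t) / t := div_nonneg (by linarith) ht0.le
      rw [h3, norm_neg, Real.norm_eq_abs, abs_of_nonneg h6]
      calc (1 - besselSlope t) / t ≤ (5 * t ^ (-(1 / 2) : ℝ)) / t := by gcongr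
        _ = 5 * (t ^ (-(1 / 2) : ℝ) * t ^ (-1 : ℝ)) := by rw [Real.rpow_neg_one]; ring
        _ = _ := by rw [← Real.rpow_add ht0]; norm_num
  have hd : ∀ t : ℝ, 0 < t → HasDerivAt (fun t => (besselSlope t - 1) * Real.log (t / 2))
      (besselSlopeDeriv t * Real.log (t / 2) + (Real.log (besselI0 t) - t) / t ^ 2) t := by
    intro t ht
    refine (((hasDerivAt_besselSlope ht).sub_const 1).mul (hasDerivAt_log_div_two ht)).congr_deriv ?_
    simp only [besselSlope, besselLog]
    field_simp
  have h := integral_Ioi_of_hasDerivAt_of_tendsto (a := 2) (f := fun t => (besselSlope t - 1) * Real.log (t / 2))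
    (f' := fun t => besselSlopeDeriv t * Real.log (t / 2) + (Real.log (besselI0 t) - t) / t ^ 2) (m := 0)
    (hd 2 two_pos).continuousAt.continuousWithinAt (fun t ht => hd t (two_pos.trans ht)) (hi1.add hi2) ?_
  · rw [integral_add hi1 hi2] at h
    norm_num at h
    linarith
  · have h1 : Tendsto (fun t : ℝ => 20 * t ^ (-(1 / 4) : ℝ)) atTop (𝓝 0) := by
      simpa using (tendsto_rpow_neg_atTop (y := 1 / 4) (by norm_num)).const_mul 20
    refine squeeze_zero_norm' ?_ h1
    filter_upwards [eventually_ge_atTop 2] with t ht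
    have ht0 : 0 < t := by linarith
    have h4 := one_sub_besselSlope_le_rpow (t := t) (by linarith)
    have h5 := besselSlope_le_one ht0.le
    have h6 := Real.log_le_rpow_div (x := t / 2) (by positivity) (ε := 1 / 4) (by norm_num)
    have h7 : (t / 2) ^ (1 / 4 : ℝ) ≤ t ^ (1 / 4 : ℝ) := by gcongr; linarith
    have h8 : 0 ≤ Real.log (t / 2) := Real.log_nonneg (by linarith)
    rw [norm_mul, Real.norm_eq_abs, Real.norm_eq_abs, abs_of_nonneg h8, abs_of_nonpos (by linarith)]
    calc -(besselSlope t - 1) * Real.log (t / 2) ≤ (5 * t ^ (-(1 / 2) : ℝ)) * (4 * t ^ (1 / 4 : ℝ)) := by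
          gcongr
          · linarith
          · linarith
      _ = 20 * (t ^ (-(1 / 2) : ℝ) * t ^ (1 / 4 : ℝ)) := by ring
      _ = _ := by rw [← Real.rpow_add ht0]; norm_num

/-- The constant `C - log 2` as a single integral. -/
lemma integral_besselSlopeDeriv_mul_log :
    ∫ t in Set.Ioi 0, besselSlopeDeriv t * Real.log t = -(constC - Real.log 2) := by
  have h1 : constC = -∫ t in Set.Ioi (0 : ℝ), besselSlopeDeriv t * Real.log (t / 2) := by
    rw [constC, integral_besselLog_div_sq, integral_besselLog_sub_div_sq, ← neg_add,
      ← setIntegral_union (Set.Ioc_disjoint_Ioi le_rfl) measurableSet_Ioi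
        (integrableOn_besselSlopeDeriv_mul_log_div_two.mono_set Set.Ioc_subset_Ioi_self)
        (integrableOn_besselSlopeDeriv_mul_log_div_two.mono_set (Set.Ioi_subset_Ioi (by norm_num))),
      Set.Ioc_union_Ioi_eq_Ioi (by norm_num)]
  have h2 : ∫ t in Set.Ioi (0 : ℝ), besselSlopeDeriv t * Real.log (t / 2) =
      ∫ t in Set.Ioi (0 : ℝ), (besselSlopeDeriv t * Real.log t - besselSlopeDeriv t * Real.log 2) := by
    refine setIntegral_congr_fun measurableSet_Ioi fun t ht => ?_
    have ht0 : t ≠ 0 := (ne_of_gt ht : t ≠ 0)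
    rw [Real.log_div ht0 two_ne_zero]
    ring
  rw [h2, integral_sub integrableOn_besselSlopeDeriv_mul_log (integrableOn_besselSlopeDeriv.mul_const _),
    integral_mul_const, integral_besselSlopeDeriv] at h1
  linarith

end RandomEuler

/-! ### The main term: a sum over primes as an average of Mertens sums. -/

namespace RandomEuler
open Mertens

lemma abs_sign_eq_one {ε : ℝ} (hε : ε = 1 ∨ ε = -1) : |ε| = 1 := by
  rcases hε with rfl | rfl <;> simp

lemma abs_neg_sign_mul_log_sub_le {ε : ℝ} (hε : ε = 1 ∨ ε = -1) {x : ℝ} (hx : 0 ≤ x) (hx1 : x ≤ 1 / 2) :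
    |-ε * Real.log (1 - ε * x) - x| ≤ 2 * x ^ 2 := by
  have he := abs_sign_eq_one hε
  have h := Real.abs_log_sub_add_sum_range_le (x := ε * x) (by rw [abs_mul, he, abs_of_nonneg hx]; linarith) 1
  simp only [Finset.sum_range_one, zero_add, pow_one, Nat.cast_zero, div_one, Nat.reduceAdd] at h
  rw [abs_mul, he, one_mul, abs_of_nonneg hx] at h
  have h1 : -ε * Real.log (1 - ε * x) - x = -ε * (ε * x + Real.log (1 - ε * x)) := by
    rcases hε with rfl | rfl <;> ring
  rw [h1, abs_mul, abs_neg, he, one_mul]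
  refine h.trans ?_
  rw [div_le_iff₀ (by linarith)]
  nlinarith [sq_nonneg x, mul_nonneg (sq_nonneg x) (sub_nonneg.2 hx1)]

lemma one_div_prime_le_half {p : ℕ} (hp : p.Prime) : 1 / (p : ℝ) ≤ 1 / 2 := by
  have h2 : (2 : ℝ) ≤ p := by exact_mod_cast hp.two_le
  gcongr

lemma eulerWeight_of_prime (ε : ℝ) {p : ℕ} (hp : p.Prime) :
    eulerWeight ε p = -ε * Real.log (1 - ε * (1 / p)) := by
  rw [eulerWeight, if_pos hp, mul_one_div]

lemma abs_eulerWeight_sub_le {ε : ℝ} (hε : ε = 1 ∨ ε = -1) {p : ℕ} (hp : p.Prime) :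
    |eulerWeight ε p - 1 / p| ≤ 2 / (p : ℝ) ^ 2 := by
  rw [eulerWeight_of_prime ε hp]
  refine (abs_neg_sign_mul_log_sub_le hε (by positivity) (one_div_prime_le_half hp)).trans_eq ?_
  rw [one_div_pow]; ring

lemma eulerWeight_nonneg {ε : ℝ} (hε : ε = 1 ∨ ε = -1) (n : ℕ) : 0 ≤ eulerWeight ε n := by
  by_cases hp : n.Prime
  · rw [eulerWeight_of_prime ε hp]
    have h1 := one_div_prime_le_half hp
    have h0 : 0 ≤ 1 / (n : ℝ) := by positivity
    rcases hε with rfl | rfl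
    · have := Real.log_nonpos (x := 1 - 1 * (1 / (n : ℝ))) (by linarith) (by linarith)
      linarith
    · have := Real.log_nonneg (x := 1 - (-1) * (1 / (n : ℝ))) (by linarith)
      linarith
  · simp [eulerWeight, hp]

lemma eulerWeight_le {ε : ℝ} (hε : ε = 1 ∨ ε = -1) (n : ℕ) : eulerWeight ε n ≤ 2 / n := by
  by_cases hp : n.Prime
  · have h := (abs_le.1 (abs_eulerWeight_sub_le hε hp)).2
    have h1 := one_div_prime_le_half hp
    have h0 : 0 ≤ 1 / (n : ℝ) := by positivity
    have h2 : 2 / (n : ℝ) ^ 2 = 2 * (1 / n) * (1 / n) := by field_simp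
    have h3 : 2 / (n : ℝ) = 2 * (1 / n) := by ring
    rw [h2] at h
    rw [h3]
    nlinarith
  · simp only [eulerWeight, hp, if_false]
    positivity

lemma eulerSum_mono {ε : ℝ} (hε : ε = 1 ∨ ε = -1) : Monotone (eulerSum ε) := fun _ _ h =>
  Finset.sum_le_sum_of_subset_of_nonneg (Finset.Icc_subset_Icc_right (Nat.floor_mono h))
    fun _ _ _ => eulerWeight_nonneg hε _

lemma eulerSum_nonneg {ε : ℝ} (hε : ε = 1 ∨ ε = -1) (x : ℝ) : 0 ≤ eulerSum ε x :=
  Finset.sum_nonneg fun _ _ => eulerWeight_nonneg hε _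

lemma summable_eulerWeight_mul_besselSlope {ε : ℝ} (hε : ε = 1 ∨ ε = -1) {k : ℝ} (hk : 0 < k) :
    Summable fun n : ℕ => eulerWeight ε n * besselSlope (k / n) := by
  refine Summable.of_nonneg_of_le (fun n => mul_nonneg (eulerWeight_nonneg hε n) (besselSlope_nonneg (by positivity)))
    (fun n => ?_) ((Real.summable_one_div_nat_pow.2 (one_lt_two)).mul_left k)
  rcases Nat.eq_zero_or_pos n with rfl | hn
  · simp [eulerWeight]
  have hn0 : (0 : ℝ) < n := by exact_mod_cast hn
  calc eulerWeight ε n * besselSlope (k / n) ≤ 2 / n * (k / n / 2) := by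
        gcongr
        · exact besselSlope_nonneg (by positivity)
        · exact eulerWeight_le hε n
        · exact besselSlope_le_half (by positivity)
    _ = _ := by field_simp

/-- Write the slope at k/n as the integral of its derivative over (0, k/n] and interchange with the
sum, all terms being non-negative. The condition t ≤ k/n becomes n ≤ k/t. -/
lemma tsum_eulerWeight_mul_besselSlope {ε : ℝ} (hε : ε = 1 ∨ ε = -1) {k : ℝ} (hk : 0 < k) :
    ∑' n : ℕ, eulerWeight ε n * besselSlope (k / n) =
      ∫ t in Set.Ioi 0, besselSlopeDeriv t * eulerSum ε (k / t) := by
  set f : ℕ → ℝ → ℝ := fun n => (Set.Ioc 0 (k / n)).indicator fun t => eulerWeight ε n * besselSlopeDeriv t with hf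
  have hfi : ∀ n, Integrable (f n) (volume.restrict (Set.Ioi 0)) := fun n =>
    (integrableOn_besselSlopeDeriv.const_mul _).indicator measurableSet_Ioc
  have hfint : ∀ n, ∫ t in Set.Ioi 0, f n t = eulerWeight ε n * besselSlope (k / n) := by
    intro n
    rcases Nat.eq_zero_or_pos n with rfl | hn
    · simp [hf, eulerWeight]
    have hn0 : (0 : ℝ) < n := by exact_mod_cast hn
    rw [hf]
    simp only
    rw [setIntegral_indicator measurableSet_Ioc, Set.inter_eq_right.2 Set.Ioc_subset_Ioi_self, integral_const_mul,
      integral_Ioc_besselSlopeDeriv (by positivity)]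
  have hf0 : ∀ n t, 0 ≤ f n t := fun n t => Set.indicator_nonneg (fun t ht =>
    mul_nonneg (eulerWeight_nonneg hε n) (besselSlopeDeriv_nonneg ht.1.le)) t
  have h := hasSum_integral_of_summable_integral_norm hfi (by
    refine (summable_eulerWeight_mul_besselSlope hε hk).congr fun n => ?_
    rw [← hfint]
    exact integral_congr_ae (ae_of_all _ fun t => by simp only [Real.norm_eq_abs, abs_of_nonneg (hf0 n t)]))
  simp_rw [hfint] at h
  rw [h.tsum_eq]
  refine setIntegral_congr_fun measurableSet_Ioi fun t ht => ?_
  have ht0 : 0 < t := ht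
  rw [tsum_eq_sum (s := Finset.Icc 1 ⌊k / t⌋₊), eulerSum, Finset.mul_sum]
  · refine Finset.sum_congr rfl fun n hn => ?_
    have hn' := Finset.mem_Icc.1 hn
    have hn0 : (0 : ℝ) < n := by exact_mod_cast hn'.1
    have h1 := (Nat.le_floor_iff (by positivity)).1 hn'.2
    rw [hf]
    simp only
    rw [Set.indicator_of_mem, mul_comm]
    refine ⟨ht0, ?_⟩
    rw [le_div_iff₀ hn0]
    rw [le_div_iff₀ ht0] at h1
    linarith
  · intro n hn
    rcases Nat.eq_zero_or_pos n with rfl | hn1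
    · simp [hf, eulerWeight]
    have hn0 : (0 : ℝ) < n := by exact_mod_cast hn1
    refine Set.indicator_of_notMem (fun h1 => hn ?_) _
    rw [Finset.mem_Icc]
    refine ⟨hn1, (Nat.le_floor_iff (by positivity)).2 ?_⟩
    have h2 := h1.2
    rw [le_div_iff₀ hn0] at h2
    rw [le_div_iff₀ ht0]
    linarith

/-- When |log t| ≤ (log k)/2, apply Mertens at k/t and expand log(log k - log t) to first order.
When |log t| is larger, every quantity is O(|log t|) and log² k ≤ 4 log² t, so the cube of |log t|
covers the error. -/
lemma exists_eulerSum_div_sub_le {ε : ℝ} (hε : ε = 1 ∨ ε = -1) :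
    ∃ C : ℝ, 0 ≤ C ∧ ∀ k : ℝ, Real.exp 2 ≤ k → ∀ t : ℝ, 0 < t →
      |eulerSum ε (k / t) - (Real.log (Real.log k) + eulerConst ε - Real.log t / Real.log k)| ≤
        C / Real.log k ^ 2 * (1 + |Real.log t|) ^ 3 := by
  obtain ⟨C, hC, h⟩ := exists_eulerSum_sub_le hε
  set a := eulerConst ε with ha
  set E := eulerSum ε (Real.exp 1) with hE
  have hE0 : 0 ≤ E := eulerSum_nonneg hε _
  refine ⟨4 * C + 2 + 4 * (8 + 2 * |a| + C + E), by positivity, fun k hk t ht => ?_⟩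
  have hk0 : 0 < k := (Real.exp_pos 2).trans_le hk
  set l := Real.log k with hl
  have hl2 : 2 ≤ l := by rw [hl, Real.le_log_iff_exp_le hk0]; exact hk
  set u := Real.log t with hu
  have hlog : Real.log (k / t) = l - u := Real.log_div hk0.ne' ht.ne'
  have hu0 := abs_nonneg u
  have hcube : 1 ≤ (1 + |u|) ^ 3 := one_le_pow₀ (by linarith)
  rw [div_mul_eq_mul_div, le_div_iff₀ (by positivity)]
  rcases le_or_gt |u| (l / 2) with hul | hul
  · have h1 : l / 2 ≤ l - u := by linarith [le_abs_self u]
    have hx : Real.exp 1 ≤ k / t := by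
      rw [← Real.le_log_iff_exp_le (by positivity), hlog]; linarith
    have h2 := h (k / t) hx
    rw [hlog] at h2
    have hy : |u / l| ≤ 1 / 2 := by
      rw [abs_div, abs_of_pos (by linarith : 0 < l), div_le_iff₀ (by linarith)]; linarith
    have h3 := Real.abs_log_sub_add_sum_range_le (x := u / l) (by linarith) 1
    simp only [Finset.sum_range_one, zero_add, pow_one, Nat.cast_zero, div_one, Nat.reduceAdd] at h3
    have h4 : |u / l| ^ 2 / (1 - |u / l|) ≤ 2 * |u / l| ^ 2 := by
      rw [div_le_iff₀ (by linarith)]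
      nlinarith [sq_nonneg |u / l|]
    have h5 : Real.log (l - u) = Real.log l + Real.log (1 - u / l) := by
      rw [← Real.log_mul (by linarith) (by linarith [le_abs_self (u / l)])]
      congr 1
      field_simp
    have h6 : eulerSum ε (k / t) - (Real.log l + a - u / l) =
        (eulerSum ε (k / t) - Real.log (l - u) - a) + (u / l + Real.log (1 - u / l)) := by
      rw [h5]; ring
    have h7 : C / (l - u) ^ 2 * l ^ 2 ≤ 4 * C := by
      rw [div_mul_eq_mul_div, div_le_iff₀ (by nlinarith)]
      have : l ^ 2 ≤ 4 * (l - u) ^ 2 := by nlinarith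
      nlinarith
    have h8 : 2 * |u / l| ^ 2 * l ^ 2 = 2 * |u| ^ 2 := by
      rw [abs_div, abs_of_pos (by linarith : 0 < l)]
      field_simp
    have h9 : |u| ^ 2 ≤ (1 + |u|) ^ 3 := by nlinarith
    rw [h6]
    calc _ ≤ (C / (l - u) ^ 2 + 2 * |u / l| ^ 2) * l ^ 2 := by
          gcongr
          exact (abs_add_le _ _).trans (add_le_add h2 (h3.trans h4))
      _ ≤ 4 * C + 2 * |u| ^ 2 := by rw [add_mul, h8]; linarith
      _ ≤ (4 * C + 2) * (1 + |u|) ^ 3 := by nlinarith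
      _ ≤ _ := by
        have : 0 ≤ 4 * (8 + 2 * |a| + C + E) := by positivity
        exact mul_le_mul_of_nonneg_right (by linarith) (by positivity)
  · have h1 : 1 ≤ |u| := by linarith
    have hs0 := eulerSum_nonneg hε (k / t)
    have hs : eulerSum ε (k / t) ≤ 3 * |u| + |a| + C + E := by
      rcases le_or_gt (Real.exp 1) (k / t) with hx | hx
      · have h2 := (abs_le.1 (h (k / t) hx)).2
        rw [hlog] at h2
        have h3 : 1 ≤ l - u := by rw [← hlog]; exact one_le_log_of_exp_le hx
        have h4 : Real.log (l - u) ≤ l - u := Real.log_le_self (by linarith)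
        have h5 : C / (l - u) ^ 2 ≤ C := div_le_self hC (one_le_pow₀ h3)
        linarith [le_abs_self a, neg_abs_le u]
      · have := eulerSum_mono hε hx.le
        linarith [abs_nonneg a]
    have hll : 0 ≤ Real.log l := Real.log_nonneg (by linarith)
    have hll2 : Real.log l ≤ 2 * |u| := (Real.log_le_self (by linarith)).trans (by linarith)
    have hul2 : |u / l| ≤ |u| := by
      rw [abs_div, abs_of_pos (by linarith : 0 < l)]
      exact div_le_self hu0 (by linarith)
    have hb := abs_le.1 hul2
    have h2 : |eulerSum ε (k / t) - (Real.log l + a - u / l)| ≤ (8 + 2 * |a| + C + E) * |u| := by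
      have h3 : |eulerSum ε (k / t) - (Real.log l + a - u / l)| ≤ 8 * |u| + (2 * |a| + C + E) := by
        rw [abs_le]
        constructor <;> linarith [le_abs_self a, neg_abs_le a, abs_nonneg a]
      have : 0 ≤ 2 * |a| + C + E := by positivity
      nlinarith
    calc _ ≤ (8 + 2 * |a| + C + E) * |u| * l ^ 2 := by gcongr
      _ ≤ (8 + 2 * |a| + C + E) * |u| * (2 * |u|) ^ 2 := by gcongr; linarith
      _ = 4 * (8 + 2 * |a| + C + E) * |u| ^ 3 := by ring
      _ ≤ (4 * C + 2 + 4 * (8 + 2 * |a| + C + E)) * (1 + |u|) ^ 3 := by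
        gcongr
        · linarith
        · linarith

/-- Integrate the expansion of the Mertens sum at k/t against the density: total mass 1 keeps the
constant part, and the first moment of log t produces the term in 1/log k. -/
theorem exists_tsum_eulerWeight_mul_besselSlope_sub_le {ε : ℝ} (hε : ε = 1 ∨ ε = -1) :
    ∃ C : ℝ, 0 ≤ C ∧ ∀ k : ℝ, Real.exp 2 ≤ k →
      |∑' n : ℕ, eulerWeight ε n * besselSlope (k / n) -
        (Real.log (Real.log k) + eulerConst ε + (constC - Real.log 2) / Real.log k)| ≤ C / Real.log k ^ 2 := by
  obtain ⟨C, hC, h⟩ := exists_eulerSum_div_sub_le hε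
  set J := ∫ t in Set.Ioi 0, besselSlopeDeriv t * (1 + |Real.log t|) ^ 3 with hJ
  have hJ0 : 0 ≤ J := setIntegral_nonneg measurableSet_Ioi fun t ht =>
    mul_nonneg (besselSlopeDeriv_nonneg (le_of_lt ht)) (by positivity)
  refine ⟨C * J, by positivity, fun k hk => ?_⟩
  have hk0 : 0 < k := (Real.exp_pos 2).trans_le hk
  have hi1 : IntegrableOn (fun t => besselSlopeDeriv t * (Real.log (Real.log k) + eulerConst ε)) (Set.Ioi 0) :=
    integrableOn_besselSlopeDeriv.mul_const _
  have hi2 : IntegrableOn (fun t => besselSlopeDeriv t * Real.log t / Real.log k) (Set.Ioi 0) :=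
    integrableOn_besselSlopeDeriv_mul_log.div_const _
  have hmain : Real.log (Real.log k) + eulerConst ε + (constC - Real.log 2) / Real.log k =
      ∫ t in Set.Ioi 0, (besselSlopeDeriv t * (Real.log (Real.log k) + eulerConst ε) - besselSlopeDeriv t * Real.log t / Real.log k) := by
    rw [integral_sub hi1 hi2, integral_mul_const, integral_div, integral_besselSlopeDeriv, integral_besselSlopeDeriv_mul_log]
    ring
  have hmeas : Measurable fun t => eulerSum ε (k / t) :=
    (eulerSum_mono hε).measurable.comp (by fun_prop)
  have hi3 : IntegrableOn (fun t => besselSlopeDeriv t * (eulerSum ε (k / t) -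
      (Real.log (Real.log k) + eulerConst ε - Real.log t / Real.log k))) (Set.Ioi 0) :=
    integrableOn_besselSlopeDeriv_mul (f := fun t => eulerSum ε (k / t) -
      (Real.log (Real.log k) + eulerConst ε - Real.log t / Real.log k)) (hmeas.sub (by fun_prop)) (h k hk)
  have hi4 : IntegrableOn (fun t => besselSlopeDeriv t * eulerSum ε (k / t)) (Set.Ioi 0) := by
    have hi5 := (hi3.add hi1).sub hi2
    refine hi5.congr (ae_of_all _ fun t => ?_)
    simp only [Pi.add_apply, Pi.sub_apply]
    ring
  have hi6 : IntegrableOn (fun t => besselSlopeDeriv t * (Real.log (Real.log k) + eulerConst ε) -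
      besselSlopeDeriv t * Real.log t / Real.log k) (Set.Ioi 0) := hi1.sub hi2
  rw [tsum_eulerWeight_mul_besselSlope hε hk0, hmain, ← integral_sub hi4 hi6]
  rw [← Real.norm_eq_abs]
  refine (norm_integral_le_of_norm_le (integrableOn_besselSlopeDeriv_mul_log_cube.const_mul (C / Real.log k ^ 2)) ?_).trans_eq ?_
  · refine (ae_restrict_iff' measurableSet_Ioi).2 (ae_of_all _ fun t ht => ?_)
    have ht0 : 0 < t := ht
    have h0 := besselSlopeDeriv_nonneg ht0.le
    calc _ = ‖besselSlopeDeriv t * (eulerSum ε (k / t) - (Real.log (Real.log k) + eulerConst ε - Real.log t / Real.log k))‖ := by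
          congr 1
          ring
      _ ≤ besselSlopeDeriv t * (C / Real.log k ^ 2 * (1 + |Real.log t|) ^ 3) := by
          rw [norm_mul, Real.norm_eq_abs, Real.norm_eq_abs, abs_of_nonneg h0]
          gcongr
          exact h k hk t ht0
      _ = _ := by ring
  · rw [integral_const_mul]
    ring

end RandomEuler

/-! ### The moment of a single Euler factor. -/

namespace RandomEuler
open Mertens

/-- `E |1 - X/n|^{-s}` for `X` uniform on the unit circle. -/
noncomputable def localMoment (n : ℕ) (s : ℝ) : ℝ := ∫ x, ‖1 - x / (n : ℂ)‖ ^ (-s) ∂unifCircle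

lemma norm_one_sub_div_bounds {n : ℕ} (hn : 2 ≤ n) {x : ℂ} (hx : ‖x‖ = 1) :
    1 - 1 / (n : ℝ) ≤ ‖1 - x / (n : ℂ)‖ ∧ ‖1 - x / (n : ℂ)‖ ≤ 1 + 1 / (n : ℝ) ∧ 1 / 2 ≤ ‖1 - x / (n : ℂ)‖ := by
  have h2 : (2 : ℝ) ≤ n := by exact_mod_cast hn
  have hxn : ‖x / (n : ℂ)‖ = 1 / n := by rw [norm_div, hx, Complex.norm_natCast]
  have h1 := norm_sub_norm_le (1 : ℂ) (x / n)
  have h3 := norm_sub_le (1 : ℂ) (x / n)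
  have h4 : 1 / (n : ℝ) ≤ 1 / 2 := by gcongr
  rw [hxn, norm_one] at h1 h3
  exact ⟨h1, h3, by linarith⟩

lemma ae_rpow_eq_exp {n : ℕ} (hn : 2 ≤ n) (s : ℝ) :
    ∀ᵐ x ∂unifCircle, ‖1 - x / (n : ℂ)‖ ^ (-s) = Real.exp (-s * Real.log ‖1 - x / (n : ℂ)‖) := by
  filter_upwards [ae_norm_eq_one] with x hx
  have h := (norm_one_sub_div_bounds hn hx).2.2
  rw [Real.rpow_def_of_pos (by linarith), mul_comm]

lemma measurable_norm_rpow (n : ℕ) (s : ℝ) : Measurable fun x : ℂ => ‖1 - x / (n : ℂ)‖ ^ (-s) := by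
  fun_prop

lemma integrable_norm_rpow {n : ℕ} (hn : 2 ≤ n) (s : ℝ) :
    Integrable (fun x : ℂ => ‖1 - x / (n : ℂ)‖ ^ (-s)) unifCircle := by
  refine Integrable.of_bound (C := Real.exp |s|) (measurable_norm_rpow n s).aestronglyMeasurable ?_
  filter_upwards [ae_norm_eq_one, ae_rpow_eq_exp hn s] with x hx hx2
  obtain ⟨h1, h2, h3⟩ := norm_one_sub_div_bounds hn hx
  rw [hx2, Real.norm_eq_abs, Real.abs_exp, Real.exp_le_exp]
  have h4 : 1 / (n : ℝ) ≤ 1 / 2 := by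
    have h2 : (2 : ℝ) ≤ n := by exact_mod_cast hn
    gcongr
  have h5 : |Real.log ‖1 - x / (n : ℂ)‖| ≤ 1 := by
    have h6 := Real.log_le_sub_one_of_pos (x := ‖1 - x / (n : ℂ)‖) (by linarith)
    have h7 := Real.one_sub_inv_le_log_of_pos (x := ‖1 - x / (n : ℂ)‖) (by linarith)
    have h8 : (‖1 - x / (n : ℂ)‖)⁻¹ ≤ 2 := by
      rw [inv_le_comm₀ (by linarith) two_pos]; linarith
    rw [abs_le]; constructor <;> linarith
  refine (le_abs_self _).trans ?_
  rw [abs_mul, abs_neg]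
  exact mul_le_of_le_one_right (abs_nonneg _) h5

lemma localMoment_eq {n : ℕ} (hn : 2 ≤ n) (s : ℝ) :
    localMoment n s = ∫ x, Real.exp (-s * Real.log ‖1 - x / (n : ℂ)‖) ∂unifCircle :=
  integral_congr_ae (ae_rpow_eq_exp hn s)

lemma integrable_exp_log {n : ℕ} (hn : 2 ≤ n) (s : ℝ) :
    Integrable (fun x : ℂ => Real.exp (-s * Real.log ‖1 - x / (n : ℂ)‖)) unifCircle :=
  (integrable_norm_rpow hn s).congr (ae_rpow_eq_exp hn s)

lemma localMoment_pos {n : ℕ} (hn : 2 ≤ n) (s : ℝ) : 0 < localMoment n s := by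
  rw [localMoment_eq hn]
  exact integral_exp_pos (integrable_exp_log hn s)

lemma besselI0_neg (t : ℝ) : besselI0 (-t) = besselI0 t := by
  unfold besselI0
  refine tsum_congr fun n => ?_
  rw [neg_div, Even.neg_pow (even_two_mul n)]

lemma abs_neg_log_norm_sub_le {n : ℕ} (hn : 2 ≤ n) {x : ℂ} (hx : ‖x‖ = 1) :
    |-Real.log ‖1 - x / (n : ℂ)‖ - x.re / n| ≤ 1 / (n : ℝ) ^ 2 := by
  have h2 : (2 : ℝ) ≤ n := by exact_mod_cast hn
  have hxn : ‖x / (n : ℂ)‖ = 1 / n := by rw [norm_div, hx, Complex.norm_natCast]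
  have h4 : 1 / (n : ℝ) ≤ 1 / 2 := by gcongr
  have h := Complex.norm_log_one_add_sub_self_le (z := -(x / (n : ℂ))) (by rw [norm_neg, hxn]; linarith)
  rw [norm_neg, hxn, ← sub_eq_add_neg] at h
  have h5 := (Complex.abs_re_le_norm _).trans h
  have h6 : (Complex.log (1 - x / (n : ℂ)) - -(x / (n : ℂ))).re = -(-Real.log ‖1 - x / (n : ℂ)‖ - x.re / n) := by
    rw [Complex.sub_re, Complex.log_re, Complex.neg_re, Complex.div_natCast_re]
    ring
  rw [h6, abs_neg] at h5
  refine h5.trans ?_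
  have h7 : (1 - 1 / (n : ℝ))⁻¹ ≤ 2 := by
    rw [inv_le_comm₀ (by linarith) two_pos]; linarith
  calc (1 / (n : ℝ)) ^ 2 * (1 - 1 / (n : ℝ))⁻¹ / 2 ≤ (1 / (n : ℝ)) ^ 2 * 2 / 2 := by gcongr
    _ = _ := by rw [one_div_pow]; ring

/-- The exponents -εk log|1 - x/n| and εk Re x/n differ by at most k/n² on the circle, so the
logarithms of the two expectations differ by no more. The sign disappears because I₀ is even. -/
lemma abs_log_localMoment_sub_besselLog_le {ε : ℝ} (hε : ε = 1 ∨ ε = -1) {n : ℕ} (hn : 2 ≤ n) {k : ℝ} (hk : 0 ≤ k) :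
    |Real.log (localMoment n (ε * k)) - besselLog (k / n)| ≤ k / (n : ℝ) ^ 2 := by
  have he := abs_sign_eq_one hε
  have hI : besselI0 (k / n) = ∫ x, Real.exp (ε * (k / n) * x.re) ∂unifCircle := by
    have : besselI0 (k / n) = besselI0 (ε * (k / n)) := by
      rcases hε with rfl | rfl
      · rw [one_mul]
      · rw [neg_one_mul, besselI0_neg]
    rw [this, besselI0_eq_mgf, mgf]
  have hpos := besselI0_pos (k / n)
  have hpos2 := localMoment_pos hn (ε * k)
  have hd : ∀ x : ℂ, ‖x‖ = 1 → |-(ε * k) * Real.log ‖1 - x / (n : ℂ)‖ - ε * (k / n) * x.re| ≤ k / (n : ℝ) ^ 2 := by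
    intro x hx
    have h := abs_neg_log_norm_sub_le hn hx
    have h1 : -(ε * k) * Real.log ‖1 - x / (n : ℂ)‖ - ε * (k / n) * x.re =
        (ε * k) * (-Real.log ‖1 - x / (n : ℂ)‖ - x.re / n) := by ring
    rw [h1, abs_mul, abs_mul, he, one_mul, abs_of_nonneg hk]
    calc _ ≤ k * (1 / (n : ℝ) ^ 2) := by gcongr
      _ = _ := by ring
  have hmul : ∀ c : ℝ, ∀ f : ℂ → ℝ, Real.exp c * ∫ x, Real.exp (f x) ∂unifCircle = ∫ x, Real.exp (c + f x) ∂unifCircle := by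
    intro c f
    simp_rw [Real.exp_add]
    rw [integral_const_mul]
  have hint1 := integrable_exp_log hn (ε * k)
  have hint2 := integrable_exp_mul_re (ε * (k / n))
  have h1 : localMoment n (ε * k) ≤ Real.exp (k / (n : ℝ) ^ 2) * besselI0 (k / n) := by
    rw [hI, hmul, localMoment_eq hn]
    refine integral_mono_ae hint1 ?_ ?_
    · simp_rw [Real.exp_add]
      exact hint2.const_mul _
    · filter_upwards [ae_norm_eq_one] with x hx
      rw [Real.exp_le_exp]
      linarith [(abs_le.1 (hd x hx)).2]
  have h2 : besselI0 (k / n) ≤ Real.exp (k / (n : ℝ) ^ 2) * localMoment n (ε * k) := by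
    rw [hI, localMoment_eq hn, hmul]
    refine integral_mono_ae hint2 ?_ ?_
    · simp_rw [Real.exp_add]
      exact hint1.const_mul _
    · filter_upwards [ae_norm_eq_one] with x hx
      rw [Real.exp_le_exp]
      linarith [(abs_le.1 (hd x hx)).1]
  have h3 := Real.log_le_log hpos2 h1
  have h4 := Real.log_le_log hpos h2
  rw [Real.log_mul (Real.exp_pos _).ne' hpos.ne', Real.log_exp] at h3
  rw [Real.log_mul (Real.exp_pos _).ne' hpos2.ne', Real.log_exp] at h4
  unfold besselLog
  rw [abs_le]
  constructor <;> linarith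

lemma le_unifCircle_near {ε : ℝ} (hε : ε = 1 ∨ ε = -1) {δ : ℝ} (hδ : 0 < δ) (hδ1 : δ ≤ 1) :
    δ / (2 * Real.pi) ≤ unifCircle.real {x : ℂ | ‖x - ε‖ ≤ δ} := by
  have hpi := Real.pi_gt_three
  have hms : MeasurableSet {x : ℂ | ‖x - ε‖ ≤ δ} := measurableSet_le (by fun_prop) (by fun_prop)
  -- A one-sided arc, starting at angle 0 or π, stays within the parameter interval (0, 2π].
  obtain ⟨b, hb0, hb1, hb⟩ : ∃ b : ℝ, 0 ≤ b ∧ b + δ ≤ 2 * Real.pi ∧ Complex.exp (b * Complex.I) = ε := by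
    rcases hε with rfl | rfl
    · exact ⟨0, le_rfl, by linarith, by simp⟩
    · exact ⟨Real.pi, by linarith, by linarith, by simp [Complex.exp_pi_mul_I]⟩
  have hsub : Set.Ioc b (b + δ) ⊆ (fun θ : ℝ => Complex.exp (θ * Complex.I)) ⁻¹' {x : ℂ | ‖x - ε‖ ≤ δ} := by
    intro θ hθ
    have h1 : Complex.exp (θ * Complex.I) - ε = Complex.exp (b * Complex.I) * (Complex.exp (Complex.I * ((θ - b : ℝ) : ℂ)) - 1) := by
      rw [mul_sub, ← Complex.exp_add, hb, mul_one]
      congr 2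
      push_cast
      ring
    have h2 : ‖Complex.exp (θ * Complex.I) - ε‖ ≤ δ := by
      rw [h1, norm_mul, Complex.norm_exp_ofReal_mul_I, one_mul]
      refine Real.norm_exp_I_mul_ofReal_sub_one_le.trans ?_
      rw [Real.norm_eq_abs, abs_of_pos (by linarith [hθ.1])]
      linarith [hθ.2]
    exact h2
  have hsub2 : Set.Ioc b (b + δ) ⊆ Set.Ioc 0 (2 * Real.pi) := Set.Ioc_subset_Ioc hb0 hb1
  rw [measureReal_def, unifCircle, Measure.map_apply (by fun_prop) hms]
  have h3 : (ProbabilityTheory.cond volume (Set.Ioc (0 : ℝ) (2 * Real.pi))).real (Set.Ioc b (b + δ)) = δ / (2 * Real.pi) := by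
    rw [measureReal_def, cond_apply measurableSet_Ioc, Set.inter_eq_right.2 hsub2, Real.volume_Ioc, Real.volume_Ioc,
      ENNReal.toReal_mul, ENNReal.toReal_inv, ENNReal.toReal_ofReal (by linarith), ENNReal.toReal_ofReal (by linarith)]
    field_simp
    ring
  rw [← h3]
  exact measureReal_mono hsub

lemma le_neg_log_norm_of_near {ε : ℝ} (hε : ε = 1 ∨ ε = -1) {p : ℕ} (hp : p.Prime) {δ : ℝ} (hδ : 0 < δ) (hδ1 : δ ≤ 1 / 2)
    {x : ℂ} (hx : ‖x‖ = 1) (hxδ : ‖x - ε‖ ≤ δ) :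
    eulerWeight ε p - δ ≤ -ε * Real.log ‖1 - x / (p : ℂ)‖ := by
  rw [eulerWeight_of_prime ε hp]
  have hr := one_div_prime_le_half hp
  have hr0 : 0 < 1 / (p : ℝ) := by have := hp.pos; positivity
  set r := 1 / (p : ℝ) with hr'
  obtain ⟨hb1, hb2, hb3⟩ := norm_one_sub_div_bounds hp.two_le hx
  have h1 : (1 - x / (p : ℂ)) - ((1 - ε * r : ℝ) : ℂ) = -((x - ε) * (r : ℝ)) := by
    rw [hr']; push_cast; ring
  have h2 : |‖1 - x / (p : ℂ)‖ - abs (1 - ε * r)| ≤ δ * r := by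
    have h3 := abs_norm_sub_norm_le (1 - x / (p : ℂ)) ((1 - ε * r : ℝ) : ℂ)
    rw [h1, norm_neg, norm_mul, Complex.norm_real, Complex.norm_real, Real.norm_eq_abs, Real.norm_eq_abs, abs_of_pos hr0] at h3
    exact h3.trans (by gcongr)
  have h3 := abs_le.1 h2
  rcases hε with rfl | rfl
  · rw [one_mul, abs_of_pos (by linarith)] at h3
    have h4 : ‖1 - x / (p : ℂ)‖ ≤ (1 - r) * (1 + δ) := by nlinarith
    have h5 := Real.log_le_log (by linarith) h4
    rw [Real.log_mul (by linarith) (by linarith)] at h5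
    have h6 := Real.log_le_sub_one_of_pos (x := 1 + δ) (by linarith)
    rw [one_mul]
    linarith
  · rw [neg_one_mul, sub_neg_eq_add, abs_of_pos (by linarith)] at h3
    have h4 : (1 + r) * (1 - δ / 2) ≤ ‖1 - x / (p : ℂ)‖ := by nlinarith
    have h5 := Real.log_le_log (by nlinarith) h4
    rw [Real.log_mul (by linarith) (by linarith)] at h5
    have h6 := Real.one_sub_inv_le_log_of_pos (x := 1 - δ / 2) (by linarith)
    have h7 : (1 - δ / 2)⁻¹ ≤ 1 + δ := by
      rw [inv_le_iff_one_le_mul₀ (by linarith)]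
      nlinarith
    have h8 : 1 - -1 * r = 1 + r := by ring
    rw [h8]
    linarith

lemma log_two_mul_pi_le : Real.log (2 * Real.pi) ≤ 2 := by
  have h8 := Real.pi_lt_d2
  have h6 := Real.exp_one_gt_d9
  have h9 : Real.exp 2 = Real.exp 1 * Real.exp 1 := by rw [← Real.exp_add]; norm_num
  rw [Real.log_le_iff_le_exp (by positivity), h9]
  nlinarith

/-- The maximum of -ε log|1 - x/p| on the circle is attained at x = ε and gives the upper bound. For
the lower bound restrict to |x - ε| ≤ 1/k: the mass is at least 1/(2πk) and the integrand loses at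
most a factor e. -/
lemma log_localMoment_bounds {ε : ℝ} (hε : ε = 1 ∨ ε = -1) {p : ℕ} (hp : p.Prime) {k : ℝ} (hk : 2 ≤ k) :
    Real.log (localMoment p (ε * k)) ≤ k * eulerWeight ε p ∧
      k * eulerWeight ε p - (Real.log k + 3) ≤ Real.log (localMoment p (ε * k)) := by
  have hpos := localMoment_pos hp.two_le (ε * k)
  have hint := integrable_exp_log hp.two_le (ε * k)
  have hr := one_div_prime_le_half hp
  have hr0 : 0 < 1 / (p : ℝ) := by have := hp.pos; positivity
  constructor
  · rw [Real.log_le_iff_le_exp hpos, localMoment_eq hp.two_le]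
    calc _ ≤ ∫ x, Real.exp (k * eulerWeight ε p) ∂unifCircle := by
          refine integral_mono_ae hint (integrable_const _) ?_
          filter_upwards [ae_norm_eq_one] with x hx
          obtain ⟨hb1, hb2, hb3⟩ := norm_one_sub_div_bounds hp.two_le hx
          rw [Real.exp_le_exp, eulerWeight_of_prime ε hp]
          have : -ε * Real.log ‖1 - x / (p : ℂ)‖ ≤ -ε * Real.log (1 - ε * (1 / p)) := by
            rcases hε with rfl | rfl
            · have := Real.log_le_log (by linarith) hb1
              rw [one_mul]; linarith
            · have := Real.log_le_log (by linarith) hb2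
              rw [neg_one_mul, sub_neg_eq_add]; linarith
          nlinarith
      _ = _ := by simp
  · rw [Real.le_log_iff_exp_le hpos]
    have hk0 : 0 < k := by linarith
    set S := {x : ℂ | ‖x - ε‖ ≤ 1 / k} with hS
    have hms : MeasurableSet S := measurableSet_le (by fun_prop) (by fun_prop)
    have hk1 : 1 / k ≤ 1 / 2 := by gcongr
    calc Real.exp (k * eulerWeight ε p - (Real.log k + 3)) ≤ 1 / k / (2 * Real.pi) * Real.exp (k * eulerWeight ε p - 1) := by
          have h1 : 1 / k / (2 * Real.pi) * Real.exp (k * eulerWeight ε p - 1) =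
              Real.exp (k * eulerWeight ε p - 1 - Real.log k - Real.log (2 * Real.pi)) := by
            rw [Real.exp_sub _ (Real.log (2 * Real.pi)), Real.exp_sub _ (Real.log k), Real.exp_log hk0, Real.exp_log (by positivity)]
            field_simp
          rw [h1, Real.exp_le_exp]
          linarith [log_two_mul_pi_le]
      _ ≤ unifCircle.real S * Real.exp (k * eulerWeight ε p - 1) := by
          gcongr
          exact le_unifCircle_near hε (by positivity) (by linarith)
      _ = ∫ x in S, Real.exp (k * eulerWeight ε p - 1) ∂unifCircle := by
          rw [setIntegral_const, smul_eq_mul]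
      _ ≤ ∫ x in S, Real.exp (-(ε * k) * Real.log ‖1 - x / (p : ℂ)‖) ∂unifCircle := by
          refine setIntegral_mono_on_ae (integrableOn_const (measure_ne_top _ _)) hint.integrableOn hms ?_
          filter_upwards [ae_norm_eq_one] with x hx hxS
          rw [Real.exp_le_exp]
          have h1 := le_neg_log_norm_of_near hε hp (by positivity) hk1 hx hxS
          have h2 : k * (1 / k) = 1 := by field_simp
          nlinarith
      _ ≤ ∫ x, Real.exp (-(ε * k) * Real.log ‖1 - x / (p : ℂ)‖) ∂unifCircle :=
          setIntegral_le_integral hint (ae_of_all _ fun x => (Real.exp_pos _).le)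
      _ = _ := (localMoment_eq hp.two_le _).symm

end RandomEuler

/-! ### The cumulant generating function of log |L(1,X)|. -/

namespace RandomEuler
open Mertens

/-- `log E |1 - X/p|^{-s}` at primes. -/
noncomputable def logMoment (s : ℝ) (n : ℕ) : ℝ := if n.Prime then Real.log (localMoment n s) else 0

lemma abs_logMoment_sub_le_of_large {ε : ℝ} (hε : ε = 1 ∨ ε = -1) {p : ℕ} (hp : p.Prime) {k : ℝ} (hk : 0 ≤ k) :
    |logMoment (ε * k) p - k * (eulerWeight ε p * besselSlope (k / p))| ≤ 3 * k / (p : ℝ) ^ 2 := by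
  have hp0 : (0 : ℝ) < p := by exact_mod_cast hp.pos
  rw [logMoment, if_pos hp]
  have h1 := abs_log_localMoment_sub_besselLog_le hε hp.two_le hk
  have h2 : besselLog (k / p) = k * (1 / p * besselSlope (k / p)) := by
    rcases hk.eq_or_lt with rfl | hk0
    · simp [besselLog_zero]
    · rw [besselSlope]; field_simp
  have h3 : Real.log (localMoment p (ε * k)) - k * (eulerWeight ε p * besselSlope (k / p)) =
      (Real.log (localMoment p (ε * k)) - besselLog (k / p)) - k * ((eulerWeight ε p - 1 / p) * besselSlope (k / p)) := by
    rw [h2]; ring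
  have h4 : |k * ((eulerWeight ε p - 1 / p) * besselSlope (k / p))| ≤ k * (2 / (p : ℝ) ^ 2 * 1) := by
    have h5 := besselSlope_nonneg (t := k / p) (by positivity)
    rw [abs_mul, abs_mul, abs_of_nonneg hk, abs_of_nonneg h5]
    gcongr
    · exact abs_eulerWeight_sub_le hε hp
    · exact besselSlope_le_one (by positivity)
  rw [h3]
  refine (abs_sub _ _).trans ((add_le_add h1 h4).trans_eq ?_)
  ring

lemma abs_logMoment_sub_le_of_small {ε : ℝ} (hε : ε = 1 ∨ ε = -1) {p : ℕ} (hp : p.Prime) {k : ℝ} (hk : 2 ≤ k) :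
    |logMoment (ε * k) p - k * (eulerWeight ε p * besselSlope (k / p))| ≤ 2 * Real.log k + 8 := by
  have hp2 : (2 : ℝ) ≤ p := by exact_mod_cast hp.two_le
  have hk0 : 0 < k := by linarith
  have hkp : 0 < k / p := by positivity
  rw [logMoment, if_pos hp]
  obtain ⟨h1, h2⟩ := log_localMoment_bounds hε hp hk
  have h3 : 0 ≤ 1 - besselSlope (k / p) := sub_nonneg.2 (besselSlope_le_one hkp.le)
  have hw := eulerWeight_nonneg hε p
  have h4 : k * (eulerWeight ε p * (1 - besselSlope (k / p))) ≤ 2 * Real.log k + 6 := by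
    have h5 : 1 + k / p ≤ k := by
      have : k / p ≤ k / 2 := by gcongr
      linarith
    have h6 := Real.log_le_log (by positivity) h5
    calc k * (eulerWeight ε p * (1 - besselSlope (k / p))) ≤ k * (2 / p * ((Real.log (1 + k / p) + 3) / (k / p))) := by
          gcongr
          · exact eulerWeight_le hε p
          · exact one_sub_besselSlope_le hkp
      _ = 2 * (Real.log (1 + k / p) + 3) := by field_simp
      _ ≤ _ := by linarith
  have h5 : 0 ≤ k * (eulerWeight ε p * (1 - besselSlope (k / p))) := by positivity
  have h6 : 0 ≤ Real.log k := Real.log_nonneg (by linarith)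
  rw [abs_le]
  constructor <;> linarith

/-- The geometric mean with weights 3/4 and 1/4 of the bounds O(k/p²) and O(log k). It is summable
over n and costs only k^{3/4} log k, with no need to cut the sum into small and large primes. -/
lemma abs_logMoment_sub_le {ε : ℝ} (hε : ε = 1 ∨ ε = -1) (n : ℕ) {k : ℝ} (hk : 2 ≤ k) :
    |logMoment (ε * k) n - k * (eulerWeight ε n * besselSlope (k / n))| ≤
      (2 * Real.log k + 8) * (3 * k ^ (3 / 4 : ℝ)) * (n : ℝ) ^ (-(3 / 2) : ℝ) := by
  have hk0 : 0 < k := by linarith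
  have h6 : 0 ≤ Real.log k := Real.log_nonneg (by linarith)
  by_cases hp : n.Prime
  · have hn0 : (0 : ℝ) < n := by exact_mod_cast hp.pos
    have h1 := abs_logMoment_sub_le_of_large hε hp hk0.le
    have h2 := abs_logMoment_sub_le_of_small hε hp hk
    set D := |logMoment (ε * k) n - k * (eulerWeight ε n * besselSlope (k / n))| with hD
    have hD0 : 0 ≤ D := abs_nonneg _
    calc D = D ^ (1 / 4 : ℝ) * D ^ (3 / 4 : ℝ) := by
          rw [← Real.rpow_add_of_nonneg hD0 (by norm_num) (by norm_num)]; norm_num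
      _ ≤ (2 * Real.log k + 8) ^ (1 / 4 : ℝ) * (3 * k / (n : ℝ) ^ 2) ^ (3 / 4 : ℝ) := by gcongr
      _ ≤ (2 * Real.log k + 8) * (3 * k ^ (3 / 4 : ℝ) * (n : ℝ) ^ (-(3 / 2) : ℝ)) := by
          have h3 : (3 * k / (n : ℝ) ^ 2) ^ (3 / 4 : ℝ) = 3 ^ (3 / 4 : ℝ) * k ^ (3 / 4 : ℝ) * (n : ℝ) ^ (-(3 / 2) : ℝ) := by
            rw [Real.div_rpow (by positivity) (by positivity), Real.mul_rpow (by norm_num) hk0.le, ← Real.rpow_natCast,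
              ← Real.rpow_mul hn0.le, Real.rpow_neg hn0.le, div_eq_mul_inv]
            norm_num
          have h4 : (3 : ℝ) ^ (3 / 4 : ℝ) ≤ 3 := by
            calc (3 : ℝ) ^ (3 / 4 : ℝ) ≤ 3 ^ (1 : ℝ) :=
                  Real.rpow_le_rpow_of_exponent_le (by norm_num) (by norm_num)
              _ = 3 := Real.rpow_one 3
          have h5 : (2 * Real.log k + 8) ^ (1 / 4 : ℝ) ≤ 2 * Real.log k + 8 := by
            nth_rw 2 [← Real.rpow_one (2 * Real.log k + 8)]
            exact Real.rpow_le_rpow_of_exponent_le (by linarith) (by norm_num)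
          rw [h3]
          gcongr
      _ = _ := by ring
  · rw [logMoment, if_neg hp, eulerWeight, if_neg hp, zero_mul, mul_zero, sub_zero, abs_zero]
    positivity

lemma summable_logMoment {ε : ℝ} (hε : ε = 1 ∨ ε = -1) {k : ℝ} (hk : 2 ≤ k) : Summable (logMoment (ε * k)) := by
  have h1 : Summable fun n : ℕ => logMoment (ε * k) n - k * (eulerWeight ε n * besselSlope (k / n)) :=
    Summable.of_norm_bounded ((Real.summable_nat_rpow.2 (show (-(3 / 2) : ℝ) < -1 by norm_num)).mul_left
      ((2 * Real.log k + 8) * (3 * k ^ (3 / 4 : ℝ)))) fun n => abs_logMoment_sub_le hε n hk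
  have h2 := (summable_eulerWeight_mul_besselSlope hε (k := k) (by linarith)).mul_left k
  exact (h1.add h2).congr fun n => by ring

/-- The cumulant generating function of `log |L(1,X)|`. -/
theorem exists_tsum_logMoment_sub_le {ε : ℝ} (hε : ε = 1 ∨ ε = -1) :
    ∃ C : ℝ, 0 ≤ C ∧ ∀ k : ℝ, Real.exp 2 ≤ k →
      |∑' n : ℕ, logMoment (ε * k) n -
        k * (Real.log (Real.log k) + eulerConst ε + (constC - Real.log 2) / Real.log k)| ≤ C * (k / Real.log k ^ 2) := by
  obtain ⟨C, hC, h⟩ := exists_tsum_eulerWeight_mul_besselSlope_sub_le hε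
  set Z := ∑' n : ℕ, (n : ℝ) ^ (-(3 / 2) : ℝ) with hZ
  have hZs : Summable fun n : ℕ => (n : ℝ) ^ (-(3 / 2) : ℝ) := Real.summable_nat_rpow.2 (by norm_num)
  have hZ0 : 0 ≤ Z := tsum_nonneg fun n => by positivity
  -- 51840 = 10·1728·3: here 2 log k + 8 ≤ 10 log k, log³ k ≤ 1728 k^{1/4}, and 3 comes from
  -- `abs_logMoment_sub_le`.
  refine ⟨51840 * Z + C, by positivity, fun k hk => ?_⟩
  have hk0 : 0 < k := (Real.exp_pos 2).trans_le hk
  have hl2 : 2 ≤ Real.log k := by rw [Real.le_log_iff_exp_le hk0]; exact hk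
  have hk2 : 2 ≤ k := hl2.trans (Real.log_le_self hk0.le)
  have h2 := (summable_eulerWeight_mul_besselSlope hε hk0).mul_left k
  have h1 : |∑' n : ℕ, (logMoment (ε * k) n - k * (eulerWeight ε n * besselSlope (k / n)))| ≤
      (2 * Real.log k + 8) * (3 * k ^ (3 / 4 : ℝ)) * Z :=
    (Real.norm_eq_abs _).symm.trans_le <| tsum_of_norm_bounded (hZs.hasSum.mul_left _) fun n => abs_logMoment_sub_le hε n hk2
  rw [(summable_logMoment hε hk2).tsum_sub h2, tsum_mul_left] at h1
  have h3 : (2 * Real.log k + 8) * (3 * k ^ (3 / 4 : ℝ)) * Z ≤ 51840 * Z * (k / Real.log k ^ 2) := by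
    rw [← mul_div_assoc, le_div_iff₀ (by positivity)]
    have h4 := Real.log_le_rpow_div (x := k) hk0.le (ε := 1 / 12) (by norm_num)
    have h5 : Real.log k ^ 3 ≤ 1728 * k ^ (1 / 4 : ℝ) := by
      calc Real.log k ^ 3 ≤ (k ^ (1 / 12 : ℝ) / (1 / 12)) ^ 3 := by gcongr
        _ = 1728 * (k ^ (1 / 12 : ℝ)) ^ 3 := by ring
        _ = _ := by rw [← Real.rpow_natCast, ← Real.rpow_mul hk0.le]; norm_num
    have h6 : (2 * Real.log k + 8) * Real.log k ^ 2 ≤ 10 * Real.log k ^ 3 := by nlinarith [sq_nonneg (Real.log k)]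
    have h7 : k ^ (3 / 4 : ℝ) * k ^ (1 / 4 : ℝ) = k := by
      rw [← Real.rpow_add hk0]; norm_num
    calc (2 * Real.log k + 8) * (3 * k ^ (3 / 4 : ℝ)) * Z * Real.log k ^ 2 =
          ((2 * Real.log k + 8) * Real.log k ^ 2) * (3 * k ^ (3 / 4 : ℝ) * Z) := by ring
      _ ≤ (10 * (1728 * k ^ (1 / 4 : ℝ))) * (3 * k ^ (3 / 4 : ℝ) * Z) := by
          refine mul_le_mul_of_nonneg_right (h6.trans ?_) (by positivity)
          linarith
      _ = 51840 * Z * (k ^ (3 / 4 : ℝ) * k ^ (1 / 4 : ℝ)) := by ring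
      _ = _ := by rw [h7]
  have h4 := h k hk
  set S := ∑' n : ℕ, eulerWeight ε n * besselSlope (k / n) with hS
  set m := Real.log (Real.log k) + eulerConst ε + (constC - Real.log 2) / Real.log k with hm
  have h5 : ∑' n : ℕ, logMoment (ε * k) n - k * m = (∑' n : ℕ, logMoment (ε * k) n - k * S) + k * (S - m) := by ring
  rw [h5]
  refine (abs_add_le _ _).trans ?_
  rw [abs_mul, abs_of_pos hk0, add_mul]
  refine add_le_add (h1.trans h3) ?_
  calc k * |S - m| ≤ k * (C / Real.log k ^ 2) := by gcongr
    _ = _ := by ring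

end RandomEuler

/-! ### From the cumulant generating function to tail probabilities. -/

namespace TailBound

lemma half_sq_le_exp_mul_sub_one {y : ℝ} (hy : 0 ≤ y) : -1 + y ^ 2 / 2 ≤ Real.exp y * (y - 1) := by
  have hd : ∀ y, HasDerivAt (fun y => Real.exp y * (y - 1) - y ^ 2 / 2) (y * (Real.exp y - 1)) y := by
    intro y
    refine (((Real.hasDerivAt_exp y).mul ((hasDerivAt_id y).sub_const 1)).sub ((hasDerivAt_pow 2 y).div_const 2)).congr_deriv ?_
    simp only [id]
    norm_num
    ring
  have hm : MonotoneOn (fun y => Real.exp y * (y - 1) - y ^ 2 / 2) (Set.Ici 0) := by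
    refine monotoneOn_of_deriv_nonneg (convex_Ici 0) (fun x _ => (hd x).continuousAt.continuousWithinAt)
      (fun x _ => (hd x).differentiableAt.differentiableWithinAt) (fun x hx => ?_)
    rw [interior_Ici] at hx
    have h0 : 0 < x := hx
    rw [(hd x).deriv]
    exact mul_nonneg h0.le (sub_nonneg.2 (Real.one_le_exp h0.le))
  have := hm Set.self_mem_Ici hy hy
  norm_num at this
  linarith

/-- Two-sided bound for a tail probability from the moment generating function on `[K, eK]`. -/
lemma prob_nonneg_bounds {Ω : Type*} [MeasurableSpace Ω] {μ : Measure Ω} [IsProbabilityMeasure μ] {W : Ω → ℝ}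
    (hW : AEMeasurable W μ) {K r y : ℝ} (hK : 0 < K) (hr : 0 ≤ r)
    (hint : ∀ y, 0 ≤ y → y ≤ 1 → Integrable (fun ω => Real.exp (K * Real.exp y * W ω)) μ)
    (hM : ∀ y, 0 ≤ y → y ≤ 1 →
      |Real.log (∫ ω, Real.exp (K * Real.exp y * W ω) ∂μ) - K * (Real.exp y * (y - 1))| ≤ K * r)
    (hy : 0 < y) (hy1 : y ≤ 1 / 2) (hKy : 2 ≤ K * (y ^ 2 / 2 - 2 * r)) :
    Real.exp (-K * (1 + 7 * y)) ≤ μ.real {ω | 0 ≤ W ω} ∧ μ.real {ω | 0 ≤ W ω} ≤ Real.exp (-K * (1 - y)) := by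
  have hpos : ∀ y, 0 ≤ y → y ≤ 1 → 0 < ∫ ω, Real.exp (K * Real.exp y * W ω) ∂μ := fun y h0 h1 =>
    integral_exp_pos (hint y h0 h1)
  have hup : ∀ y, 0 ≤ y → y ≤ 1 → ∫ ω, Real.exp (K * Real.exp y * W ω) ∂μ ≤ Real.exp (K * (Real.exp y * (y - 1) + r)) := by
    intro y h0 h1
    rw [← Real.log_le_iff_le_exp (hpos y h0 h1)]
    linarith [(abs_le.1 (hM y h0 h1)).2]
  have hlo : ∀ y, 0 ≤ y → y ≤ 1 → Real.exp (K * (Real.exp y * (y - 1) - r)) ≤ ∫ ω, Real.exp (K * Real.exp y * W ω) ∂μ := by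
    intro y h0 h1
    rw [← Real.le_log_iff_exp_le (hpos y h0 h1)]
    linarith [(abs_le.1 (hM y h0 h1)).1]
  have hry : 2 * r ≤ y ^ 2 / 2 := by
    by_contra h
    push Not at h
    nlinarith
  have hns : NullMeasurableSet {ω | 0 ≤ W ω} μ := nullMeasurableSet_le aemeasurable_const hW
  have hconst : ∀ c : ℝ, ∫ ω, {ω | 0 ≤ W ω}.indicator (fun _ => c) ω ∂μ = μ.real {ω | 0 ≤ W ω} * c := fun c => by
    rw [integral_indicator₀ hns, setIntegral_const, smul_eq_mul]
  have hiconst : ∀ c : ℝ, Integrable ({ω | 0 ≤ W ω}.indicator (fun _ => c)) μ := fun c =>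
    (integrable_const c).indicator₀ hns
  constructor
  -- Lower bound: the derivative of K e^y (y-1) with respect to K e^y is y, so the tilted law at K
  -- e^y concentrates near W = y. The parts W < 0 and W > 2y are compared with the generating
  -- function at parameters 0 and 2y.
  · have hE : 0 < Real.exp y := Real.exp_pos y
    have hE1 : 1 + y ≤ Real.exp y := by linarith [Real.add_one_le_exp y]
    have hE2 : Real.exp y ≤ 1 + 2 * y := by
      have h := Real.abs_exp_sub_one_le (x := y) (by rw [abs_of_pos hy]; linarith)
      rw [abs_of_pos hy, abs_of_nonneg (by linarith)] at h
      linarith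
    have hEE : Real.exp (2 * y) = Real.exp y ^ 2 := by rw [← Real.exp_nat_mul]; norm_num
    have hquad := half_sq_le_exp_mul_sub_one hy.le
    -- pointwise decomposition
    have hpt : ∀ ω, Real.exp (K * Real.exp y * W ω) ≤ {ω | 0 ≤ W ω}.indicator (fun _ => Real.exp (K * Real.exp y * (2 * y))) ω +
        Real.exp (K * Real.exp 0 * W ω) +
        Real.exp (-K * ((Real.exp (2 * y) - Real.exp y) * (2 * y))) * Real.exp (K * Real.exp (2 * y) * W ω) := by
      intro ω
      have p1 := (Real.exp_pos (K * Real.exp 0 * W ω)).le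
      have p2 := (Real.exp_pos (K * Real.exp (2 * y) * W ω)).le
      have p3 := (Real.exp_pos (-K * ((Real.exp (2 * y) - Real.exp y) * (2 * y)))).le
      rcases lt_or_ge (W ω) 0 with h | h
      · have h1 : ω ∉ {ω | 0 ≤ W ω} := not_le.2 h
        rw [Set.indicator_of_notMem h1, zero_add]
        have h2 : Real.exp (K * Real.exp y * W ω) ≤ Real.exp (K * Real.exp 0 * W ω) := by
          rw [Real.exp_le_exp, Real.exp_zero]
          have : K * W ω < 0 := mul_neg_of_pos_of_neg hK h
          nlinarith
        have := mul_nonneg p3 p2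
        linarith
      · have h1 : ω ∈ {ω | 0 ≤ W ω} := h
        rw [Set.indicator_of_mem h1]
        rcases le_or_gt (W ω) (2 * y) with h3 | h3
        · have h2 : Real.exp (K * Real.exp y * W ω) ≤ Real.exp (K * Real.exp y * (2 * y)) := by gcongr
          have := mul_nonneg p3 p2
          linarith
        · have h2 : Real.exp (K * Real.exp y * W ω) ≤
              Real.exp (-K * ((Real.exp (2 * y) - Real.exp y) * (2 * y))) * Real.exp (K * Real.exp (2 * y) * W ω) := by
            rw [← Real.exp_add, Real.exp_le_exp]
            have h4 : 0 ≤ K * (Real.exp (2 * y) - Real.exp y) :=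
              mul_nonneg hK.le (sub_nonneg.2 (Real.exp_le_exp.2 (by linarith)))
            nlinarith
          have := Real.exp_pos (K * Real.exp y * (2 * y))
          linarith
    have hi0 := hint 0 le_rfl zero_le_one
    have hi2 := (hint (2 * y) (by linarith) (by linarith)).const_mul (Real.exp (-K * ((Real.exp (2 * y) - Real.exp y) * (2 * y))))
    have hmono := integral_mono (hint y hy.le (by linarith))
      (((hiconst (Real.exp (K * Real.exp y * (2 * y)))).add hi0).add hi2) hpt
    simp only [Pi.add_apply] at hmono
    have hi3 : Integrable (fun ω => {ω | 0 ≤ W ω}.indicator (fun _ => Real.exp (K * Real.exp y * (2 * y))) ω +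
        Real.exp (K * Real.exp 0 * W ω)) μ := (hiconst _).add hi0
    rw [integral_add hi3 hi2, integral_add (hiconst _) hi0, hconst, integral_const_mul] at hmono
    set M := ∫ ω, Real.exp (K * Real.exp y * W ω) ∂μ with hMdef
    have hMlo := hlo y hy.le (by linarith)
    -- Each of the two outer parts will be at most e^{-2} ≤ 1/4 of the whole, so at least half
    -- remains in the middle.
    have hbad : Real.exp (-2) * 4 ≤ 1 := by
      have h9 : Real.exp (-2) * (Real.exp 1 * Real.exp 1) = 1 := by
        rw [← Real.exp_add, ← Real.exp_add]; norm_num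
      have := Real.exp_one_gt_d9
      have := Real.exp_pos (-2)
      have h10 : 4 ≤ Real.exp 1 * Real.exp 1 := by nlinarith
      nlinarith
    have hneg : ∫ ω, Real.exp (K * Real.exp 0 * W ω) ∂μ ≤ M * Real.exp (-2) := by
      calc _ ≤ Real.exp (K * (Real.exp 0 * (0 - 1) + r)) := hup 0 le_rfl zero_le_one
        _ ≤ Real.exp (K * (Real.exp y * (y - 1) - r)) * Real.exp (-2) := by
          rw [← Real.exp_add, Real.exp_le_exp, Real.exp_zero]
          nlinarith
        _ ≤ _ := by gcongr
    have hbig : Real.exp (-K * ((Real.exp (2 * y) - Real.exp y) * (2 * y))) * ∫ ω, Real.exp (K * Real.exp (2 * y) * W ω) ∂μ ≤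
        M * Real.exp (-2) := by
      calc _ ≤ Real.exp (-K * ((Real.exp (2 * y) - Real.exp y) * (2 * y))) * Real.exp (K * (Real.exp (2 * y) * (2 * y - 1) + r)) := by
            gcongr
            exact hup (2 * y) (by linarith) (by linarith)
        _ ≤ Real.exp (K * (Real.exp y * (y - 1) - r)) * Real.exp (-2) := by
          rw [← Real.exp_add, ← Real.exp_add, Real.exp_le_exp]
          -- The exponent for the right-hand part is e^{2y}(2y-1) - 2y(e^{2y} - e^y), which falls
          -- short of e^y(y-1) by exactly e^y(e^y - y - 1).
          have h1 : y ^ 2 / 2 ≤ Real.exp y * (Real.exp y - y - 1) := by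
            have h2 := Real.quadratic_le_exp_of_nonneg hy.le
            nlinarith
          have h3 : K * (y ^ 2 / 2) ≤ K * (Real.exp y * (Real.exp y - y - 1)) := by gcongr
          rw [hEE]
          nlinarith
        _ ≤ _ := by gcongr
    have hMpos : 0 < M := hpos y hy.le (by linarith)
    have hhalf : M / 2 ≤ μ.real {ω | 0 ≤ W ω} * Real.exp (K * Real.exp y * (2 * y)) := by nlinarith
    have hfin : Real.exp (-K * (1 + 7 * y)) * Real.exp (K * Real.exp y * (2 * y)) ≤ M / 2 := by
      rw [← Real.exp_add]
      have h1 : Real.exp (-K * (1 + 7 * y) + K * Real.exp y * (2 * y)) ≤ Real.exp (K * (Real.exp y * (y - 1) - r)) * Real.exp (-2) := by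
        rw [← Real.exp_add, Real.exp_le_exp]
        -- Moving the factor for W ≤ 2y to the other side changes the exponent e^y(y-1) to -e^y(1+y)
        -- ≥ -(1+5y). The errors take at most another 2y, which accounts for the 7.
        have h2 : Real.exp y * (1 + y) ≤ 1 + 5 * y := by nlinarith
        have h3 : r + y ^ 2 / 2 ≤ 2 * y := by nlinarith
        have h4 : K * (Real.exp y * (1 + y) + r + y ^ 2 / 2) ≤ K * (1 + 7 * y) :=
          mul_le_mul_of_nonneg_left (by linarith) hK.le
        have h5 : 0 ≤ K * r := by positivity
        nlinarith
      have h2 := mul_le_mul_of_nonneg_right hMlo (Real.exp_pos (-2)).le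
      nlinarith
    exact le_of_mul_le_mul_right (hfin.trans hhalf) (Real.exp_pos _)
  · have hi0 := hint 0 le_rfl zero_le_one
    have h1 : μ.real {ω | 0 ≤ W ω} * 1 ≤ ∫ ω, Real.exp (K * Real.exp 0 * W ω) ∂μ := by
      rw [← hconst]
      refine integral_mono (hiconst 1) hi0 fun ω => ?_
      rcases lt_or_ge (W ω) 0 with h | h
      · have h1 : ω ∉ {ω | 0 ≤ W ω} := not_le.2 h
        simp only [Set.indicator_of_notMem h1]
        exact (Real.exp_pos _).le
      · have h1 : ω ∈ {ω | 0 ≤ W ω} := h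
        simp only [Set.indicator_of_mem h1]
        exact Real.one_le_exp (by positivity)
    have h2 := hup 0 le_rfl zero_le_one
    rw [mul_one] at h1
    refine (h1.trans h2).trans ?_
    rw [Real.exp_le_exp, Real.exp_zero]
    have : r ≤ y := by nlinarith
    nlinarith

/-- Expansion of the cumulant generating function around the saddle point. -/
lemma saddle_expansion (b : ℝ) {C : ℝ} (hC : 0 ≤ C) :
    ∃ C₁ τ₁ : ℝ, 0 < C₁ ∧ 1 ≤ τ₁ ∧ ∀ τ y : ℝ, τ₁ ≤ τ → 0 ≤ y → y ≤ 1 →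
      Real.exp 2 ≤ Real.exp (τ - b - 1 + y) ∧
      ∀ M : ℝ, |M - Real.exp (τ - b - 1 + y) * (Real.log (τ - b - 1 + y) + b / (τ - b - 1 + y))| ≤
          C * (Real.exp (τ - b - 1 + y) / (τ - b - 1 + y) ^ 2) →
        |M - Real.exp (τ - b - 1 + y) * Real.log τ - Real.exp (τ - b - 1) / τ * (Real.exp y * (y - 1))| ≤
          Real.exp (τ - b - 1) / τ * (C₁ / τ) := by
  set B := |b| + 2 with hB
  have hB2 : 2 ≤ B := by linarith [abs_nonneg b]
  refine ⟨3 * (4 * B ^ 2 + 4 * C), 2 * B + 4, by positivity, by linarith, fun τ y hτ hy hy1 => ?_⟩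
  -- Since log k = τ + c, the expression log(log k) + b/log k expands as log τ + (c+b)/τ +
  -- O(τ^{-2}), and c + b = y - 1 no longer involves b.
  set c := y - b - 1 with hc
  have hτ0 : 0 < τ := by linarith
  have hcB : |c| ≤ B := by
    rw [abs_le]; constructor <;> linarith [le_abs_self b, neg_abs_le b]
  have hl : τ - b - 1 + y = τ + c := by rw [hc]; ring
  have hcb := abs_le.1 hcB
  have hl2 : τ / 2 ≤ τ + c := by linarith
  rw [hl]
  refine ⟨Real.exp_le_exp.2 (by linarith), fun M hM => ?_⟩
  have hE : Real.exp (τ + c) = Real.exp (τ - b - 1) * Real.exp y := by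
    rw [← Real.exp_add]; congr 1; rw [hc]; ring
  have hx : |c / τ| ≤ 1 / 2 := by
    rw [abs_div, abs_of_pos hτ0, div_le_iff₀ hτ0]; linarith
  have hlog : |Real.log (τ + c) - Real.log τ - c / τ| ≤ 2 * (B / τ) ^ 2 := by
    have h3 := Real.abs_log_sub_add_sum_range_le (x := -(c / τ)) (by rw [abs_neg]; linarith) 1
    simp only [Finset.sum_range_one, zero_add, pow_one, Nat.cast_zero, div_one, Nat.reduceAdd, abs_neg] at h3
    have h4 : |c / τ| ^ 2 / (1 - |c / τ|) ≤ 2 * |c / τ| ^ 2 := by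
      rw [div_le_iff₀ (by linarith)]
      nlinarith [sq_nonneg |c / τ|]
    have h5 : Real.log (τ + c) = Real.log τ + Real.log (1 - -(c / τ)) := by
      rw [← Real.log_mul (by linarith) (by linarith [(abs_le.1 hx).1])]
      congr 1
      field_simp
      ring
    have h6 : Real.log (τ + c) - Real.log τ - c / τ = -(c / τ) + Real.log (1 - -(c / τ)) := by
      rw [h5]; ring
    rw [h6]
    refine (h3.trans h4).trans ?_
    rw [abs_div, abs_of_pos hτ0]
    gcongr
  have hbl : |b / (τ + c) - b / τ| ≤ 2 * (B / τ) ^ 2 := by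
    have h1 : b / (τ + c) - b / τ = -(b * c) / ((τ + c) * τ) := by
      have : τ + c ≠ 0 := by linarith
      field_simp
      ring
    rw [h1, abs_div, abs_neg, abs_mul, abs_of_pos (show 0 < (τ + c) * τ by nlinarith), div_le_iff₀ (by nlinarith)]
    calc |b| * |c| ≤ B * B := by gcongr; linarith
      _ = 2 * (B / τ) ^ 2 * ((τ / 2) * τ) := by field_simp
      _ ≤ _ := by gcongr
  have hsum : |Real.log (τ + c) + b / (τ + c) - Real.log τ - (y - 1) / τ| ≤ 4 * B ^ 2 / τ ^ 2 := by
    have h1 : Real.log (τ + c) + b / (τ + c) - Real.log τ - (y - 1) / τ =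
        (Real.log (τ + c) - Real.log τ - c / τ) + (b / (τ + c) - b / τ) := by
      rw [hc]; field_simp; ring
    rw [h1]
    refine ((abs_add_le _ _).trans (add_le_add hlog hbl)).trans_eq ?_
    rw [div_pow]; ring
  have hCl : C * (Real.exp (τ + c) / (τ + c) ^ 2) ≤ Real.exp (τ + c) * (4 * C / τ ^ 2) := by
    have h1 : 1 / (τ + c) ^ 2 ≤ 4 / τ ^ 2 := by
      rw [div_le_div_iff₀ (by nlinarith) (by positivity)]
      nlinarith
    calc C * (Real.exp (τ + c) / (τ + c) ^ 2) = Real.exp (τ + c) * C * (1 / (τ + c) ^ 2) := by ring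
      _ ≤ Real.exp (τ + c) * C * (4 / τ ^ 2) := by gcongr
      _ = _ := by ring
  have hy3 : Real.exp y ≤ 3 := by
    have := Real.exp_le_exp.2 hy1
    linarith [Real.exp_one_lt_d9]
  have hsplit : M - Real.exp (τ + c) * Real.log τ - Real.exp (τ - b - 1) / τ * (Real.exp y * (y - 1)) =
      (M - Real.exp (τ + c) * (Real.log (τ + c) + b / (τ + c))) +
      Real.exp (τ + c) * (Real.log (τ + c) + b / (τ + c) - Real.log τ - (y - 1) / τ) := by
    rw [hE]; field_simp; ring
  rw [hsplit]
  calc _ ≤ Real.exp (τ + c) * (4 * C / τ ^ 2) + Real.exp (τ + c) * (4 * B ^ 2 / τ ^ 2) := by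
        refine (abs_add_le _ _).trans (add_le_add (hM.trans hCl) ?_)
        rw [abs_mul, abs_of_pos (Real.exp_pos _)]
        gcongr
    _ = Real.exp (τ - b - 1) * Real.exp y * ((4 * B ^ 2 + 4 * C) / τ ^ 2) := by rw [hE]; ring
    _ ≤ Real.exp (τ - b - 1) * 3 * ((4 * B ^ 2 + 4 * C) / τ ^ 2) := by gcongr
    _ = _ := by field_simp

end TailBound

namespace TailBound

lemma eq_exp_of_bounds {P K lo hi : ℝ} (hP : 0 < P) (hK : 0 < K) (h1 : Real.exp (-K * (1 + hi)) ≤ P)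
    (h2 : P ≤ Real.exp (-K * (1 - lo))) :
    ∃ E : ℝ, -lo ≤ E ∧ E ≤ hi ∧ P = Real.exp (-K * (1 + E)) := by
  rw [← Real.le_log_iff_exp_le hP] at h1
  rw [← Real.log_le_iff_le_exp hP] at h2
  refine ⟨-Real.log P / K - 1, ?_, ?_, ?_⟩
  · rw [le_sub_iff_add_le, le_div_iff₀ hK]; linarith
  · rw [sub_le_iff_le_add, div_le_iff₀ hK]; linarith
  · have : -K * (1 + (-Real.log P / K - 1)) = Real.log P := by field_simp; ring
    rw [this, Real.exp_log hP]

/-- Tail asymptotics from the asymptotic expansion of the cumulant generating function. -/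
theorem exists_tail_asymptotic (a b : ℝ) {C : ℝ} (hC : 0 ≤ C) :
    ∃ A : ℝ, 0 < A ∧ ∀ (Ω : Type*) [MeasurableSpace Ω] (μ : Measure Ω) [IsProbabilityMeasure μ] (Y : Ω → ℝ),
      AEMeasurable Y μ → (∀ k, Real.exp 2 ≤ k → Integrable (fun ω => Real.exp (k * Y ω)) μ) →
      (∀ k, Real.exp 2 ≤ k → |Real.log (∫ ω, Real.exp (k * Y ω) ∂μ) -
        k * (Real.log (Real.log k) + a + b / Real.log k)| ≤ C * (k / Real.log k ^ 2)) →
      ∀ τ : ℝ, 1 ≤ τ → ∃ E : ℝ, |E| ≤ A / √τ ∧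
        μ.real {ω | a + Real.log τ ≤ Y ω} = Real.exp (-(Real.exp (τ - b - 1) / τ) * (1 + E)) := by
  obtain ⟨C₁, τ₁, hC₁, hτ₁, hsad⟩ := saddle_expansion b hC
  -- With y = B/√τ and r = C₁/τ this makes y²/2 - 2r equal to 1/τ, and K/τ ≥ 2 then holds once
  -- e^{τ-b-1} ≥ 2τ².
  set B := √(4 * C₁ + 2) with hB
  have hB2 : B ^ 2 = 4 * C₁ + 2 := Real.sq_sqrt (by positivity)
  have hB0 : 0 < B := Real.sqrt_pos.2 (by positivity)
  obtain ⟨T, hT⟩ : ∃ T : ℝ, ∀ τ, T ≤ τ → 2 * τ ^ 2 ≤ Real.exp (τ - b - 1) := by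
    have h := (Real.tendsto_exp_div_pow_atTop 2).eventually_ge_atTop (2 * Real.exp (b + 1))
    obtain ⟨T, hT⟩ := (h.and (eventually_gt_atTop 0)).exists_forall_of_atTop
    refine ⟨T, fun τ hτ => ?_⟩
    obtain ⟨h1, h2⟩ := hT τ hτ
    rw [le_div_iff₀ (by positivity)] at h1
    have h3 : Real.exp (τ - b - 1) * Real.exp (b + 1) = Real.exp τ := by
      rw [← Real.exp_add]; congr 1; ring
    rw [← h3] at h1
    have := Real.exp_pos (b + 1)
    nlinarith
  -- The term 4B² ensures B/√τ ≤ 1/2.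
  set τ₀ := max (max τ₁ T) (4 * B ^ 2) with hτ₀
  have h01 : τ₁ ≤ τ₀ := (le_max_left _ _).trans (le_max_left _ _)
  have h0T : T ≤ τ₀ := (le_max_right _ _).trans (le_max_left _ _)
  have h0B : 4 * B ^ 2 ≤ τ₀ := le_max_right _ _
  have hτ₀1 : 1 ≤ τ₀ := hτ₁.trans h01
  -- The values Q and κ handle 1 ≤ τ < τ₀. They depend only on b and C, so the final constant is
  -- chosen before the probability space.
  set Q := Real.exp (τ₀ - b - 1) / τ₀ * (1 + 7 * (B / √τ₀)) with hQ
  have hQ0 : 0 < Q := by positivity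
  set κ := Real.exp (-b) / τ₀ with hκ
  have hκ0 : 0 < κ := by positivity
  refine ⟨7 * B + (Q / κ + 1) * √τ₀, by positivity, fun Ω _ μ _ Y hY hint hM => ?_⟩
  have large : ∀ τ, τ₀ ≤ τ →
      Real.exp (-(Real.exp (τ - b - 1) / τ) * (1 + 7 * (B / √τ))) ≤ μ.real {ω | a + Real.log τ ≤ Y ω} ∧
      μ.real {ω | a + Real.log τ ≤ Y ω} ≤ Real.exp (-(Real.exp (τ - b - 1) / τ) * (1 - B / √τ)) := by
    intro τ hτ
    have hτ0 : 0 < τ := by linarith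
    have hs0 : 0 < √τ := Real.sqrt_pos.2 hτ0
    -- The factor τ cancels the denominator of K: then K e^y W is exactly k(Y - a - log τ) with k =
    -- e^{τ-b-1+y}.
    have hset : {ω | a + Real.log τ ≤ Y ω} = {ω | 0 ≤ (Y ω - a - Real.log τ) * τ} := by
      ext ω
      simp only [Set.mem_ofPred_eq]
      rw [mul_nonneg_iff_of_pos_right hτ0]
      constructor <;> intro h <;> linarith
    rw [hset]
    have hexp : ∀ y ω, Real.exp (Real.exp (τ - b - 1) / τ * Real.exp y * ((Y ω - a - Real.log τ) * τ)) =
        Real.exp (Real.exp (τ - b - 1 + y) * (-a - Real.log τ)) * Real.exp (Real.exp (τ - b - 1 + y) * Y ω) := by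
      intro y ω
      rw [← Real.exp_add, Real.exp_add (τ - b - 1) y]
      congr 1
      field_simp
      ring
    have hysq : (B / √τ) ^ 2 = B ^ 2 / τ := by rw [div_pow, Real.sq_sqrt hτ0.le]
    refine prob_nonneg_bounds (r := C₁ / τ) ?_ (by positivity) (by positivity) ?_ ?_ (by positivity) ?_ ?_
    · exact ((hY.sub_const _).sub_const _).mul_const _
    · intro y h0 h1
      simp_rw [hexp]
      exact (hint _ (hsad τ y (h01.trans hτ) h0 h1).1).const_mul _
    · intro y h0 h1
      obtain ⟨hk, hs⟩ := hsad τ y (h01.trans hτ) h0 h1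
      have hk2 := hM _ hk
      have hpos : 0 < ∫ ω, Real.exp (Real.exp (τ - b - 1 + y) * Y ω) ∂μ := integral_exp_pos (hint _ hk)
      simp_rw [hexp]
      rw [integral_const_mul, Real.log_mul (Real.exp_pos _).ne' hpos.ne', Real.log_exp]
      rw [Real.log_exp] at hk2
      have h2 := hs (Real.log (∫ ω, Real.exp (Real.exp (τ - b - 1 + y) * Y ω) ∂μ) - Real.exp (τ - b - 1 + y) * a) (by
        refine le_trans (le_of_eq ?_) hk2
        congr 1
        ring)
      refine le_trans (le_of_eq ?_) h2
      congr 1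
      ring
    · rw [div_le_iff₀ hs0]
      have : 2 * B ≤ √τ := Real.le_sqrt_of_sq_le (by nlinarith)
      linarith
    · rw [hysq, hB2]
      have h1 := hT τ (h0T.trans hτ)
      have h2 : (4 * C₁ + 2) / τ / 2 - 2 * (C₁ / τ) = 1 / τ := by field_simp; ring
      rw [h2, div_mul_div_comm, mul_one, le_div_iff₀ (by positivity)]
      nlinarith
  intro τ hτ
  have hτ0 : 0 < τ := by linarith
  have hs0 : 0 < √τ := Real.sqrt_pos.2 hτ0
  have hK : 0 < Real.exp (τ - b - 1) / τ := by positivity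
  rcases le_or_gt τ₀ τ with h | h
  · obtain ⟨h1, h2⟩ := large τ h
    obtain ⟨E, hE1, hE2, hE3⟩ := eq_exp_of_bounds ((Real.exp_pos _).trans_le h1) hK h1 h2
    refine ⟨E, ?_, hE3⟩
    have h3 : 0 < B / √τ := by positivity
    have h4 : |E| ≤ 7 * (B / √τ) := abs_le.2 ⟨by linarith, hE2⟩
    refine h4.trans ?_
    rw [← mul_div_assoc]
    gcongr
    have : 0 ≤ (Q / κ + 1) * √τ₀ := by positivity
    linarith
  -- For small τ the event contains the one at τ₀, so its probability is at least e^{-Q}. With the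
  -- trivial upper bound 1 this bounds E on both sides, and √τ₀ in the constant pays for the factor
  -- 1/√τ.
  · have h1 : Real.exp (-Q) ≤ μ.real {ω | a + Real.log τ ≤ Y ω} := by
      have h2 := (large τ₀ le_rfl).1
      rw [neg_mul, ← hQ] at h2
      refine h2.trans (measureReal_mono fun ω hω => ?_)
      have h3 := Real.log_le_log hτ0 h.le
      have h4 : a + Real.log τ₀ ≤ Y ω := hω
      exact (add_le_add_right h3 a).trans h4
    have hκK : κ ≤ Real.exp (τ - b - 1) / τ := by
      rw [hκ]
      gcongr
      linarith
    have h2 : Real.exp (-(Real.exp (τ - b - 1) / τ) * (1 + Q / κ)) ≤ μ.real {ω | a + Real.log τ ≤ Y ω} := by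
      refine le_trans (Real.exp_le_exp.2 ?_) h1
      have h3 : Q ≤ Real.exp (τ - b - 1) / τ * (Q / κ) := by
        rw [← mul_div_assoc, le_div_iff₀ hκ0]
        nlinarith
      linarith
    have h3 : μ.real {ω | a + Real.log τ ≤ Y ω} ≤ Real.exp (-(Real.exp (τ - b - 1) / τ) * (1 - 1)) := by
      rw [sub_self, mul_zero, Real.exp_zero]
      exact measureReal_le_one
    obtain ⟨E, hE1, hE2, hE3⟩ := eq_exp_of_bounds ((Real.exp_pos _).trans_le h2) hK h2 h3
    refine ⟨E, ?_, hE3⟩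
    have h5 : 0 < Q / κ := by positivity
    have h4 : |E| ≤ Q / κ + 1 := abs_le.2 ⟨by linarith, by linarith⟩
    refine h4.trans ?_
    rw [le_div_iff₀ hs0]
    have h6 : √τ ≤ √τ₀ := Real.sqrt_le_sqrt h.le
    nlinarith

end TailBound

/-! ### Convergence of series of independent variables. -/

namespace RandomSeries

variable {Ω : Type*} [mΩ : MeasurableSpace Ω] {μ : Measure Ω} [IsProbabilityMeasure μ]

/-- The partial sums form a martingale. Orthogonality bounds them in L², hence in L¹, and Doob's
convergence theorem applies. -/
lemma ae_exists_tendsto_sum_of_stronglyMeasurable {V : ℕ → Ω → ℝ} (hm : ∀ j, StronglyMeasurable (V j))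
    (hi : iIndepFun V μ) (h2 : ∀ j, MemLp (V j) 2 μ) (h0 : ∀ j, ∫ ω, V j ω ∂μ = 0)
    (hs : Summable fun j => ∫ ω, V j ω ^ 2 ∂μ) :
    ∀ᵐ ω ∂μ, ∃ c, Tendsto (fun n => ∑ j ∈ Finset.range n, V j ω) atTop (𝓝 c) := by
  set ℱ := Filtration.natural V hm with hℱ
  -- The sum includes index n, in step with the natural filtration, which at time n knows V 0, …, V
  -- n.
  set S : ℕ → Ω → ℝ := fun n => ∑ j ∈ Finset.range (n + 1), V j with hS
  have hint : ∀ j, Integrable (V j) μ := fun j => (h2 j).integrable one_le_two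
  have hadp : StronglyAdapted ℱ S := by
    intro n
    refine Finset.stronglyMeasurable_sum _ fun j hj => ?_
    exact ((Filtration.stronglyAdapted_natural hm) j).mono (ℱ.mono (Nat.lt_succ_iff.1 (Finset.mem_range.1 hj)))
  have hSint : ∀ n, Integrable (S n) μ := fun n => integrable_finsetSum' _ fun j _ => hint j
  have hsub : Submartingale S ℱ μ := by
    refine submartingale_of_condExp_sub_nonneg_nat hadp hSint fun n => ?_
    have h1 : S (n + 1) - S n = V (n + 1) := by
      simp only [hS]
      rw [Finset.sum_range_succ V (n + 1), add_sub_cancel_left]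
    rw [h1]
    have h3 := hi.condExp_natural_ae_eq_of_lt hm (Nat.lt_succ_self n)
    filter_upwards [h3] with ω hω
    rw [hω, h0]
    exact le_rfl
  set R := ∑' j, ∫ ω, V j ω ^ 2 ∂μ with hR
  have hsq : ∀ n, ∫ ω, S n ω ^ 2 ∂μ ≤ R := by
    intro n
    have hS0 : ∫ ω, S n ω ∂μ = 0 := by
      simp only [hS, Finset.sum_apply]
      rw [integral_finsetSum _ fun j _ => hint j]
      simp [h0]
    have h3 := IndepFun.variance_sum (μ := μ) (X := V) (s := Finset.range (n + 1)) (fun j _ => h2 j)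
      (fun i _ j _ hij => hi.indepFun hij)
    have hSL : MemLp (S n) 2 μ := memLp_finsetSum' _ fun j _ => h2 j
    rw [variance_eq_sub hSL, hS0] at h3
    have h4 : ∀ j, variance (V j) μ = ∫ ω, V j ω ^ 2 ∂μ := fun j => by
      rw [variance_eq_sub (h2 j), h0]; simp
    simp_rw [h4] at h3
    have h5 : ∫ ω, S n ω ^ 2 ∂μ = ∑ j ∈ Finset.range (n + 1), ∫ ω, V j ω ^ 2 ∂μ := by
      rw [← h3]; simp
    rw [h5]
    exact hs.sum_le_tsum _ fun j _ => integral_nonneg fun ω => sq_nonneg _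
  have hbdd : ∀ n, eLpNorm (S n) 1 μ ≤ ((1 + R).toNNReal : ENNReal) := by
    intro n
    have hSL : MemLp (S n) 2 μ := memLp_finsetSum' _ fun j _ => h2 j
    rw [eLpNorm_one_eq_lintegral_enorm, ← ofReal_integral_norm_eq_lintegral_enorm (hSint n)]
    refine ENNReal.ofReal_le_ofReal ?_
    calc ∫ ω, ‖S n ω‖ ∂μ ≤ ∫ ω, (1 + S n ω ^ 2) ∂μ := by
          refine integral_mono (hSint n).norm ((integrable_const 1).add hSL.integrable_sq) fun ω => ?_
          simp only [Real.norm_eq_abs]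
          nlinarith [sq_abs (S n ω), sq_nonneg (|S n ω| - 1), abs_nonneg (S n ω)]
      _ = 1 + ∫ ω, S n ω ^ 2 ∂μ := by
          rw [integral_add (integrable_const 1) hSL.integrable_sq]; simp
      _ ≤ 1 + R := by linarith [hsq n]
  filter_upwards [hsub.exists_ae_tendsto_of_bdd hbdd] with ω ⟨c, hc⟩
  refine ⟨c, (tendsto_add_atTop_iff_nat 1).1 (hc.congr fun n => ?_)⟩
  simp [hS]

/-- Almost sure convergence of a series of independent centred random variables with summable variances. -/
theorem ae_exists_tendsto_sum {V : ℕ → Ω → ℝ} (hi : iIndepFun V μ) (h2 : ∀ j, MemLp (V j) 2 μ)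
    (h0 : ∀ j, ∫ ω, V j ω ∂μ = 0) (hs : Summable fun j => ∫ ω, V j ω ^ 2 ∂μ) :
    ∀ᵐ ω ∂μ, ∃ c, Tendsto (fun n => ∑ j ∈ Finset.range n, V j ω) atTop (𝓝 c) := by
  set V' : ℕ → Ω → ℝ := fun j => (h2 j).1.mk (V j) with hV'
  have hae : ∀ j, V j =ᵐ[μ] V' j := fun j => (h2 j).1.ae_eq_mk
  have h := ae_exists_tendsto_sum_of_stronglyMeasurable (V := V') (μ := μ) (fun j => (h2 j).1.stronglyMeasurable_mk)
    (hi.congr hae) (fun j => (h2 j).ae_eq (hae j)) (fun j => by rw [← h0 j]; exact integral_congr_ae (hae j).symm)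
    (hs.congr fun j => integral_congr_ae ((hae j).fun_comp fun x => x ^ 2))
  filter_upwards [h, ae_all_iff.2 hae] with ω ⟨c, hc⟩ hω
  exact ⟨c, by simpa only [hω] using hc⟩

end RandomSeries

/-! ### Almost sure convergence of the Euler product. -/

namespace RandomEuler

/-- The primes in increasing order. -/
noncomputable def nthPrime (j : ℕ) : Nat.Primes := ⟨Nat.nth Nat.Prime j, Nat.prime_nth_prime j⟩

lemma nthPrime_injective : Function.Injective nthPrime := fun _ _ h =>
  (Nat.nth_strictMono Nat.infinite_setOfPred_prime).injective (congrArg Subtype.val h)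

lemma prod_range_prime_eq {M : Type*} [CommMonoid M] (h : Nat.Primes → M) (N : ℕ) :
    ∏ n ∈ Finset.range N, (if hn : n.Prime then h ⟨n, hn⟩ else 1) =
      ∏ j ∈ Finset.range (Nat.count Nat.Prime N), h (nthPrime j) := by
  induction N with
  | zero => simp
  | succ N ih =>
    rw [Finset.prod_range_succ, ih, Nat.count_succ]
    split_ifs with hN
    · rw [Finset.prod_range_succ]
      congr 2
      exact Subtype.ext (Nat.nth_count hN).symm
    · simp

section
variable {Ω : Type*} [mΩ : MeasurableSpace Ω] {μ : Measure Ω} {X : Nat.Primes → Ω → ℂ}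

lemma IsSteinhaus.ae_norm_eq_one (hX : IsSteinhaus μ X) : ∀ᵐ ω ∂μ, ∀ p, ‖X p ω‖ = 1 := by
  rw [ae_all_iff]
  intro p
  exact ((hX.hasLaw p).ae_iff (p := fun x : ℂ => ‖x‖ = 1)
    (measurableSet_setOfPred.1 (measurableSet_eq_fun (by fun_prop) (by fun_prop)))).2 RandomEuler.ae_norm_eq_one

lemma summable_one_div_nthPrime_sq : Summable fun j => 1 / ((nthPrime j : ℕ) : ℝ) ^ 2 :=
  (Real.summable_one_div_nat_pow.2 one_lt_two).comp_injective
    (Subtype.val_injective.comp nthPrime_injective)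

lemma integral_im_unifCircle : ∫ x, x.im ∂unifCircle = 0 := by
  have h := integral_pow_mul_conj_pow 1 0
  simp only [pow_one, pow_zero, mul_one, one_ne_zero, if_false] at h
  have hi : Integrable (fun x : ℂ => x) unifCircle := by
    refine Integrable.of_bound (C := 1) (by fun_prop) ?_
    filter_upwards [RandomEuler.ae_norm_eq_one] with x hx using hx.le
  have h2 := integral_im hi
  rw [h] at h2
  simpa using h2

/-- Used with f = Re and f = Im: the terms are centred with variance at most 1/p². -/
lemma IsSteinhaus.ae_exists_tendsto_sum_comp [IsProbabilityMeasure μ] (hX : IsSteinhaus μ X) {f : ℂ → ℝ} (hf : Measurable f)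
    (hf1 : ∀ x, |f x| ≤ ‖x‖) (hf0 : ∫ x, f x ∂unifCircle = 0) :
    ∀ᵐ ω ∂μ, ∃ c, Tendsto (fun n => ∑ j ∈ Finset.range n, f (X (nthPrime j) ω) / ((nthPrime j : ℕ) : ℝ)) atTop (𝓝 c) := by
  have hmeas : ∀ j, AEStronglyMeasurable (fun ω => f (X (nthPrime j) ω) / ((nthPrime j : ℕ) : ℝ)) μ := fun j =>
    ((hf.comp_aemeasurable (hX.hasLaw _).aemeasurable).div_const _).aestronglyMeasurable
  have hb : ∀ j, ∀ᵐ ω ∂μ, ‖f (X (nthPrime j) ω) / ((nthPrime j : ℕ) : ℝ)‖ ≤ 1 / ((nthPrime j : ℕ) : ℝ) := by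
    intro j
    filter_upwards [hX.ae_norm_eq_one] with ω hω
    rw [norm_div, Real.norm_natCast, Real.norm_eq_abs]
    gcongr
    exact (hf1 _).trans (hω _).le
  have h2 : ∀ j, MemLp (fun ω => f (X (nthPrime j) ω) / ((nthPrime j : ℕ) : ℝ)) 2 μ := fun j => MemLp.of_bound (hmeas j) _ (hb j)
  refine RandomSeries.ae_exists_tendsto_sum ?_ h2 (fun j => ?_) ?_
  · exact (hX.indep.precomp nthPrime_injective).comp (fun j x => f x / ((nthPrime j : ℕ) : ℝ)) fun j => hf.div_const _
  · rw [integral_div]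
    have h3 := (hX.hasLaw (nthPrime j)).integral_comp (f := f) hf.aestronglyMeasurable
    have h4 : ∫ ω, f (X (nthPrime j) ω) ∂μ = 0 := by rw [← hf0, ← h3]; rfl
    rw [h4, zero_div]
  · refine Summable.of_nonneg_of_le (fun j => integral_nonneg fun ω => sq_nonneg _) (fun j => ?_) summable_one_div_nthPrime_sq
    calc ∫ ω, (f (X (nthPrime j) ω) / ((nthPrime j : ℕ) : ℝ)) ^ 2 ∂μ ≤ ∫ ω, 1 / ((nthPrime j : ℕ) : ℝ) ^ 2 ∂μ := by
          refine integral_mono_ae (h2 j).integrable_sq (integrable_const _) ?_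
          filter_upwards [hb j] with ω hω
          rw [Real.norm_eq_abs] at hω
          rw [← sq_abs, ← one_div_pow]
          gcongr
      _ = _ := by simp

lemma IsSteinhaus.ae_exists_tendsto_sum_div [IsProbabilityMeasure μ] (hX : IsSteinhaus μ X) :
    ∀ᵐ ω ∂μ, ∃ c : ℂ, Tendsto (fun n => ∑ j ∈ Finset.range n, X (nthPrime j) ω / ((nthPrime j : ℕ) : ℂ)) atTop (𝓝 c) := by
  filter_upwards [hX.ae_exists_tendsto_sum_comp Complex.measurable_re Complex.abs_re_le_norm integral_re_unifCircle,
    hX.ae_exists_tendsto_sum_comp Complex.measurable_im Complex.abs_im_le_norm integral_im_unifCircle] with ω ⟨a, ha⟩ ⟨b, hb⟩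
  refine ⟨(a : ℂ) + b * Complex.I, ?_⟩
  have h1 := ((Complex.continuous_ofReal.tendsto a).comp ha).add
    (((Complex.continuous_ofReal.tendsto b).comp hb).mul_const Complex.I)
  refine h1.congr fun n => ?_
  simp only [Function.comp_apply]
  push_cast
  rw [Finset.sum_mul, ← Finset.sum_add_distrib]
  refine Finset.sum_congr rfl fun j _ => ?_
  nth_rw 3 [← Complex.re_add_im (X (nthPrime j) ω)]
  ring

/-- The partial products converge almost surely to a non-zero limit. -/
theorem IsSteinhaus.ae_tendsto_L1 [IsProbabilityMeasure μ] (hX : IsSteinhaus μ X) :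
    ∀ᵐ ω ∂μ, Tendsto (fun N : ℕ => partialProd X N ω) atTop (𝓝 (L1 X ω)) ∧ L1 X ω ≠ 0 := by
  filter_upwards [hX.ae_exists_tendsto_sum_div, hX.ae_norm_eq_one] with ω ⟨c, hc⟩ h1
  set w : ℕ → ℂ := fun j => X (nthPrime j) ω / ((nthPrime j : ℕ) : ℂ) with hw
  have hwn : ∀ j, ‖w j‖ = 1 / ((nthPrime j : ℕ) : ℝ) := fun j => by
    rw [hw, norm_div, h1, Complex.norm_natCast]
  have hwh : ∀ j, ‖w j‖ ≤ 1 / 2 := fun j => by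
    rw [hwn]; exact one_div_prime_le_half (nthPrime j).2
  -- Only the linear part ∑ X(p)/p converges conditionally. The remainder of the logarithm is at
  -- most 1/p² and converges absolutely.
  have hes : Summable fun j => Complex.log (1 - w j)⁻¹ - w j := by
    refine Summable.of_norm_bounded summable_one_div_nthPrime_sq fun j => ?_
    have h2 := Complex.norm_log_one_sub_inv_sub_self_le (z := w j) (by linarith [hwh j])
    refine h2.trans ?_
    have h3 : (1 - ‖w j‖)⁻¹ ≤ 2 := by
      rw [inv_le_comm₀ (by linarith [hwh j]) two_pos]; linarith [hwh j]
    calc ‖w j‖ ^ 2 * (1 - ‖w j‖)⁻¹ / 2 ≤ ‖w j‖ ^ 2 * 2 / 2 := by gcongr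
      _ = _ := by rw [hwn, one_div_pow]; ring
  have hlog : Tendsto (fun n => ∑ j ∈ Finset.range n, Complex.log (1 - w j)⁻¹) atTop
      (𝓝 (c + ∑' j, (Complex.log (1 - w j)⁻¹ - w j))) := by
    refine (hc.add hes.hasSum.tendsto_sum_nat).congr fun n => ?_
    rw [← Finset.sum_add_distrib]
    exact Finset.sum_congr rfl fun j _ => by ring
  have hprod : Tendsto (fun n => ∏ j ∈ Finset.range n, (1 - w j)⁻¹) atTop
      (𝓝 (Complex.exp (c + ∑' j, (Complex.log (1 - w j)⁻¹ - w j)))) := by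
    refine ((Complex.continuous_exp.tendsto _).comp hlog).congr fun n => ?_
    simp only [Function.comp_apply]
    rw [Complex.exp_sum]
    refine Finset.prod_congr rfl fun j _ => Complex.exp_log (inv_ne_zero (sub_ne_zero.2 fun h => ?_))
    have h2 := hwh j
    rw [← h, norm_one] at h2
    norm_num at h2
  have hpart : Tendsto (fun N : ℕ => partialProd X N ω) atTop
      (𝓝 (Complex.exp (c + ∑' j, (Complex.log (1 - w j)⁻¹ - w j)))) := by
    have h2 : Tendsto (fun N : ℕ => Nat.count Nat.Prime (N + 1)) atTop atTop :=
      Nat.tendsto_primeCounting'.comp (tendsto_add_atTop_nat 1)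
    refine (hprod.comp h2).congr fun N => ?_
    exact (prod_range_prime_eq (fun p => (1 - X p ω / ((p : ℕ) : ℂ))⁻¹) (N + 1)).symm
  have hL : L1 X ω = Complex.exp (c + ∑' j, (Complex.log (1 - w j)⁻¹ - w j)) := hpart.limUnder_eq
  exact ⟨hL ▸ hpart, hL ▸ Complex.exp_ne_zero _⟩

end

end RandomEuler

/-! ### Passage of moments to the limit. -/

namespace RandomEuler
open Mertens

/-- Convergence of integrals along an almost surely convergent sequence bounded in `L²`. -/
lemma tendsto_integral_of_sq_bound {Ω : Type*} [MeasurableSpace Ω] {μ : Measure Ω} [IsFiniteMeasure μ]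
    {f : ℕ → Ω → ℂ} {g : Ω → ℂ} (hf : ∀ n, AEStronglyMeasurable (f n) μ)
    (hfg : ∀ᵐ ω ∂μ, Tendsto (fun n => f n ω) atTop (𝓝 (g ω))) {M : ℝ}
    (hi : ∀ n, Integrable (fun ω => ‖f n ω‖ ^ 2) μ) (hM : ∀ n, ∫ ω, ‖f n ω‖ ^ 2 ∂μ ≤ M) :
    Integrable g μ ∧ Tendsto (fun n => ∫ ω, f n ω ∂μ) atTop (𝓝 (∫ ω, g ω ∂μ)) := by
  have hM0 : 0 ≤ M := (integral_nonneg fun ω => by positivity).trans (hM 0)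
  have hui : UniformIntegrable f 1 μ := by
    -- Where ‖f‖ ≥ (M+1)/ε one has ‖f‖ ≤ ‖f‖² ε/(M+1), so the L² bound makes the tail integral at
    -- most ε. Vitali's theorem then gives L¹ convergence.
    refine uniformIntegrable_of le_rfl ENNReal.one_ne_top hf fun ε hε => ?_
    have hC : 0 < (M + 1) / ε := by positivity
    refine ⟨((M + 1) / ε).toNNReal, fun n => ?_⟩
    rw [eLpNorm_one_eq_lintegral_enorm]
    calc ∫⁻ ω, ‖{x | ((M + 1) / ε).toNNReal ≤ ‖f n x‖₊}.indicator (f n) ω‖ₑ ∂μ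
        ≤ ∫⁻ ω, ENNReal.ofReal (‖f n ω‖ ^ 2 * (ε / (M + 1))) ∂μ := by
          refine lintegral_mono fun ω => ?_
          by_cases h : ω ∈ {x | ((M + 1) / ε).toNNReal ≤ ‖f n x‖₊}
          · rw [Set.indicator_of_mem h, ← ofReal_norm]
            refine ENNReal.ofReal_le_ofReal ?_
            have h1 : (M + 1) / ε ≤ ‖f n ω‖ := by
              have h2 : ((M + 1) / ε).toNNReal ≤ ‖f n ω‖₊ := h
              rw [Real.toNNReal_le_iff_le_coe] at h2
              exact h2
            rw [sq, mul_assoc]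
            refine le_mul_of_one_le_right (norm_nonneg _) ?_
            rw [div_le_iff₀ hε] at h1
            rw [← mul_div_assoc, le_div_iff₀ (by positivity)]
            linarith
          · rw [Set.indicator_of_notMem h]; simp
      _ = ENNReal.ofReal (∫ ω, ‖f n ω‖ ^ 2 * (ε / (M + 1)) ∂μ) :=
          (ofReal_integral_eq_lintegral_ofReal ((hi n).mul_const _) (ae_of_all _ fun ω => by positivity)).symm
      _ ≤ ENNReal.ofReal ε := by
          refine ENNReal.ofReal_le_ofReal ?_
          rw [integral_mul_const, ← mul_div_assoc, div_le_iff₀ (by positivity)]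
          nlinarith [hM n]
  have hg := hui.integrable_of_ae_tendsto hfg
  refine ⟨hg, tendsto_integral_of_L1' g hg.aestronglyMeasurable (Eventually.of_forall fun n => ?_) ?_⟩
  · exact memLp_one_iff_integrable.1 (hui.memLp n)
  · exact tendsto_Lp_finite_of_tendsto_ae le_rfl ENNReal.one_ne_top hf (memLp_one_iff_integrable.2 hg) hui.unifIntegrable hfg

lemma partialProd_eq {Ω : Type*} (X : Nat.Primes → Ω → ℂ) (N : ℕ) (ω : Ω) :
    partialProd X N ω = ∏ j ∈ Finset.range (Nat.count Nat.Prime (N + 1)), (1 - X (nthPrime j) ω / ((nthPrime j : ℕ) : ℂ))⁻¹ :=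
  prod_range_prime_eq (fun p => (1 - X p ω / ((p : ℕ) : ℂ))⁻¹) (N + 1)

lemma norm_partialProd_rpow {Ω : Type*} (X : Nat.Primes → Ω → ℂ) (ω : Ω) (N : ℕ) (s : ℝ) :
    ‖partialProd X N ω‖ ^ s = ∏ j ∈ Finset.range (Nat.count Nat.Prime (N + 1)),
      ‖1 - X (nthPrime j) ω / ((nthPrime j : ℕ) : ℂ)‖ ^ (-s) := by
  rw [partialProd_eq, norm_prod, ← Real.finsetProd_rpow _ _ fun _ _ => norm_nonneg _]
  refine Finset.prod_congr rfl fun j _ => ?_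
  rw [norm_inv, Real.inv_rpow (norm_nonneg _), Real.rpow_neg (norm_nonneg _)]

lemma norm_partialProd_cpow {Ω : Type*} (X : Nat.Primes → Ω → ℂ) (ω : Ω) (N : ℕ) (s : ℂ) :
    (‖partialProd X N ω‖ : ℂ) ^ s = ∏ j ∈ Finset.range (Nat.count Nat.Prime (N + 1)),
      (‖1 - X (nthPrime j) ω / ((nthPrime j : ℕ) : ℂ)‖ : ℂ) ^ (-s) := by
  rw [partialProd_eq, norm_prod]
  induction Nat.count Nat.Prime (N + 1) with
  | zero => simp
  | succ n ih =>
    rw [Finset.prod_range_succ, Finset.prod_range_succ, Complex.ofReal_mul,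
      Complex.mul_cpow_ofReal_nonneg (Finset.prod_nonneg fun _ _ => norm_nonneg _) (norm_nonneg _), ih,
      norm_inv, Complex.ofReal_inv, Complex.inv_cpow_ofReal_nonneg (norm_nonneg _), Complex.cpow_neg]

section
variable {Ω : Type*} [mΩ : MeasurableSpace Ω] {μ : Measure Ω} {X : Nat.Primes → Ω → ℂ}

lemma IsSteinhaus.aemeasurable_partialProd (hX : IsSteinhaus μ X) (N : ℕ) : AEMeasurable (partialProd X N) μ := by
  have h : partialProd X N = fun ω => ∏ j ∈ Finset.range (Nat.count Nat.Prime (N + 1)),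
      (1 - X (nthPrime j) ω / ((nthPrime j : ℕ) : ℂ))⁻¹ := funext fun ω => partialProd_eq X N ω
  rw [h]
  refine Finset.aemeasurable_fun_prod _ fun j _ => ?_
  exact (((hX.hasLaw (nthPrime j)).aemeasurable.div_const _).const_sub 1).inv

lemma IsSteinhaus.integral_prod_comp {𝕜 : Type*} [RCLike 𝕜] (hX : IsSteinhaus μ X) {f : ℕ → ℂ → 𝕜}
    (hf : ∀ p, Measurable (f p)) (n : ℕ) :
    ∫ ω, ∏ j ∈ Finset.range n, f (nthPrime j : ℕ) (X (nthPrime j) ω) ∂μ =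
      ∏ j ∈ Finset.range n, ∫ x, f (nthPrime j : ℕ) x ∂unifCircle := by
  have hinj : Function.Injective fun j : Fin n => nthPrime j := nthPrime_injective.comp Fin.val_injective
  have h := (hX.indep.precomp hinj).integral_fun_prod_comp (f := fun j : Fin n => f (nthPrime j : ℕ))
    (fun j => (hX.hasLaw _).aemeasurable) (fun j => (hf _).aestronglyMeasurable)
  simp_rw [Finset.prod_range]
  rw [h]
  refine Finset.prod_congr rfl fun j _ => ?_
  exact (hX.hasLaw (nthPrime j)).integral_comp (f := f (nthPrime j : ℕ)) (hf _).aestronglyMeasurable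

lemma IsSteinhaus.integral_norm_partialProd_rpow (hX : IsSteinhaus μ X) (N : ℕ) (s : ℝ) :
    ∫ ω, ‖partialProd X N ω‖ ^ s ∂μ = ∏ j ∈ Finset.range (Nat.count Nat.Prime (N + 1)), localMoment (nthPrime j) s := by
  simp_rw [norm_partialProd_rpow]
  exact hX.integral_prod_comp (f := fun p x => ‖1 - x / (p : ℂ)‖ ^ (-s)) (fun p => measurable_norm_rpow p s) _

lemma IsSteinhaus.integral_norm_partialProd_cpow (hX : IsSteinhaus μ X) (N : ℕ) (s : ℂ) :
    ∫ ω, (‖partialProd X N ω‖ : ℂ) ^ s ∂μ = ∏ j ∈ Finset.range (Nat.count Nat.Prime (N + 1)),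
      ∫ x, (‖1 - x / ((nthPrime j : ℕ) : ℂ)‖ : ℂ) ^ (-s) ∂unifCircle := by
  simp_rw [norm_partialProd_cpow]
  exact hX.integral_prod_comp (f := fun p x => (‖1 - x / (p : ℂ)‖ : ℂ) ^ (-s)) (fun p => by fun_prop) _

lemma prod_localMoment_eq_exp (N : ℕ) (s : ℝ) :
    ∏ j ∈ Finset.range (Nat.count Nat.Prime N), localMoment (nthPrime j) s =
      Real.exp (∑ n ∈ Finset.range N, logMoment s n) := by
  rw [← prod_range_prime_eq (fun p => localMoment p s) N, Real.exp_sum]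
  refine Finset.prod_congr rfl fun n _ => ?_
  split_ifs with hn
  · rw [logMoment, if_pos hn, Real.exp_log (localMoment_pos hn.two_le s)]
  · rw [logMoment, if_neg hn, Real.exp_zero]

lemma IsSteinhaus.integrable_norm_partialProd_rpow [IsProbabilityMeasure μ] (hX : IsSteinhaus μ X) (N : ℕ) (s : ℝ) :
    Integrable (fun ω => ‖partialProd X N ω‖ ^ s) μ := by
  -- A non-integrable function would have integral zero by convention, whereas the product formula
  -- gives an exponential.
  by_contra h
  have h1 := hX.integral_norm_partialProd_rpow N s
  rw [integral_undef h, prod_localMoment_eq_exp] at h1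
  exact (Real.exp_pos _).ne h1

lemma IsSteinhaus.integral_norm_partialProd_rpow_le (hX : IsSteinhaus μ X) {ε : ℝ} (hε : ε = 1 ∨ ε = -1) {k : ℝ}
    (hk : 2 ≤ k) (N : ℕ) :
    ∫ ω, ‖partialProd X N ω‖ ^ (ε * k) ∂μ ≤ Real.exp (∑' n, |logMoment (ε * k) n|) := by
  rw [hX.integral_norm_partialProd_rpow, prod_localMoment_eq_exp, Real.exp_le_exp]
  exact (Finset.sum_le_sum fun n _ => le_abs_self _).trans
    ((summable_logMoment hε hk).abs.sum_le_tsum _ fun n _ => abs_nonneg _)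

lemma rpow_le_rpow_add_rpow_neg {x s k : ℝ} (hx : 0 < x) (hs : |s| ≤ k) : x ^ s ≤ x ^ k + x ^ (-k) := by
  have h := abs_le.1 hs
  rcases le_or_gt 1 x with h1 | h1
  · have := Real.rpow_le_rpow_of_exponent_le h1 h.2
    have : 0 < x ^ (-k) := by positivity
    linarith
  · have := Real.rpow_le_rpow_of_exponent_ge hx h1.le h.1
    have : 0 < x ^ k := by positivity
    linarith

lemma IsSteinhaus.ae_partialProd_ne_zero (hX : IsSteinhaus μ X) : ∀ᵐ ω ∂μ, ∀ N, partialProd X N ω ≠ 0 := by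
  filter_upwards [hX.ae_norm_eq_one] with ω hω N
  rw [partialProd_eq, Finset.prod_ne_zero_iff]
  intro j _
  have h := (norm_one_sub_div_bounds (nthPrime j).2.two_le (hω (nthPrime j))).2.2
  refine inv_ne_zero fun h0 => ?_
  rw [h0, norm_zero] at h
  norm_num at h

/-- The moments of the partial products converge to those of the limit. -/
theorem IsSteinhaus.tendsto_integral_cpow [IsProbabilityMeasure μ] (hX : IsSteinhaus μ X) (s : ℂ) :
    Integrable (fun ω => (‖L1 X ω‖ : ℂ) ^ s) μ ∧
      Tendsto (fun N => ∫ ω, (‖partialProd X N ω‖ : ℂ) ^ s ∂μ) atTop (𝓝 (∫ ω, (‖L1 X ω‖ : ℂ) ^ s ∂μ)) := by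
  -- The square of the modulus has exponent 2 Re s, dominated by the powers k and -k together. The
  -- lower limit 2 is required by `summable_logMoment`.
  set k : ℝ := max 2 |2 * s.re| with hk
  have hk2 : 2 ≤ k := le_max_left _ _
  set M := Real.exp (∑' n, |logMoment (1 * k) n|) + Real.exp (∑' n, |logMoment (-1 * k) n|) with hM
  have hsq : ∀ N, ∀ᵐ ω ∂μ, ‖(‖partialProd X N ω‖ : ℂ) ^ s‖ ^ 2 ≤ ‖partialProd X N ω‖ ^ (1 * k) + ‖partialProd X N ω‖ ^ (-1 * k) := by
    intro N
    filter_upwards [hX.ae_partialProd_ne_zero] with ω hω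
    have h0 : 0 < ‖partialProd X N ω‖ := norm_pos_iff.2 (hω N)
    rw [Complex.norm_cpow_eq_rpow_re_of_pos h0, ← Real.rpow_natCast, ← Real.rpow_mul h0.le, one_mul, neg_one_mul]
    refine rpow_le_rpow_add_rpow_neg h0 ?_
    rw [mul_comm, Nat.cast_ofNat]
    exact le_max_right _ _
  have hmeas : ∀ N, AEStronglyMeasurable (fun ω => (‖partialProd X N ω‖ : ℂ) ^ s) μ := by
    intro N
    have h1 : Measurable fun x : ℂ => (‖x‖ : ℂ) ^ s := by fun_prop
    exact (h1.comp_aemeasurable (hX.aemeasurable_partialProd N)).aestronglyMeasurable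
  have hdom : ∀ N, Integrable (fun ω => ‖partialProd X N ω‖ ^ (1 * k) + ‖partialProd X N ω‖ ^ (-1 * k)) μ := fun N =>
    (hX.integrable_norm_partialProd_rpow N _).add (hX.integrable_norm_partialProd_rpow N _)
  have hi : ∀ N, Integrable (fun ω => ‖(‖partialProd X N ω‖ : ℂ) ^ s‖ ^ 2) μ := by
    intro N
    refine (hdom N).mono' ((hmeas N).norm.pow 2) ?_
    filter_upwards [hsq N] with ω hω
    rw [Real.norm_eq_abs, abs_of_nonneg (by positivity)]
    exact hω
  refine tendsto_integral_of_sq_bound hmeas ?_ hi (M := M) fun N => ?_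
  · filter_upwards [hX.ae_tendsto_L1] with ω ⟨h1, h2⟩
    have h3 : ContinuousAt (fun x : ℂ => (‖x‖ : ℂ) ^ s) (L1 X ω) := by
      have h4 : (‖L1 X ω‖ : ℂ) ∈ Complex.slitPlane := by
        rw [Complex.ofReal_mem_slitPlane]; exact norm_pos_iff.2 h2
      exact (Complex.continuous_ofReal.comp continuous_norm).continuousAt.cpow continuousAt_const h4
    exact h3.tendsto.comp h1
  · calc _ ≤ ∫ ω, (‖partialProd X N ω‖ ^ (1 * k) + ‖partialProd X N ω‖ ^ (-1 * k)) ∂μ :=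
          integral_mono_ae (hi N) (hdom N) (hsq N)
      _ ≤ M := by
          rw [integral_add (hX.integrable_norm_partialProd_rpow N _) (hX.integrable_norm_partialProd_rpow N _)]
          exact add_le_add (hX.integral_norm_partialProd_rpow_le (Or.inl rfl) hk2 N)
            (hX.integral_norm_partialProd_rpow_le (Or.inr rfl) hk2 N)

/-- The real moments of `|L(1,X)|` as a product over the primes. -/
theorem IsSteinhaus.integral_rpow_eq_exp [IsProbabilityMeasure μ] (hX : IsSteinhaus μ X) {ε : ℝ} (hε : ε = 1 ∨ ε = -1)
    {k : ℝ} (hk : 2 ≤ k) :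
    Integrable (fun ω => ‖L1 X ω‖ ^ (ε * k)) μ ∧
      ∫ ω, ‖L1 X ω‖ ^ (ε * k) ∂μ = Real.exp (∑' n, logMoment (ε * k) n) := by
  obtain ⟨h1, h2⟩ := hX.tendsto_integral_cpow ((ε * k : ℝ) : ℂ)
  simp_rw [← Complex.ofReal_cpow (norm_nonneg _)] at h1 h2
  simp_rw [integral_complex_ofReal] at h2
  have h3 := (Complex.continuous_re.tendsto _).comp h2
  simp only [Function.comp_def, Complex.ofReal_re] at h3
  refine ⟨by simpa using h1.re, tendsto_nhds_unique h3 ?_⟩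
  simp_rw [hX.integral_norm_partialProd_rpow, prod_localMoment_eq_exp]
  exact (Real.continuous_exp.tendsto _).comp ((summable_logMoment hε hk).hasSum.tendsto_sum_nat.comp (tendsto_add_atTop_nat 1))

end

end RandomEuler

/-! ### Complex moments and the Dirichlet series with coefficients d_z(n)². -/

namespace RandomEuler
open scoped ComplexConjugate
open Mertens

/-- The coefficient `z (z+1) ⋯ (z+a-1) / a!` of the binomial series. -/
noncomputable def dzCoeff (z : ℂ) (a : ℕ) : ℂ := (ascPochhammer ℂ a).eval z / (a.factorial : ℂ)

lemma dzCoeff_eq_choose (z : ℂ) (a : ℕ) : dzCoeff z a = Ring.choose (z + a - 1) a := by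
  rw [← Ring.multichoose_eq, dzCoeff, div_eq_iff (by exact_mod_cast a.factorial_ne_zero), mul_comm, ← nsmul_eq_mul,
    Ring.factorial_nsmul_multichoose_eq_ascPochhammer, ← ascPochhammer_map (Nat.castRingHom ℂ),
    Polynomial.eval_map, ← Polynomial.eval₂_smulOneHom_eq_smeval]
  congr 1
  exact Subsingleton.elim _ _

lemma hasSum_dzCoeff (z : ℂ) {w : ℂ} (hw : ‖w‖ < 1) : HasSum (fun a => dzCoeff z a * w ^ a) ((1 - w) ^ (-z)) := by
  have h := (Complex.one_div_one_sub_cpow_hasFPowerSeriesOnBall_zero z).hasSum (y := w) (by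
    simpa [Metric.eball, edist_zero_right, ← ofReal_norm] using hw)
  rw [zero_add, one_div, ← Complex.cpow_neg] at h
  refine h.congr_fun fun a => ?_
  rw [FormalMultilinearSeries.ofScalars_apply_eq, dzCoeff_eq_choose, smul_eq_mul]

/-- For |w| < 1 the number 1 - w lies in the slit plane, so the principal logarithms of 1 - w and
its conjugate are conjugate and add up to 2 log|1 - w|. -/
lemma ofReal_norm_cpow_eq {w : ℂ} (hw : ‖w‖ < 1) (z : ℂ) :
    (‖1 - w‖ : ℂ) ^ (-(2 * z)) = (1 - w) ^ (-z) * (1 - conj w) ^ (-z) := by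
  have hs : 1 - w ∈ Complex.slitPlane := by
    rw [sub_eq_add_neg]
    exact Complex.mem_slitPlane_of_norm_lt_one (by rwa [norm_neg])
  have h0 : 1 - w ≠ 0 := Complex.slitPlane_ne_zero hs
  have hc : 1 - conj w = conj (1 - w) := by simp
  have hc0 : conj (1 - w) ≠ 0 := (map_ne_zero _).2 h0
  have harg : (1 - w).arg ≠ Real.pi := (Complex.mem_slitPlane_iff_arg.1 hs).1
  have hn : (‖1 - w‖ : ℂ) ≠ 0 := by exact_mod_cast (norm_pos_iff.2 h0).ne'
  rw [hc, Complex.cpow_def_of_ne_zero hn, Complex.cpow_def_of_ne_zero h0, Complex.cpow_def_of_ne_zero hc0,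
    Complex.log_conj _ harg, ← Complex.exp_add, ← add_mul, Complex.add_conj, Complex.log_re]
  congr 1
  push_cast
  rw [Complex.ofReal_log (norm_nonneg _)]
  ring

lemma summable_norm_dzCoeff (z : ℂ) {p : ℕ} (hp : 2 ≤ p) : Summable fun a => ‖dzCoeff z a * ((p : ℂ)⁻¹) ^ a‖ := by
  have h2 : (2 : ℝ) ≤ p := by exact_mod_cast hp
  refine (hasSum_dzCoeff z (w := (p : ℂ)⁻¹) ?_).summable.norm
  rw [norm_inv, Complex.norm_natCast]
  exact inv_lt_one_of_one_lt₀ (by linarith)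

/-- The local factor of the Euler product. -/
lemma integral_local_factor (z : ℂ) {p : ℕ} (hp : 2 ≤ p) :
    ∫ x, (‖1 - x / (p : ℂ)‖ : ℂ) ^ (-(2 * z)) ∂unifCircle = ∑' a, dzCoeff z a ^ 2 / ((p ^ a : ℕ) : ℂ) ^ 2 := by
  have h2 : (2 : ℝ) ≤ p := by exact_mod_cast hp
  have hs := summable_norm_dzCoeff z hp
  have h := integral_tsum_mul_tsum_conj hs hs
  have h3 : ∑' a, dzCoeff z a ^ 2 / ((p ^ a : ℕ) : ℂ) ^ 2 =
      ∑' a, dzCoeff z a * ((p : ℂ)⁻¹) ^ a * (dzCoeff z a * ((p : ℂ)⁻¹) ^ a) := by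
    refine tsum_congr fun a => ?_
    push_cast
    rw [inv_pow, div_eq_mul_inv, ← inv_pow]
    ring
  rw [h3, ← h]
  refine integral_congr_ae ?_
  filter_upwards [ae_norm_eq_one] with x hx
  have hw : ‖x / (p : ℂ)‖ < 1 := by
    rw [norm_div, hx, Complex.norm_natCast, div_lt_one (by linarith)]; linarith
  have hw2 : ‖conj (x / (p : ℂ))‖ < 1 := by rwa [RCLike.norm_conj]
  rw [ofReal_norm_cpow_eq hw, ← (hasSum_dzCoeff z hw).tsum_eq, ← (hasSum_dzCoeff z hw2).tsum_eq]
  congr 1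
  · exact tsum_congr fun a => by rw [div_eq_mul_inv, mul_pow]; ring
  · refine tsum_congr fun a => ?_
    rw [map_div₀, Complex.conj_natCast, div_eq_mul_inv, mul_pow]
    ring

lemma dz_one (z : ℂ) : dz z 1 = 1 := by simp [dz]

lemma dz_prime_pow (z : ℂ) {p : ℕ} (hp : p.Prime) (a : ℕ) : dz z (p ^ a) = dzCoeff z a := by
  rw [dz, if_neg (pow_ne_zero _ hp.ne_zero), hp.factorization_pow, Finsupp.prod_single_index]
  · rfl
  · simp

lemma dz_mul_of_coprime (z : ℂ) {m n : ℕ} (h : m.Coprime n) : dz z (m * n) = dz z m * dz z n := by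
  rcases eq_or_ne m 0 with rfl | hm
  · simp [dz]
  rcases eq_or_ne n 0 with rfl | hn
  · simp [dz]
  rw [dz, dz, dz, if_neg hm, if_neg hn, if_neg (mul_ne_zero hm hn), Nat.factorization_mul_of_coprime h,
    Finsupp.prod_add_index_of_disjoint]
  simpa using h.disjoint_primeFactors

lemma ascPochhammer_eval_eq_prod (z : ℂ) (a : ℕ) : (ascPochhammer ℂ a).eval z = ∏ i ∈ Finset.range a, (z + i) := by
  induction a with
  | zero => simp
  | succ a ih => rw [ascPochhammer_succ_eval, ih, Finset.prod_range_succ]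

/-- Factor by factor |z + i| ≤ r + i. This reduces absolute convergence to real parameters, where
all coefficients are non-negative. -/
lemma norm_dzCoeff_le (z : ℂ) {r : ℝ} (hr : ‖z‖ ≤ r) (a : ℕ) : ‖dzCoeff z a‖ ≤ ‖dzCoeff r a‖ := by
  have hr0 : 0 ≤ r := (norm_nonneg _).trans hr
  rw [dzCoeff, dzCoeff, norm_div, norm_div, ascPochhammer_eval_eq_prod, ascPochhammer_eval_eq_prod,
    norm_prod, norm_prod]
  gcongr with i _
  calc ‖z + i‖ ≤ ‖z‖ + i := (norm_add_le _ _).trans (by rw [Complex.norm_natCast])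
    _ ≤ r + i := by gcongr
    _ = ‖(r : ℂ) + i‖ := by
      rw [← Complex.ofReal_natCast, ← Complex.ofReal_add, Complex.norm_real, Real.norm_eq_abs, abs_of_nonneg (by positivity)]

lemma norm_dz_le (z : ℂ) {r : ℝ} (hr : ‖z‖ ≤ r) (n : ℕ) : ‖dz z n‖ ≤ ‖dz r n‖ := by
  rcases eq_or_ne n 0 with rfl | hn
  · simp [dz]
  rw [dz, dz, if_neg hn, if_neg hn, Finsupp.prod, Finsupp.prod, norm_prod, norm_prod]
  gcongr with i _
  exact norm_dzCoeff_le z hr _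

lemma norm_dzCoeff_ofReal {r : ℝ} (hr : 0 ≤ r) (a : ℕ) : (‖dzCoeff r a‖ : ℂ) = dzCoeff r a := by
  have h : dzCoeff r a = (((∏ i ∈ Finset.range a, (r + i)) / a.factorial : ℝ) : ℂ) := by
    rw [dzCoeff, ascPochhammer_eval_eq_prod]
    push_cast
    rfl
  rw [h, Complex.norm_real, Real.norm_eq_abs, abs_of_nonneg]
  exact div_nonneg (Finset.prod_nonneg fun i _ => by positivity) (by positivity)

/-- The general term of the moment series. -/
noncomputable def dzTerm (z : ℂ) (n : ℕ) : ℂ := dz z n ^ 2 / (n : ℂ) ^ 2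

lemma dzTerm_mul_of_coprime (z : ℂ) {m n : ℕ} (h : m.Coprime n) : dzTerm z (m * n) = dzTerm z m * dzTerm z n := by
  rw [dzTerm, dzTerm, dzTerm, dz_mul_of_coprime z h]
  push_cast
  rw [mul_pow, mul_pow, mul_div_mul_comm]

lemma dzTerm_prime_pow (z : ℂ) {p : ℕ} (hp : p.Prime) (a : ℕ) :
    dzTerm z (p ^ a) = dzCoeff z a ^ 2 / ((p ^ a : ℕ) : ℂ) ^ 2 := by
  rw [dzTerm, dz_prime_pow z hp]

lemma summable_norm_dzTerm_prime_pow (z : ℂ) {p : ℕ} (hp : p.Prime) : Summable fun a : ℕ => ‖dzTerm z (p ^ a)‖ := by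
  have hs := summable_norm_dzCoeff z hp.two_le
  -- The local series of squares is the diagonal of the absolutely convergent product of the
  -- binomial series with itself.
  refine (summable_mul_of_summable_norm hs hs |>.norm.comp_injective (i := fun a : ℕ => (a, a))
    (fun _ _ h => (Prod.mk.inj h).1)).congr fun a => ?_
  rw [dzTerm_prime_pow z hp]
  simp only [Function.comp_apply]
  congr 1
  push_cast
  rw [inv_pow, div_eq_mul_inv, ← inv_pow]
  ring

/-- For r ≥ 0 the terms equal their norms, so the local series of norms is the Parseval expression
of the local moment. -/
lemma tsum_norm_dzTerm_prime_pow {r : ℝ} (hr : 0 ≤ r) {p : ℕ} (hp : p.Prime) :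
    ∑' a : ℕ, ‖dzTerm r (p ^ a)‖ = localMoment p (2 * r) := by
  have h1 : ((∑' a : ℕ, ‖dzTerm r (p ^ a)‖ : ℝ) : ℂ) = ((localMoment p (2 * r) : ℝ) : ℂ) := by
    rw [Complex.ofReal_tsum, localMoment, ← integral_complex_ofReal]
    have h2 : ∀ x : ℂ, ((‖1 - x / (p : ℂ)‖ ^ (-(2 * r)) : ℝ) : ℂ) = (‖1 - x / (p : ℂ)‖ : ℂ) ^ (-(2 * (r : ℂ))) := by
      intro x
      rw [Complex.ofReal_cpow (norm_nonneg _)]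
      push_cast
      rfl
    simp_rw [h2]
    rw [integral_local_factor _ hp.two_le]
    refine tsum_congr fun a => ?_
    rw [dzTerm_prime_pow _ hp, norm_div, norm_pow, norm_pow, Complex.norm_natCast]
    push_cast
    rw [norm_dzCoeff_ofReal hr]
  exact_mod_cast h1

/-- Every n with 0 < n < N has only prime factors below N, so it occurs in the expansion of the
finite Euler product. -/
lemma sum_range_norm_dzTerm_le (r : ℝ) (N : ℕ) : ∑ n ∈ Finset.range N, ‖dzTerm (r : ℂ) n‖ ≤
    ∏ p ∈ N.primesBelow, ∑' a : ℕ, ‖dzTerm (r : ℂ) (p ^ a)‖ := by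
  have h0 : ‖dzTerm (r : ℂ) 1‖ = 1 := by simp [dzTerm, dz_one]
  have hm : ∀ {m n : ℕ}, m.Coprime n → ‖dzTerm (r : ℂ) (m * n)‖ = ‖dzTerm (r : ℂ) m‖ * ‖dzTerm (r : ℂ) n‖ :=
    fun h => by rw [dzTerm_mul_of_coprime _ h, norm_mul]
  have hs : ∀ {p : ℕ}, p.Prime → Summable fun a : ℕ => ‖‖dzTerm (r : ℂ) (p ^ a)‖‖ := fun hp => by
    simp_rw [norm_norm]
    exact summable_norm_dzTerm_prime_pow _ hp
  have h1 := (EulerProduct.summable_and_hasSum_smoothNumbers_prod_primesBelow_tsum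
    (f := fun n => ‖dzTerm (r : ℂ) n‖) h0 hm hs N).2
  have h2 := (hasSum_subtype_iff_indicator (f := fun n => ‖dzTerm (r : ℂ) n‖)).1 h1
  calc ∑ n ∈ Finset.range N, ‖dzTerm (r : ℂ) n‖
      = ∑ n ∈ Finset.range N, (N.smoothNumbers).indicator (fun n => ‖dzTerm (r : ℂ) n‖) n := by
        refine Finset.sum_congr rfl fun n hn => ?_
        rcases eq_or_ne n 0 with rfl | hn0
        · have hz : ‖dzTerm (r : ℂ) 0‖ = 0 := by simp [dzTerm]
          rw [Set.indicator_apply, hz, ite_self]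
        · rw [Set.indicator_of_mem]
          exact Nat.mem_smoothNumbers_of_lt (Nat.pos_of_ne_zero hn0) (Finset.mem_range.1 hn)
    _ ≤ _ := sum_le_hasSum _ (fun n _ => Set.indicator_nonneg (fun _ _ => norm_nonneg _) n) h2

/-- The finite Euler products are products of local moments of order 2r, bounded uniformly because
`logMoment` is absolutely summable. The assumption r ≥ 1 gives the order at least 2 needed there. -/
lemma summable_norm_dzTerm_ofReal {r : ℝ} (hr : 1 ≤ r) : Summable fun n => ‖dzTerm (r : ℂ) n‖ := by
  have hsum : Summable (logMoment (1 * (2 * r))) := summable_logMoment (Or.inl rfl) (by linarith)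
  refine summable_of_sum_range_le (fun _ => norm_nonneg _) (c := Real.exp (∑' n, |logMoment (1 * (2 * r)) n|)) fun N => ?_
  refine (sum_range_norm_dzTerm_le r N).trans ?_
  have h : ∏ p ∈ N.primesBelow, ∑' a : ℕ, ‖dzTerm (r : ℂ) (p ^ a)‖ =
      Real.exp (∑ n ∈ Finset.range N, logMoment (1 * (2 * r)) n) := by
    rw [← prod_localMoment_eq_exp, ← prod_range_prime_eq (fun p => localMoment p (1 * (2 * r))), Nat.primesBelow,
      Finset.prod_filter]
    refine Finset.prod_congr rfl fun p _ => ?_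
    split_ifs with hp
    · rw [tsum_norm_dzTerm_prime_pow (by linarith) hp, one_mul]
    · rfl
  rw [h, Real.exp_le_exp]
  exact (Finset.sum_le_sum fun n _ => le_abs_self _).trans (hsum.abs.sum_le_tsum _ fun n _ => abs_nonneg _)

theorem summable_norm_dzTerm (z : ℂ) : Summable fun n => ‖dzTerm z n‖ := by
  refine Summable.of_nonneg_of_le (fun _ => norm_nonneg _) (fun n => ?_)
    (summable_norm_dzTerm_ofReal (le_max_left 1 ‖z‖))
  rw [dzTerm, dzTerm, norm_div, norm_div, norm_pow (dz z n), norm_pow (dz _ n)]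
  gcongr
  exact norm_dz_le z (le_max_right _ _) n

/-- The complex moments of `|L(1,X)|`. -/
theorem IsSteinhaus.hasSum_moment {Ω : Type*} [MeasurableSpace Ω] {μ : Measure Ω} [IsProbabilityMeasure μ]
    {X : Nat.Primes → Ω → ℂ} (hX : IsSteinhaus μ X) (z : ℂ) :
    HasSum (dzTerm z) (∫ ω, (‖L1 X ω‖ : ℂ) ^ (2 * z) ∂μ) := by
  have h1 := (hX.tendsto_integral_cpow (2 * z)).2
  have h2 := (EulerProduct.eulerProduct (f := dzTerm z) (by simp [dzTerm, dz_one])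
    (fun h => dzTerm_mul_of_coprime z h) (summable_norm_dzTerm z) (by simp [dzTerm])).comp (tendsto_add_atTop_nat 1)
  have h3 : ∫ ω, (‖L1 X ω‖ : ℂ) ^ (2 * z) ∂μ = ∑' n, dzTerm z n := by
    refine tendsto_nhds_unique h1 (h2.congr fun N => ?_)
    rw [hX.integral_norm_partialProd_cpow,
      ← prod_range_prime_eq (fun p => ∫ x, (‖1 - x / ((p : ℕ) : ℂ)‖ : ℂ) ^ (-(2 * z)) ∂unifCircle)]
    simp only [Function.comp_apply]
    rw [Nat.primesBelow, Finset.prod_filter]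
    refine Finset.prod_congr rfl fun p _ => ?_
    split_ifs with hp
    · rw [integral_local_factor z hp.two_le]
      exact tsum_congr fun a => dzTerm_prime_pow z hp a
    · rfl
  rw [h3]
  exact (summable_norm_dzTerm z).of_norm.hasSum

end RandomEuler

/-! ### The two tails and the final assembly. -/

namespace RandomEuler
open Mertens

lemma IsSteinhaus.aemeasurable_L1 {Ω : Type*} [MeasurableSpace Ω] {μ : Measure Ω} [IsProbabilityMeasure μ]
    {X : Nat.Primes → Ω → ℂ} (hX : IsSteinhaus μ X) : AEMeasurable (L1 X) μ :=
  aemeasurable_of_tendsto_metrizable_ae atTop hX.aemeasurable_partialProd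
    (hX.ae_tendsto_L1.mono fun _ h => h.1)

/-- The two-sided tail of `log |L(1,X)|`, the sign `ε` selecting the side. -/
theorem exists_log_norm_L1_tail {ε : ℝ} (hε : ε = 1 ∨ ε = -1) :
    ∃ A : ℝ, 0 < A ∧ ∀ (Ω : Type*) [MeasurableSpace Ω] (μ : Measure Ω) [IsProbabilityMeasure μ]
      (X : Nat.Primes → Ω → ℂ), IsSteinhaus μ X → ∀ τ : ℝ, 1 ≤ τ →
        HasAsymptotic A τ (μ.real {ω | eulerConst ε + Real.log τ ≤ ε * Real.log ‖L1 X ω‖}) := by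
  obtain ⟨C, hC, hmom⟩ := exists_tsum_logMoment_sub_le hε
  obtain ⟨A, hA, htail⟩ := TailBound.exists_tail_asymptotic (eulerConst ε) (constC - Real.log 2) hC
  refine ⟨A, hA, fun Ω _ μ _ X hX τ hτ => ?_⟩
  have hexp : ∀ k : ℝ, (fun ω => ‖L1 X ω‖ ^ (ε * k)) =ᵐ[μ] fun ω => Real.exp (k * (ε * Real.log ‖L1 X ω‖)) := fun k => by
    filter_upwards [hX.ae_tendsto_L1] with ω hω
    rw [Real.rpow_def_of_pos (norm_pos_iff.2 hω.2)]
    ring_nf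
  have hk2 : ∀ k : ℝ, Real.exp 2 ≤ k → 2 ≤ k := fun k hk => by linarith [Real.add_one_le_exp (2 : ℝ)]
  obtain ⟨E, hE, h⟩ := htail Ω μ (fun ω => ε * Real.log ‖L1 X ω‖)
    ((Real.measurable_log.comp_aemeasurable hX.aemeasurable_L1.norm).const_mul ε)
    (fun k hk => (hX.integral_rpow_eq_exp hε (hk2 k hk)).1.congr (hexp k))
    (fun k hk => by
      rw [← integral_congr_ae (hexp k), (hX.integral_rpow_eq_exp hε (hk2 k hk)).2, Real.log_exp]
      exact hmom k hk) τ hτ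
  refine ⟨E, hE, h.trans ?_⟩
  -- With b = C - log 2 the exponential e^{τ-b-1} is 2e^{τ-C-1}, the source of the factor 2 in the
  -- theorem.
  rw [show τ - (constC - Real.log 2) - 1 = (τ - constC - 1) + Real.log 2 by ring, Real.exp_add,
    Real.exp_log two_pos, mul_comm (Real.exp _) 2]

lemma HasAsymptotic.mono {A B τ P : ℝ} (h : HasAsymptotic A τ P) (hAB : A ≤ B) : HasAsymptotic B τ P := by
  obtain ⟨E, hE, hP⟩ := h
  exact ⟨E, hE.trans (div_le_div_of_nonneg_right hAB (Real.sqrt_nonneg _)), hP⟩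

/-- Taking logarithms is legitimate off a null set, because L(1,X) is almost surely non-zero. -/
lemma IsSteinhaus.phi_eq {Ω : Type*} [MeasurableSpace Ω] {μ : Measure Ω} [IsProbabilityMeasure μ]
    {X : Nat.Primes → Ω → ℂ} (hX : IsSteinhaus μ X) {τ : ℝ} (hτ : 0 < τ) :
    Phi μ X τ = μ.real {ω | eulerConst 1 + Real.log τ ≤ 1 * Real.log ‖L1 X ω‖} := by
  refine measureReal_congr (hX.ae_tendsto_L1.mono fun ω hω => propext ?_)
  change Real.exp Real.eulerMascheroniConstant * τ ≤ ‖L1 X ω‖ ↔ eulerConst 1 + Real.log τ ≤ 1 * Real.log ‖L1 X ω‖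
  rw [eulerConst, if_pos rfl, sub_zero, one_mul, Real.le_log_iff_exp_le (norm_pos_iff.2 hω.2), Real.exp_add,
    Real.exp_log hτ]

lemma IsSteinhaus.psi_eq {Ω : Type*} [MeasurableSpace Ω] {μ : Measure Ω} [IsProbabilityMeasure μ]
    {X : Nat.Primes → Ω → ℂ} (hX : IsSteinhaus μ X) {τ : ℝ} (hτ : 0 < τ) :
    Psi μ X τ = μ.real {ω | eulerConst (-1) + Real.log τ ≤ -1 * Real.log ‖L1 X ω‖} := by
  refine measureReal_congr (hX.ae_tendsto_L1.mono fun ω hω => propext ?_)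
  change ‖L1 X ω‖ ≤ Real.pi ^ 2 / (6 * Real.exp Real.eulerMascheroniConstant * τ) ↔
    eulerConst (-1) + Real.log τ ≤ -1 * Real.log ‖L1 X ω‖
  have hpi : 0 < Real.pi ^ 2 / 6 := by positivity
  have h : Real.pi ^ 2 / (6 * Real.exp Real.eulerMascheroniConstant * τ) =
      Real.exp (Real.log (Real.pi ^ 2 / 6) - Real.eulerMascheroniConstant - Real.log τ) := by
    rw [Real.exp_sub, Real.exp_sub, Real.exp_log hpi, Real.exp_log hτ, div_div, div_div, mul_assoc]
  rw [h, ← Real.log_le_iff_le_exp (norm_pos_iff.2 hω.2), eulerConst, if_neg (by norm_num)]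
  constructor <;> intro h <;> linarith

end RandomEuler

theorem mainTheorem6 :
    ∃ A : ℝ, 0 < A ∧
      ∀ (Ω : Type*) [MeasurableSpace Ω] (μ : MeasureTheory.Measure Ω)
        [MeasureTheory.IsProbabilityMeasure μ] (X : Nat.Primes → Ω → ℂ),
        RandomEuler.IsSteinhaus μ X →
          (∀ᵐ ω ∂μ, Filter.Tendsto (fun N : ℕ => RandomEuler.partialProd X N ω) Filter.atTop
            (nhds (RandomEuler.L1 X ω))) ∧
          (∀ τ : ℝ, 1 ≤ τ →
            RandomEuler.HasAsymptotic A τ (RandomEuler.Phi μ X τ) ∧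
            RandomEuler.HasAsymptotic A τ (RandomEuler.Psi μ X τ)) ∧
          (∀ z : ℂ,
            MeasureTheory.Integrable (fun ω => (‖RandomEuler.L1 X ω‖ : ℂ) ^ (2 * z)) μ ∧
            HasSum (fun n : ℕ => RandomEuler.dz z n ^ 2 / (n : ℂ) ^ 2)
              (∫ ω, (‖RandomEuler.L1 X ω‖ : ℂ) ^ (2 * z) ∂μ)) := by
  obtain ⟨A₁, hA₁, h₁⟩ := RandomEuler.exists_log_norm_L1_tail (Or.inl rfl)
  obtain ⟨A₂, _, h₂⟩ := RandomEuler.exists_log_norm_L1_tail (Or.inr rfl)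
  refine ⟨max A₁ A₂, lt_max_of_lt_left hA₁, fun Ω _ μ _ X hX => ⟨hX.ae_tendsto_L1.mono fun _ h => h.1,
    fun τ hτ => ⟨?_, ?_⟩, fun z => ⟨(hX.tendsto_integral_cpow (2 * z)).1, hX.hasSum_moment z⟩⟩⟩
  · rw [hX.phi_eq (zero_lt_one.trans_le hτ)]
    exact (h₁ Ω μ X hX τ hτ).mono (le_max_left _ _)
  · rw [hX.psi_eq (zero_lt_one.trans_le hτ)]
    exact (h₂ Ω μ X hX τ hτ).mono (le_max_right _ _)
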